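/- Let $n\ge 1$, let $\Omega\subset\mathbb R^n$ be a smooth bounded domain (nonempty, open, connected) with outward unit normal $\nu$, and write $\langle h\rangle_\Omega=\frac1{|\Omega|}\int_\Omega h\,dx$. Let $f\in C^\infty(\mathbb R)$ satisfy $f(\pm1)=0$, $f'(\pm1)<0$, $\int_{-1}^u f=\int_1^u f<0$ for all $u\in(-1,1)$, $\lim_{u\to\pm\infty}f(u)=\mp\infty$, and, for some $M>0$, $u f''(u)\le 0$ whenever $|u|\ge M$. Let $k$ be an integer with $k>\max\{4,n\}$, let $T>0$ and $C^*>0$, and put $\Omega_T=\Omega\times[0,T]$. Then there are constants $C>0$ and $\varepsilon_0\in(0,1]$, depending only on $n,\Omega,f,k,T,C^*$, such that the following holds. Let $u^\varepsilon_k$ $(0<\varepsilon\le 1)$ be functions of class $C^{2,1}(\overline\Omega\times[0,T])$ and $\lambda^\varepsilon_k:[0,T]\to\mathbb R$ functions such that, for every $\varepsilon\in(0,1]$, $$\int_\Omega \partial_t u^\varepsilon_k(x,t)\,dx=0\quad\forall t\in[0,T],\qquad \partial_\nu u^\varepsilon_k=0\ \text{ on }\partial\Omega\times[0,T],\qquad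 \|u^\varepsilon_k\|_{L^\infty(\Omega_T)}\le 2,$$ and such that the residual $$\delta^\varepsilon_k:=\partial_t u^\varepsilon_k-\Delta u^\varepsilon_k-\varepsilon^{-2}\big(f(u^\varepsilon_k)-\varepsilon\lambda^\varepsilon_k\big)\ \text{ in }\Omega_T$$ belongs to $L^2(\Omega_T)$ with $\|\delta^\varepsilon_k\|_{L^2(\Omega_T)}\le\varepsilon^k$. Suppose that $$\int_\Omega\big(|\nabla\phi|^2-\varepsilon^{-2}f'(u^\varepsilon_k(\cdot,t))\,\phi^2\big)\,dx\ \ge\ -C^*$$ for all $t\in(0,T]$, all $\varepsilon\in(0,1]$ and all $\phi\in H^1(\Omega)$ with $\int_\Omega\phi=0$ and $\int_\Omega\phi^2=1$. For every $\varepsilon\in(0,1]$ let $\phi^\varepsilon\in L^2(\Omega)$ satisfy $\int_\Omega\phi^\varepsilon=0$ and $\|\phi^\varepsilon\|_{L^2(\Omega)}\le\varepsilon^k$, and let $u^\varepsilon$ be a classical solution, of class $C^{2,1}(\overline\Omega\times(0,T])$, of $$u^\varepsilon_t=\Delta u^\varepsilon+\varepsilon^{-2}\Big(f(u^\varepsilon)-\langle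 f(u^\varepsilon)\rangle_\Omega\Big)\ \text{ in }\Omega\times(0,T],\qquad \partial_\nu u^\varepsilon=0\ \text{ on }\partial\Omega\times(0,T],$$ with initial value $u^\varepsilon(\cdot,0)=u^\varepsilon_k(\cdot,0)+\phi^\varepsilon$, attained in the sense that $u^\varepsilon(\cdot,t)\to u^\varepsilon(\cdot,0)$ in $L^2(\Omega)$ as $t\searrow0$. Then for all $\varepsilon\in(0,\varepsilon_0)$, $$\sup_{0\le t\le T}\|u^\varepsilon(\cdot,t)-u^\varepsilon_k(\cdot,t)\|_{L^2(\Omega)}\le C\,\varepsilon^k .$$ -/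

import Mathlib

open MeasureTheory Set Filter Topology
open scoped ContDiff RealInnerProductSpace ENNReal

/-- `ρ` is a smooth local defining function of `Ω` on the open set `U`: it has no critical point
in `U`, and inside `U` the set `Ω` is exactly `{ρ < 0}` (so that `∂Ω ∩ U = {ρ = 0} ∩ U`, and `Ω`
lies on one side of its boundary). -/
structure IsLocalDefiningFunction {n : ℕ} (Ω U : Set (EuclideanSpace ℝ (Fin n)))
    (ρ : EuclideanSpace ℝ (Fin n) → ℝ) : Prop where
  isOpen : IsOpen U
  contDiffOn : ContDiffOn ℝ ∞ ρ U
  gradient_ne_zero : ∀ y ∈ U, gradient ρ y ≠ 0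
  mem_iff : ∀ y ∈ U, (y ∈ Ω ↔ ρ y < 0)

/-- A smooth bounded domain of `ℝⁿ`: a nonempty connected bounded open set whose boundary is,
locally, a regular level set of a smooth function, with the set on one side of it. -/
structure IsSmoothBoundedDomain {n : ℕ} (Ω : Set (EuclideanSpace ℝ (Fin n))) : Prop where
  isOpen : IsOpen Ω
  isConnected : IsConnected Ω
  isBounded : Bornology.IsBounded Ω
  smooth_boundary : ∀ x ∈ frontier Ω, ∃ U ρ, x ∈ U ∧ IsLocalDefiningFunction Ω U ρ

/-- `ν` is the outward unit normal to `∂Ω` at the boundary point `x`. -/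
def IsOutwardNormal {n : ℕ} (Ω : Set (EuclideanSpace ℝ (Fin n)))
    (x ν : EuclideanSpace ℝ (Fin n)) : Prop :=
  x ∈ frontier Ω ∧ ∃ U ρ, x ∈ U ∧ IsLocalDefiningFunction Ω U ρ ∧
    ν = ‖gradient ρ x‖⁻¹ • gradient ρ x

/-- The standing assumptions on the nonlinearity `f`: smooth, `-f` is the derivative of a double
well potential with wells of equal depth at `±1`, and the behaviour at infinity that is assumed
for the error estimate. -/
structure IsBistable (f : ℝ → ℝ) : Prop where
  contDiff : ContDiff ℝ ∞ f
  zero_one : f 1 = 0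
  zero_neg_one : f (-1) = 0
  deriv_one : deriv f 1 < 0
  deriv_neg_one : deriv f (-1) < 0
  wells : ∀ u ∈ Ioo (-1 : ℝ) 1,
    (∫ s in (-1 : ℝ)..u, f s) = (∫ s in (1 : ℝ)..u, f s) ∧ (∫ s in (-1 : ℝ)..u, f s) < 0
  tendsto_atTop : Tendsto f atTop atBot
  tendsto_atBot : Tendsto f atBot atTop
  concavity : ∃ M : ℝ, 0 < M ∧ ∀ u : ℝ, M ≤ |u| → u * deriv (deriv f) u ≤ 0

/-- The class `C^{2,1}` on `closure Ω × I`: `u t x` is continuous there together with its first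
time derivative and its space derivatives up to order two. The time derivative is one-sided at
endpoints of `I`, and the space derivatives are taken within `closure Ω`. -/
structure IsC21 {n : ℕ} (Ω : Set (EuclideanSpace ℝ (Fin n))) (I : Set ℝ)
    (u : ℝ → EuclideanSpace ℝ (Fin n) → ℝ) : Prop where
  contDiffOn_space : ∀ t ∈ I, ContDiffOn ℝ 2 (u t) (closure Ω)
  differentiableOn_time : ∀ x ∈ closure Ω, DifferentiableOn ℝ (fun s => u s x) I
  continuousOn : ContinuousOn
    (fun p : ℝ × EuclideanSpace ℝ (Fin n) => u p.1 p.2) (I ×ˢ closure Ω)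
  continuousOn_time_deriv : ContinuousOn
    (fun p : ℝ × EuclideanSpace ℝ (Fin n) => derivWithin (fun s => u s p.2) I p.1)
    (I ×ˢ closure Ω)
  continuousOn_space_deriv : ContinuousOn
    (fun p : ℝ × EuclideanSpace ℝ (Fin n) => fderivWithin ℝ (u p.1) (closure Ω) p.2)
    (I ×ˢ closure Ω)
  continuousOn_space_deriv₂ : ContinuousOn
    (fun p : ℝ × EuclideanSpace ℝ (Fin n) =>
      fderivWithin ℝ (fderivWithin ℝ (u p.1) (closure Ω)) (closure Ω) p.2)
    (I ×ˢ closure Ω)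

/-- The no flux condition `∂_ν u = 0` on `∂Ω × I`. -/
def NoFlux {n : ℕ} (Ω : Set (EuclideanSpace ℝ (Fin n))) (I : Set ℝ)
    (u : ℝ → EuclideanSpace ℝ (Fin n) → ℝ) : Prop :=
  ∀ t ∈ I, ∀ x ν, IsOutwardNormal Ω x ν → fderivWithin ℝ (u t) (closure Ω) x ν = 0

/-- `u` is a classical solution, for times in `(0, T]`, of the mass conserved Allen-Cahn equation
`u_t = Δu + ε⁻² (f(u) - ⨍_Ω f(u))` in `Ω`, `∂_ν u = 0` on `∂Ω`, with initial value `g`. The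
initial value is attained in the sense of `L²(Ω)`. -/
structure IsSolution {n : ℕ} (Ω : Set (EuclideanSpace ℝ (Fin n))) (f : ℝ → ℝ) (ε T : ℝ)
    (g : EuclideanSpace ℝ (Fin n) → ℝ) (u : ℝ → EuclideanSpace ℝ (Fin n) → ℝ) : Prop where
  regular : IsC21 Ω (Ioc 0 T) u
  equation : ∀ t ∈ Ioc 0 T, ∀ x ∈ Ω,
    derivWithin (fun s => u s x) (Ioc 0 T) t =
      Laplacian.laplacian (u t) x + (ε ^ 2)⁻¹ * (f (u t x) - ⨍ y in Ω, f (u t y))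
  noFlux : NoFlux Ω (Ioc 0 T) u
  initial : u 0 =ᵐ[volume.restrict Ω] g
  initial_limit : Tendsto (fun t => eLpNorm (fun x => u t x - g x) 2 (volume.restrict Ω))
    (𝓝[>] 0) (𝓝 0)

/-- The residual `v_t - Δv - ε⁻² (f(v) - ε lam(t))` of a pair `(v, lam)` on `Ω × [0, T]`. -/
noncomputable def acResidual {n : ℕ} (f : ℝ → ℝ) (ε T : ℝ)
    (v : ℝ → EuclideanSpace ℝ (Fin n) → ℝ) (lam : ℝ → ℝ)
    (p : ℝ × EuclideanSpace ℝ (Fin n)) : ℝ :=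
  derivWithin (fun s => v s p.2) (Icc 0 T) p.1 - Laplacian.laplacian (v p.1) p.2
    - (ε ^ 2)⁻¹ * (f (v p.1 p.2) - ε * lam p.1)

/-- `(v, lam)` is an approximate solution of order `k` on `Ω × [0, T]`: `v` has conserved mass, no
flux through the boundary and sup norm at most `2`, and its residual has `L²` norm at most `ε^k`
on the space-time cylinder. -/
structure IsApproxSolution {n : ℕ} (Ω : Set (EuclideanSpace ℝ (Fin n))) (f : ℝ → ℝ) (ε T : ℝ)
    (k : ℕ) (v : ℝ → EuclideanSpace ℝ (Fin n) → ℝ) (lam : ℝ → ℝ) : Prop where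
  regular : IsC21 Ω (Icc 0 T) v
  mass : ∀ t ∈ Icc 0 T, ∫ x in Ω, derivWithin (fun s => v s x) (Icc 0 T) t = 0
  noFlux : NoFlux Ω (Icc 0 T) v
  residual_memLp : MemLp (acResidual f ε T v lam) 2 (volume.restrict (Icc 0 T ×ˢ Ω))
  residual_le : eLpNorm (acResidual f ε T v lam) 2 (volume.restrict (Icc 0 T ×ˢ Ω))
    ≤ ENNReal.ofReal (ε ^ k)
  sup_le : eLpNorm (fun p : ℝ × EuclideanSpace ℝ (Fin n) => v p.1 p.2) ∞
    (volume.restrict (Icc 0 T ×ˢ Ω)) ≤ 2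

/-- `φ ∈ H¹(Ω)` with weak gradient `G`. -/
structure IsH1With {n : ℕ} (Ω : Set (EuclideanSpace ℝ (Fin n)))
    (φ : EuclideanSpace ℝ (Fin n) → ℝ)
    (G : EuclideanSpace ℝ (Fin n) → EuclideanSpace ℝ (Fin n)) : Prop where
  memLp : MemLp φ 2 (volume.restrict Ω)
  memLp_grad : MemLp G 2 (volume.restrict Ω)
  weak_gradient : ∀ ψ : EuclideanSpace ℝ (Fin n) → ℝ, ContDiff ℝ ∞ ψ → HasCompactSupport ψ →
    tsupport ψ ⊆ Ω → ∀ e : EuclideanSpace ℝ (Fin n),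
      ∫ x in Ω, φ x * fderiv ℝ ψ x e = - ∫ x in Ω, ⟪G x, e⟫ * ψ x

/-- The spectral lower bound: for all `0 < ε ≤ 1`, `0 < t ≤ T` and all `φ ∈ H¹(Ω)` with mean zero
and unit `L²` norm, `∫_Ω (|∇φ|² - ε⁻² f'(v^ε(·,t)) φ²) ≥ - Cstar`. -/
def SpectralLowerBound {n : ℕ} (Ω : Set (EuclideanSpace ℝ (Fin n))) (f : ℝ → ℝ) (T Cstar : ℝ)
    (v : ℝ → ℝ → EuclideanSpace ℝ (Fin n) → ℝ) : Prop :=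
  ∀ t ∈ Ioc 0 T, ∀ ε ∈ Ioc (0 : ℝ) 1, ∀ φ G, IsH1With Ω φ G →
    ∫ x in Ω, φ x = 0 → ∫ x in Ω, φ x ^ 2 = 1 →
      - Cstar ≤ ∫ x in Ω, (‖G x‖ ^ 2 - (ε ^ 2)⁻¹ * deriv f (v ε t x) * φ x ^ 2)

/-! Let `w = u - v`, `y = ∫ w²`, `G = ∫ |∇w|²`. Both masses are conserved and the initial
perturbation has mean zero, so `w` has mean zero at all times (`integral_sub_eq_zero`). Testing the
equation for `w` with `w` therefore kills every term that is constant in space, namely the average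
of `f(u)` and the multiplier `lam`, and gives `y' / 2 = -G + ε⁻² ∫ w (f(u) - f(v)) - ∫ w R` with `R
= v_t - Δv - ε⁻² f(v)`.

Let `m = max 4 n`. Since `f(±∞) = ∓∞`, the product `w (f(v + w) - f(v))` is negative for large
`|w|`. Hence it is at most `f'(v) w² + C₁ |w|^(2 + 4/m)` for all real `w`, without any growth
condition on `f` (`IsBistable.exists_mul_sub_le`). The Gagliardo–Nirenberg inequality bounds `∫
|w|^(2 + 4/m)` by `C₂ y^(2/m) (y + G)`. As long as `y` is of order `ε^(2k)`, the factor `y^(2/m)` is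
of order `ε^(4k/m)`. As `k > m`, the superquadratic term is then at most `ε⁻² ε⁴ (y + G)` for small
`ε`. Its part `ε² G` is paid for by using only the fraction `1 - ε²` of the spectral bound; what is
left of the quadratic form is `∫ f'(v) w²`, which is `O(y)`. The result is `y' ≤ K y + D` with `K`
independent of `ε` (`IsNeumannC2.two_mul_integral_mul_le`).

Here `D` is the spatial variance of `R`. It equals that of the true residual, since the two differ
by a function of time, so `∫ D ≤ ε^(2k)` whatever `lam` is. A Gronwall argument up to the first time
at which `y` exceeds its threshold shows that this time never comes
(`le_of_deriv_le_below_threshold`).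

Two analytic facts are proved directly from local defining functions of `Ω`. The divergence theorem
for tangential fields, which gives Green's identity, is obtained by cutting off along level sets.
The Sobolev inequality is obtained by integrating along rays that stay inside `Ω`, without an
extension operator. -/

section

variable {n : ℕ}

/-! ### The divergence theorem for tangential fields -/

/-- A `C¹` function on an open set which vanishes off a compact subset is `C¹` everywhere. -/
theorem contDiff_of_contDiffOn_of_compact {E F : Type*} [NormedAddCommGroup E] [NormedSpace ℝ E]
    [NormedAddCommGroup F] [NormedSpace ℝ F] {Z : E → F} {K Ω : Set E} (hΩ : IsOpen Ω)
    (hK : IsClosed K) (hKΩ : K ⊆ Ω) (hZ : ContDiffOn ℝ 1 Z Ω) (h0 : ∀ x, x ∉ K → Z x = 0) :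
    ContDiff ℝ 1 Z := by
  rw [contDiff_iff_contDiffAt]
  intro x
  by_cases hx : x ∈ K
  · exact hZ.contDiffAt (hΩ.mem_nhds (hKΩ hx))
  · refine (contDiffAt_const (c := (0 : F))).congr_of_eventuallyEq ?_
    filter_upwards [hK.isOpen_compl.mem_nhds hx] with y hy using h0 y hy

theorem integral_fderiv_apply_eq_zero {E : Type*} [NormedAddCommGroup E] [NormedSpace ℝ E]
    [FiniteDimensional ℝ E] [MeasurableSpace E] [BorelSpace E] (μ : Measure E)
    [μ.IsAddHaarMeasure] {Z : E → ℝ} {K Ω : Set E}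
    (hΩ : IsOpen Ω) (hK : IsCompact K) (hKΩ : K ⊆ Ω) (hZ : ContDiffOn ℝ 1 Z Ω)
    (h0 : ∀ x, x ∉ K → Z x = 0) (e : E) : ∫ x in Ω, fderiv ℝ Z x e ∂μ = 0 := by
  have hZ' : ContDiff ℝ 1 Z := contDiff_of_contDiffOn_of_compact hΩ hK.isClosed hKΩ hZ h0
  have hc : HasCompactSupport Z := HasCompactSupport.intro hK h0
  have hf0 : ∀ x, x ∉ K → fderiv ℝ Z x = 0 := fun x hx => by
    have : Z =ᶠ[𝓝 x] fun _ => 0 := by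
      filter_upwards [hK.isClosed.isOpen_compl.mem_nhds hx] with y hy using h0 y hy
    rw [this.fderiv_eq]; simp
  rw [setIntegral_eq_integral_of_forall_compl_eq_zero
    (fun x hx => by rw [hf0 x (fun h => hx (hKΩ h))]; simp)]
  have hint : Integrable (fun x => fderiv ℝ Z x e) μ := by
    refine Continuous.integrable_of_hasCompactSupport ?_ ?_
    · exact (hZ'.continuous_fderiv one_ne_zero).clm_apply continuous_const
    · exact HasCompactSupport.intro hK fun x hx => by rw [hf0 x hx]; simp
  have := integral_mul_fderiv_eq_neg_fderiv_mul_of_integrable (𝕜 := ℝ) (μ := μ)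
    (f := fun _ => (1 : ℝ)) (g := Z) (v := e) (by simp) (by simpa using hint)
    (by simpa using hZ'.continuous.integrable_of_hasCompactSupport hc)
    (fun x _ => differentiableAt_const _) (fun x _ => hZ'.differentiable one_ne_zero x)
  simpa using this

/-- The divergence of a covector field on Euclidean space. -/
noncomputable def codiv (A : EuclideanSpace ℝ (Fin n) → EuclideanSpace ℝ (Fin n) →L[ℝ] ℝ)
    (x : EuclideanSpace ℝ (Fin n)) : ℝ :=
  ∑ i, fderiv ℝ A x (EuclideanSpace.single i 1) (EuclideanSpace.single i 1)

theorem gradient_eq_sum (ρ : EuclideanSpace ℝ (Fin n) → ℝ) (x : EuclideanSpace ℝ (Fin n)) :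
    gradient ρ x = ∑ i, fderiv ℝ ρ x (EuclideanSpace.single i 1) •
      (EuclideanSpace.single i (1 : ℝ) : EuclideanSpace ℝ (Fin n)) := by
  ext j
  have h1 : (gradient ρ x) j = ⟪gradient ρ x, EuclideanSpace.single j (1 : ℝ)⟫ := by
    rw [EuclideanSpace.inner_single_right]; simp
  have h2 : ⟪gradient ρ x, EuclideanSpace.single j (1 : ℝ)⟫ =
      fderiv ℝ ρ x (EuclideanSpace.single j 1) := by
    rw [gradient, InnerProductSpace.toDual_symm_apply]
  rw [h1, h2]
  simp [Pi.single_apply]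

theorem apply_gradient (A : EuclideanSpace ℝ (Fin n) →L[ℝ] ℝ) (ρ : EuclideanSpace ℝ (Fin n) → ℝ)
    (x : EuclideanSpace ℝ (Fin n)) :
    A (gradient ρ x) = ∑ i, fderiv ℝ ρ x (EuclideanSpace.single i 1) *
      A (EuclideanSpace.single i 1) := by
  rw [gradient_eq_sum, map_sum]
  simp

theorem codiv_smul {η : EuclideanSpace ℝ (Fin n) → ℝ}
    {A : EuclideanSpace ℝ (Fin n) → EuclideanSpace ℝ (Fin n) →L[ℝ] ℝ}
    {x : EuclideanSpace ℝ (Fin n)} (hη : DifferentiableAt ℝ η x) (hA : DifferentiableAt ℝ A x) :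
    codiv (fun y => η y • A y) x = η x * codiv A x + A x (gradient η x) := by
  rw [apply_gradient, codiv, codiv, fderiv_fun_smul hη hA, Finset.mul_sum,
    ← Finset.sum_add_distrib]
  simp

theorem norm_codiv_le (A : EuclideanSpace ℝ (Fin n) → EuclideanSpace ℝ (Fin n) →L[ℝ] ℝ)
    (x : EuclideanSpace ℝ (Fin n)) : |codiv A x| ≤ n * ‖fderiv ℝ A x‖ := by
  refine (Finset.abs_sum_le_sum_abs _ _).trans ?_
  have : ∀ i ∈ (Finset.univ : Finset (Fin n)), |fderiv ℝ A x (EuclideanSpace.single i 1)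
      (EuclideanSpace.single i 1)| ≤ ‖fderiv ℝ A x‖ := fun i _ => by
    have := (fderiv ℝ A x).le_opNorm₂ (EuclideanSpace.single i (1 : ℝ)) (EuclideanSpace.single i 1)
    simpa using this
  simpa using Finset.sum_le_sum this

/-- A covector field which is `C¹` on an open set and vanishes off a compact subset has
divergence of zero integral. -/
theorem integral_codiv_eq_zero_of_compact
    {A : EuclideanSpace ℝ (Fin n) → EuclideanSpace ℝ (Fin n) →L[ℝ] ℝ}
    {K Ω : Set (EuclideanSpace ℝ (Fin n))} (hΩ : IsOpen Ω) (hK : IsCompact K) (hKΩ : K ⊆ Ω)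
    (hA : ContDiffOn ℝ 1 A Ω) (h0 : ∀ x, x ∉ K → A x = 0) : ∫ x in Ω, codiv A x = 0 := by
  have hA' := contDiff_of_contDiffOn_of_compact hΩ hK.isClosed hKΩ hA h0
  have hd : Differentiable ℝ A := hA'.differentiable one_ne_zero
  have hf : ∀ x e, fderiv ℝ (fun y => A y e) x e = fderiv ℝ A x e e := fun x e => by
    rw [fderiv_clm_apply (hd x) (differentiableAt_const _)]; simp
  unfold codiv
  rw [integral_finsetSum]
  · refine Finset.sum_eq_zero fun i _ => ?_
    simp_rw [← hf]
    exact integral_fderiv_apply_eq_zero volume hΩ hK hKΩ (hA.clm_apply contDiffOn_const)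
      (fun x hx => by simp [h0 x hx]) _
  · intro i _
    refine Integrable.integrableOn ?_
    refine Continuous.integrable_of_hasCompactSupport ?_ ?_
    · exact ((hA'.continuous_fderiv one_ne_zero).clm_apply continuous_const).clm_apply continuous_const
    · refine HasCompactSupport.intro hK fun x hx => ?_
      have : A =ᶠ[𝓝 x] fun _ => 0 := by
        filter_upwards [hK.isClosed.isOpen_compl.mem_nhds hx] with y hy using h0 y hy
      rw [this.fderiv_eq]; simp

theorem IsLocalDefiningFunction.contDiffOn_gradient {Ω U : Set (EuclideanSpace ℝ (Fin n))}
    {ρ : EuclideanSpace ℝ (Fin n) → ℝ} (h : IsLocalDefiningFunction Ω U ρ) :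
    ContDiffOn ℝ 1 (gradient ρ) U := by
  have h1 : ContDiffOn ℝ 1 (fderiv ℝ ρ) U := h.contDiffOn.fderiv_of_isOpen h.isOpen (by
    norm_cast)
  exact ((InnerProductSpace.toDual ℝ (EuclideanSpace ℝ (Fin n))).symm.contDiff).comp_contDiffOn h1

/-- A tangential covector field is `O(ρ)` in the direction of the gradient of a defining
function `ρ`. -/
theorem exists_abs_apply_gradient_le {Ω U : Set (EuclideanSpace ℝ (Fin n))} (hΩ : IsOpen Ω)
    {ρ : EuclideanSpace ℝ (Fin n) → ℝ}
    (h : IsLocalDefiningFunction Ω U ρ) {x₀ : EuclideanSpace ℝ (Fin n)} (hx₀ : x₀ ∈ U)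
    {A : EuclideanSpace ℝ (Fin n) → EuclideanSpace ℝ (Fin n) →L[ℝ] ℝ}
    (hAc : ContinuousOn A (closure Ω)) (hA : ContDiffOn ℝ 1 A Ω) {M : ℝ}
    (hM : ∀ x ∈ Ω, ‖fderiv ℝ A x‖ ≤ M) (hν : ∀ x ν, IsOutwardNormal Ω x ν → A x ν = 0) :
    ∃ r > 0, Metric.ball x₀ r ⊆ U ∧ ∃ C, ∀ x ∈ Ω ∩ Metric.ball x₀ r,
      |A x (gradient ρ x)| ≤ C * |ρ x| := by
  have hG := h.contDiffOn_gradient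
  set G := gradient ρ with hGdef
  have hρd : ∀ x ∈ U, HasFDerivAt ρ (fderiv ℝ ρ x) x := fun x hx =>
    ((h.contDiffOn.contDiffAt (h.isOpen.mem_nhds hx)).differentiableAt (by simp)).hasFDerivAt
  have hfd : ∀ x e, fderiv ℝ ρ x e = ⟪G x, e⟫ := fun x e => by
    rw [hGdef, gradient, InnerProductSpace.toDual_symm_apply]
  have hN : 0 < ‖G x₀‖ := norm_pos_iff.2 (h.gradient_ne_zero x₀ hx₀)
  set e := ‖G x₀‖⁻¹ • G x₀ with he
  have hne : ‖e‖ = 1 := by rw [he, norm_smul, norm_inv, norm_norm, inv_mul_cancel₀ hN.ne']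
  -- Half of `|∇ρ(x₀)|`: near `x₀` the function `ρ` grows at least at the rate `c` in the direction
  -- `e`.
  set c := ‖G x₀‖ / 2 with hc
  have hc0 : 0 < c := by positivity
  have hpos : ∀ᶠ x in 𝓝 x₀, x ∈ U ∧ c < ⟪G x, e⟫ := by
    refine Filter.Eventually.and (h.isOpen.mem_nhds hx₀) ?_
    have hct : ContinuousAt (fun x => ⟪G x, e⟫) x₀ :=
      (hG.continuousOn.continuousAt (h.isOpen.mem_nhds hx₀)).inner continuousAt_const
    refine hct.eventually (lt_mem_nhds ?_)
    change c < ⟪G x₀, e⟫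
    rw [he, inner_smul_right, real_inner_self_eq_norm_sq, hc]
    field_simp
    linarith
  obtain ⟨R, hR, hRU⟩ := Metric.nhds_basis_closedBall.mem_iff.1 hpos
  have hRU' : Metric.closedBall x₀ R ⊆ U := fun x hx => (hRU hx).1
  have hcomp : IsCompact (Metric.closedBall x₀ R) := isCompact_closedBall _ _
  obtain ⟨B₁, hB₁⟩ := hcomp.exists_bound_of_continuousOn (hG.continuousOn.mono hRU')
  obtain ⟨B₂, hB₂⟩ := hcomp.exists_bound_of_continuousOn
    ((hG.continuousOn_fderiv_of_isOpen h.isOpen le_rfl).mono hRU')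
  obtain ⟨B₃, hB₃⟩ := (hcomp.inter_right isClosed_closure).exists_bound_of_continuousOn
    (hAc.mono (inter_subset_right (s := Metric.closedBall x₀ R)))
  set r := R / 2 with hr
  have hr0 : 0 < r := by positivity
  refine ⟨r, hr0, fun x hx => hRU' (Metric.ball_subset_closedBall
    (Metric.ball_subset_ball (by linarith) hx)), max (B₃ * B₁ / (c * r)) ((M * B₁ + B₃ * B₂) / c),
    fun x hx => ?_⟩
  have hseg : ∀ t ∈ Icc 0 r, x + t • e ∈ Metric.closedBall x₀ R := fun t ht => by
    have h1 := hx.2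
    rw [Metric.mem_ball] at h1
    rw [Metric.mem_closedBall]
    calc dist (x + t • e) x₀ ≤ dist (x + t • e) x + dist x x₀ := dist_triangle _ _ _
      _ ≤ r + r := by
        gcongr
        rw [dist_eq_norm, add_sub_cancel_left, norm_smul, hne, mul_one, Real.norm_eq_abs,
          abs_of_nonneg ht.1]
        exact ht.2
      _ = R := by rw [hr]; ring
  have hx0 : x ∈ Metric.closedBall x₀ R := by simpa using hseg 0 ⟨le_rfl, hr0.le⟩
  have hxU := hRU' hx0
  have hρx : ρ x < 0 := (h.mem_iff x hxU).1 hx.1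
  have hl : ∀ t, HasDerivAt (fun t : ℝ => x + t • e) e t := fun t => by
    simpa using ((hasDerivAt_id t).smul_const e).const_add x
  have hp : ∀ t ∈ Icc 0 r, HasDerivAt (fun t => ρ (x + t • e)) ⟪G (x + t • e), e⟫ t :=
    fun t ht => by
      rw [← hfd]
      exact (hρd _ (hRU' (hseg t ht))).comp_hasDerivAt t (hl t)
  have hpc : ContinuousOn (fun t : ℝ => ρ (x + t • e)) (Icc 0 r) := fun t ht =>
    (hp t ht).continuousAt.continuousWithinAt
  have hgrow : ∀ s ∈ Icc 0 r, ∀ t ∈ Icc 0 r, s ≤ t → c * (t - s) ≤ ρ (x + t • e) - ρ (x + s • e) :=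
    fun s hs t ht hst => by
      refine (convex_Icc 0 r).mul_sub_le_image_sub_of_le_deriv hpc (fun y hy => ?_) (fun y hy => ?_)
        s hs t ht hst
      · rw [interior_Icc] at hy
        exact (hp y ⟨hy.1.le, hy.2.le⟩).differentiableAt.differentiableWithinAt
      · rw [interior_Icc] at hy
        rw [(hp y ⟨hy.1.le, hy.2.le⟩).deriv]
        exact (hRU (hseg y ⟨hy.1.le, hy.2.le⟩)).2.le
  have hB₁0 : 0 ≤ B₁ := (norm_nonneg _).trans (hB₁ x hx0)
  have hB₃x := hB₃ x ⟨hx0, subset_closure hx.1⟩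
  have hB₃0 : 0 ≤ B₃ := (norm_nonneg _).trans hB₃x
  rw [abs_of_neg hρx]
  -- If the segment of length `r` never leaves `{ρ < 0}`, then `|ρ x| ≥ c r` and the crude bound on
  -- `A` suffices. Otherwise it meets `∂Ω` at some `τ ≤ |ρ x| / c`, where `A (∇ρ)` vanishes. The
  -- mean value inequality on that segment, which lies in `Ω` up to `τ`, then bounds `A (∇ρ)` at `x`
  -- by a multiple of `τ`.
  rcases lt_or_ge (ρ (x + r • e)) 0 with hneg | hnn
  · have h1 := hgrow 0 ⟨le_rfl, hr0.le⟩ r ⟨hr0.le, le_rfl⟩ hr0.le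
    simp only [zero_smul, add_zero, sub_zero] at h1
    have h2 : |A x (G x)| ≤ B₃ * B₁ := by
      refine ((A x).le_opNorm (G x)).trans ?_
      exact mul_le_mul hB₃x (hB₁ x hx0) (norm_nonneg _) hB₃0
    calc |A x (G x)| ≤ B₃ * B₁ := h2
      _ = B₃ * B₁ / (c * r) * (c * r) := by field_simp
      _ ≤ B₃ * B₁ / (c * r) * (-ρ x) := by gcongr; linarith
      _ ≤ _ := by gcongr; · linarith
                  · exact le_max_left _ _
  · obtain ⟨τ, hτ, hτ0⟩ := intermediate_value_Icc hr0.le hpc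
      (show (0 : ℝ) ∈ Icc _ _ from ⟨by simpa using hρx.le, hnn⟩)
    simp only at hτ0
    have hsub : ∀ t ∈ Ico 0 τ, x + t • e ∈ Ω := fun t ht => by
      have htr : t ∈ Icc 0 r := ⟨ht.1, ht.2.le.trans hτ.2⟩
      rw [h.mem_iff _ (hRU' (hseg t htr))]
      have := hgrow t htr τ hτ ht.2.le
      have h2 : 0 < c * (τ - t) := mul_pos hc0 (sub_pos.2 ht.2)
      linarith
    have hτpos : 0 < τ := by
      refine lt_of_le_of_ne hτ.1 fun h0 => ?_
      rw [← h0] at hτ0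
      simp only [zero_smul, add_zero] at hτ0
      linarith
    have hlim : x + τ • e ∈ closure Ω := by
      have ht : Tendsto (fun t : ℝ => x + t • e) (𝓝[<] τ) (𝓝 (x + τ • e)) :=
        (hl τ).continuousAt.continuousWithinAt
      refine mem_closure_of_tendsto ht ?_
      filter_upwards [Ioo_mem_nhdsLT hτpos] with t ht using hsub t ⟨ht.1.le, ht.2⟩
    have hτU := hRU' (hseg τ hτ)
    have hfr : x + τ • e ∈ frontier Ω := by
      rw [hΩ.frontier_eq]
      exact ⟨hlim, fun hmem => by have := (h.mem_iff _ hτU).1 hmem; linarith⟩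
    have hAτ : A (x + τ • e) (G (x + τ • e)) = 0 := by
      have h1 := hν (x + τ • e) _ ⟨hfr, U, ρ, hτU, h, rfl⟩
      rw [map_smul, smul_eq_mul, mul_eq_zero] at h1
      refine h1.resolve_left (inv_ne_zero (norm_ne_zero_iff.2 (h.gradient_ne_zero _ hτU)))
    have hclo : ∀ t ∈ Icc 0 τ, x + t • e ∈ closure Ω := fun t ht => by
      rcases ht.2.lt_or_eq with h1 | h1
      · exact subset_closure (hsub t ⟨ht.1, h1⟩)
      · rw [h1]; exact hlim
    have hlc : Continuous fun t : ℝ => x + t • e := by fun_prop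
    have hFc : ContinuousOn (fun t : ℝ => A (x + t • e) (G (x + t • e))) (Icc 0 τ) :=
      (hAc.comp hlc.continuousOn hclo).clm_apply (hG.continuousOn.comp hlc.continuousOn
        fun t ht => hRU' (hseg t ⟨ht.1, ht.2.trans hτ.2⟩))
    have hFd : ∀ t ∈ Ico 0 τ, HasDerivAt (fun t : ℝ => A (x + t • e) (G (x + t • e)))
        (fderiv ℝ A (x + t • e) e (G (x + t • e)) + A (x + t • e) (fderiv ℝ G (x + t • e) e)) t :=
      fun t ht => by
        have h1 : HasDerivAt (fun t : ℝ => A (x + t • e)) (fderiv ℝ A (x + t • e) e) t :=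
          (((hA.contDiffAt (hΩ.mem_nhds (hsub t ht))).differentiableAt
            one_ne_zero).hasFDerivAt).comp_hasDerivAt t (hl t)
        have h2 : HasDerivAt (fun t : ℝ => G (x + t • e)) (fderiv ℝ G (x + t • e) e) t :=
          HasFDerivAt.comp_hasDerivAt (l := G) t ((hG.contDiffAt (h.isOpen.mem_nhds
            (hRU' (hseg t ⟨ht.1, ht.2.le.trans hτ.2⟩)))).differentiableAt
            one_ne_zero).hasFDerivAt (hl t)
        exact h1.clm_apply h2
    have hmv := norm_image_sub_le_of_norm_deriv_right_le_segment hFc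
      (fun t ht => (hFd t ht).hasDerivWithinAt) (C := M * B₁ + B₃ * B₂) (fun t ht => by
        have hb := hseg t ⟨ht.1, ht.2.le.trans hτ.2⟩
        refine (norm_add_le _ _).trans (add_le_add ?_ ?_)
        · refine ((fderiv ℝ A (x + t • e)).le_opNorm₂ _ _).trans ?_
          rw [hne, mul_one]
          have hMx := hM _ (hsub t ht)
          exact mul_le_mul hMx (hB₁ _ hb) (norm_nonneg _) 
            ((norm_nonneg (fderiv ℝ A (x + t • e))).trans hMx)
        · refine ((A (x + t • e)).le_opNorm _).trans ?_
          refine mul_le_mul (hB₃ _ ⟨hb, subset_closure (hsub t ht)⟩) ?_ (norm_nonneg _) hB₃0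
          refine ((fderiv ℝ G (x + t • e)).le_opNorm _).trans ?_
          rw [hne, mul_one]
          exact hB₂ _ hb) τ ⟨hτ.1, le_rfl⟩
    rw [hAτ, zero_smul, add_zero, zero_sub, norm_neg, sub_zero, Real.norm_eq_abs] at hmv
    have hQ : 0 ≤ M * B₁ + B₃ * B₂ := by
      have := (abs_nonneg _).trans hmv
      exact nonneg_of_mul_nonneg_left this hτpos
    have h1 := hgrow 0 ⟨le_rfl, hr0.le⟩ τ hτ hτ.1
    simp only [zero_smul, add_zero, sub_zero] at h1
    rw [hτ0] at h1
    calc |A x (G x)| ≤ (M * B₁ + B₃ * B₂) * τ := hmv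
      _ = (M * B₁ + B₃ * B₂) / c * (c * τ) := by field_simp
      _ ≤ (M * B₁ + B₃ * B₂) / c * (-ρ x) := by gcongr; linarith
      _ ≤ _ := by gcongr; · linarith
                  · exact le_max_right _ _

theorem exists_bound_deriv_smoothTransition :
    ∃ B : ℝ, 0 ≤ B ∧ ∀ x, |deriv Real.smoothTransition x| ≤ B := by
  have hc : Continuous (deriv Real.smoothTransition) :=
    (Real.smoothTransition.contDiff (n := 1)).continuous_deriv le_rfl
  obtain ⟨B, hB⟩ := (isCompact_Icc (a := (0 : ℝ)) (b := 1)).exists_bound_of_continuousOn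
    hc.continuousOn
  have hB0 : 0 ≤ B := (norm_nonneg _).trans (hB 0 (by simp))
  refine ⟨B, hB0, fun x => ?_⟩
  by_cases hx : x ∈ Icc (0 : ℝ) 1
  · exact hB x hx
  · have : ∃ c : ℝ, Real.smoothTransition =ᶠ[𝓝 x] fun _ => c := by
      rw [mem_Icc, not_and_or, not_le, not_le] at hx
      rcases hx with hx | hx
      · refine ⟨0, ?_⟩
        filter_upwards [gt_mem_nhds hx] with y hy using Real.smoothTransition.zero_of_nonpos hy.le
      · refine ⟨1, ?_⟩
        filter_upwards [lt_mem_nhds hx] with y hy using Real.smoothTransition.one_of_one_le hy.le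
    obtain ⟨c, hc⟩ := this
    rw [hc.deriv_eq]
    simpa using hB0

theorem deriv_smoothTransition_of_one_lt {x : ℝ} (hx : 1 < x) :
    deriv Real.smoothTransition x = 0 := by
  have : Real.smoothTransition =ᶠ[𝓝 x] fun _ => 1 := by
    filter_upwards [lt_mem_nhds hx] with y hy using Real.smoothTransition.one_of_one_le hy.le
  rw [this.deriv_eq]
  simp

theorem continuousOn_codiv {A : EuclideanSpace ℝ (Fin n) → EuclideanSpace ℝ (Fin n) →L[ℝ] ℝ}
    {Ω : Set (EuclideanSpace ℝ (Fin n))} (hΩ : IsOpen Ω) (hA : ContDiffOn ℝ 1 A Ω) :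
    ContinuousOn (codiv A) Ω :=
  continuousOn_finsetSum _ fun _ _ =>
    ((hA.continuousOn_fderiv_of_isOpen hΩ le_rfl).clm_apply continuousOn_const).clm_apply
      continuousOn_const

theorem Filter.EventuallyEq.codiv_eq
    {A B : EuclideanSpace ℝ (Fin n) → EuclideanSpace ℝ (Fin n) →L[ℝ] ℝ}
    {x : EuclideanSpace ℝ (Fin n)} (h : A =ᶠ[𝓝 x] B) : codiv A x = codiv B x := by
  unfold codiv
  rw [h.fderiv_eq]

theorem integrableOn_of_bounded_continuousOn {F : EuclideanSpace ℝ (Fin n) → ℝ}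
    {Ω : Set (EuclideanSpace ℝ (Fin n))} (hΩ : IsOpen Ω) (hb : Bornology.IsBounded Ω)
    (hF : ContinuousOn F Ω) {C : ℝ} (hC : ∀ x ∈ Ω, ‖F x‖ ≤ C) : IntegrableOn F Ω :=
  have : IsFiniteMeasure (volume.restrict Ω) := ⟨by simpa using hb.measure_lt_top⟩
  (integrable_const C).mono' (hF.aestronglyMeasurable hΩ.measurableSet)
    ((ae_restrict_iff' hΩ.measurableSet).2 (ae_of_all _ hC))

/-- Bounds for the divergence of a truncated covector field. -/
theorem exists_bound_codiv_smul {Ω : Set (EuclideanSpace ℝ (Fin n))} (hΩ : IsOpen Ω)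
    {A : EuclideanSpace ℝ (Fin n) → EuclideanSpace ℝ (Fin n) →L[ℝ] ℝ}
    (hb : Bornology.IsBounded Ω)
    (hAc : ContinuousOn A (closure Ω)) (hA : ContDiffOn ℝ 1 A Ω) {M : ℝ}
    (hM : ∀ x ∈ Ω, ‖fderiv ℝ A x‖ ≤ M) {χ : EuclideanSpace ℝ (Fin n) → ℝ} (hχ : ContDiff ℝ ∞ χ) :
    ∃ C, ∀ x ∈ Ω, ‖codiv (fun y => χ y • A y) x‖ ≤ C := by
  have hcomp := hb.isCompact_closure
  obtain ⟨B₁, hB₁⟩ := hcomp.exists_bound_of_continuousOn hAc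
  obtain ⟨B₂, hB₂⟩ := hcomp.exists_bound_of_continuousOn hχ.continuous.continuousOn
  obtain ⟨B₃, hB₃⟩ := hcomp.exists_bound_of_continuousOn
    (hχ.continuous_fderiv (by simp)).continuousOn
  refine ⟨n * (B₂ * M + B₃ * B₁), fun x hx => (norm_codiv_le _ x).trans ?_⟩
  gcongr
  have hx' := subset_closure hx
  have hB₂0 : 0 ≤ B₂ := (norm_nonneg _).trans (hB₂ x hx')
  have hB₃0 : 0 ≤ B₃ := (norm_nonneg _).trans (hB₃ x hx')
  rw [fderiv_fun_smul (hχ.differentiable (by simp) x)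
    ((hA.contDiffAt (hΩ.mem_nhds hx)).differentiableAt one_ne_zero)]
  refine (norm_add_le (χ x • fderiv ℝ A x) _).trans (add_le_add ?_ ?_)
  · refine (ContinuousLinearMap.opNorm_smul_le (χ x) (fderiv ℝ A x)).trans ?_
    exact mul_le_mul (hB₂ x hx') (hM x hx) (norm_nonneg (fderiv ℝ A x)) hB₂0
  · refine (ContinuousLinearMap.norm_smulRight_apply (fderiv ℝ χ x) (A x)).le.trans ?_
    exact mul_le_mul (hB₃ x hx') (hB₁ x hx') (norm_nonneg _) hB₃0

/-- Multiplying by a cutoff `η k` depending on `k ρ` makes the support compact in `Ω`, so the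
divergence integrates to zero. The extra term contains `k |A (∇ρ)| ≤ C k |ρ|` on a strip where `k
|ρ| ≤ 2`: it is bounded uniformly in `k` and lives on a shrinking strip, so dominated convergence
removes it and no boundary integral is needed. -/
theorem integral_codiv_smul_eq_zero_of_boundary {Ω U : Set (EuclideanSpace ℝ (Fin n))}
    (hΩ : IsOpen Ω) (hb : Bornology.IsBounded Ω) {ρ : EuclideanSpace ℝ (Fin n) → ℝ}
    (h : IsLocalDefiningFunction Ω U ρ)
    {A : EuclideanSpace ℝ (Fin n) → EuclideanSpace ℝ (Fin n) →L[ℝ] ℝ}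
    (hAc : ContinuousOn A (closure Ω)) (hA : ContDiffOn ℝ 1 A Ω) {M : ℝ}
    (hM : ∀ x ∈ Ω, ‖fderiv ℝ A x‖ ≤ M) {χ : EuclideanSpace ℝ (Fin n) → ℝ}
    (hχ : ContDiff ℝ ∞ χ) (hχc : HasCompactSupport χ) (hχU : tsupport χ ⊆ U) {C : ℝ}
    (hC : ∀ x ∈ Ω ∩ tsupport χ, |A x (gradient ρ x)| ≤ C * |ρ x|) :
    ∫ x in Ω, codiv (fun y => χ y • A y) x = 0 := by
  obtain ⟨C₁, hC₁⟩ := exists_bound_codiv_smul hΩ hb hAc hA hM hχ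
  obtain ⟨B, hB0, hB⟩ := exists_bound_deriv_smoothTransition
  obtain ⟨X, hX⟩ := hχ.continuous.bounded_above_of_compact_support hχc
  set Y := fun y => χ y • A y with hY
  have hYs : ContDiffOn ℝ 1 Y Ω := (hχ.of_le (by norm_cast)).contDiffOn.smul hA
  have hY0 : ∀ x, x ∉ tsupport χ → Y =ᶠ[𝓝 x] fun _ => 0 := fun x hx => by
    filter_upwards [(isClosed_tsupport χ).isOpen_compl.mem_nhds hx] with y hy
    simp [hY, image_eq_zero_of_notMem_tsupport hy]
  -- For `k > 0`, `η k` is zero where `-ρ ≤ 1 / k` and one where `-ρ ≥ 2 / k`. The shift by `-1`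
  -- keeps its support away from `{ρ = 0}`.
  set η : ℕ → EuclideanSpace ℝ (Fin n) → ℝ :=
    fun k x => Real.smoothTransition (-((k : ℝ) * ρ x) - 1) with hη
  have hρc : ContinuousOn ρ U := h.contDiffOn.continuousOn
  have hρs : ∀ x ∈ U, ContDiffAt ℝ ∞ ρ x := fun x hx =>
    h.contDiffOn.contDiffAt (h.isOpen.mem_nhds hx)
  have hηs : ∀ k, ∀ x ∈ U, ContDiffAt ℝ 1 (η k) x := fun k x hx => by
    have h1 : ContDiffAt ℝ 1 ρ x := (hρs x hx).of_le (by norm_cast)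
    exact Real.smoothTransition.contDiffAt.comp x
      (((contDiffAt_const.mul h1).neg).sub contDiffAt_const)
  have hs : ∀ k, ContDiffOn ℝ 1 (fun y => η k y • Y y) Ω := fun k x hx => by
    refine ContDiffAt.contDiffWithinAt ?_
    by_cases hxs : x ∈ tsupport χ
    · exact (hηs k x (hχU hxs)).smul (hYs.contDiffAt (hΩ.mem_nhds hx))
    · refine (contDiffAt_const (c := 0)).congr_of_eventuallyEq ?_
      filter_upwards [hY0 x hxs] with y hy
      simp [hy]
  have hK : ∀ k, 0 < k → ∃ K, IsCompact K ∧ K ⊆ Ω ∧ ∀ x, x ∉ K → η k x • Y x = 0 := by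
    intro k hk
    have hk' : (0 : ℝ) < k := by exact_mod_cast hk
    refine ⟨tsupport χ ∩ ρ ⁻¹' Iic (-(1 / k)), ?_, ?_, ?_⟩
    · exact hχc.isCompact.of_isClosed_subset ((hρc.mono hχU).preimage_isClosed_of_isClosed
        (isClosed_tsupport χ) isClosed_Iic) inter_subset_left
    · rintro x ⟨hx, hx2⟩
      rw [h.mem_iff x (hχU hx)]
      have : 0 < 1 / (k : ℝ) := by positivity
      simp only [mem_preimage, mem_Iic] at hx2
      linarith
    · intro x hx
      by_cases hxs : x ∈ tsupport χ
      · have h1 : -(1 / (k : ℝ)) < ρ x := by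
          by_contra hcon
          exact hx ⟨hxs, not_lt.1 hcon⟩
        have h2 : -((k : ℝ) * ρ x) - 1 ≤ 0 := by
          have := mul_lt_mul_of_pos_left h1 hk'
          have h3 : (k : ℝ) * -(1 / k) = -1 := by field_simp
          linarith
        simp only [hη]
        rw [Real.smoothTransition.zero_of_nonpos h2, zero_smul]
      · rw [(hY0 x hxs).eq_of_nhds, smul_zero]
  have hzero : ∀ k, 0 < k → ∫ x in Ω, codiv (fun y => η k y • Y y) x = 0 := fun k hk => by
    obtain ⟨K, hK1, hK2, hK3⟩ := hK k hk
    exact integral_codiv_eq_zero_of_compact hΩ hK1 hK2 (hs k) hK3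
  have hgrad : ∀ k, ∀ x ∈ U, gradient (η k) x =
      (deriv Real.smoothTransition (-((k : ℝ) * ρ x) - 1) * -(k : ℝ)) • gradient ρ x := by
    intro k x hx
    have h1 : HasFDerivAt (fun y => -((k : ℝ) * ρ y) - 1) (-((k : ℝ) • fderiv ℝ ρ x)) x :=
      ((((hρs x hx).differentiableAt (by simp)).hasFDerivAt.const_mul _).neg).sub_const _
    have h2 : HasDerivAt Real.smoothTransition
        (deriv Real.smoothTransition (-((k : ℝ) * ρ x) - 1)) (-((k : ℝ) * ρ x) - 1) :=
      ((Real.smoothTransition.contDiff (n := 1)).differentiable one_ne_zero _).hasDerivAt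
    have h3 := (h2.comp_hasFDerivAt x h1).fderiv
    change (InnerProductSpace.toDual ℝ _).symm (fderiv ℝ (η k) x) =
      _ • (InnerProductSpace.toDual ℝ _).symm (fderiv ℝ ρ x)
    have h4 : fderiv ℝ (η k) x = (deriv Real.smoothTransition (-((k : ℝ) * ρ x) - 1) *
        -(k : ℝ)) • fderiv ℝ ρ x := by
      rw [mul_smul, neg_smul]
      exact h3
    rw [h4, map_smulₛₗ]
    simp
  have hbound : ∀ k, ∀ x ∈ Ω, ‖codiv (fun y => η k y • Y y) x‖ ≤ |C₁| + X * (B * (2 * |C|)) := by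
    intro k x hx
    have hX0 : 0 ≤ X := (norm_nonneg _).trans (hX x)
    by_cases hxs : x ∈ tsupport χ
    · rw [codiv_smul ((hηs k x (hχU hxs)).differentiableAt one_ne_zero)
        ((hYs.contDiffAt (hΩ.mem_nhds hx)).differentiableAt one_ne_zero)]
      refine (norm_add_le _ _).trans (add_le_add ?_ ?_)
      · rw [norm_mul]
        have h1 : ‖η k x‖ ≤ 1 := by
          rw [Real.norm_eq_abs, abs_of_nonneg (Real.smoothTransition.nonneg _)]
          exact Real.smoothTransition.le_one _
        calc ‖η k x‖ * ‖codiv Y x‖ ≤ 1 * |C₁| :=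
              mul_le_mul h1 ((hC₁ x hx).trans (le_abs_self _)) (norm_nonneg _) zero_le_one
          _ = |C₁| := one_mul _
      · rw [hgrad k x (hχU hxs)]
        simp only [hY, map_smul, smul_apply, smul_eq_mul]
        have hρ0 : ρ x < 0 := (h.mem_iff x (hχU hxs)).1 hx
        have h2 := hC x ⟨hx, hxs⟩
        set d := deriv Real.smoothTransition (-((k : ℝ) * ρ x) - 1) with hd
        -- The factor `d` vanishes once `-(k ρ x) > 2`, so the factor `k` from the gradient of `η k`
        -- is always compensated by `|ρ x|`.
        have hkey : |d| * ((k : ℝ) * |ρ x|) ≤ B * 2 := by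
          rw [abs_of_neg hρ0]
          rcases le_or_gt (-((k : ℝ) * ρ x) - 1) 1 with h3 | h3
          · refine mul_le_mul (hB _) (by linarith) ?_ hB0
            have : (0 : ℝ) ≤ k := Nat.cast_nonneg k
            nlinarith
          · rw [hd, deriv_smoothTransition_of_one_lt h3]
            simp only [abs_zero, zero_mul]
            positivity
        calc ‖d * -(k : ℝ) * (χ x * A x (gradient ρ x))‖
            = ‖χ x‖ * (|d| * (k * |A x (gradient ρ x)|)) := by
              simp only [norm_mul, norm_neg, Real.norm_eq_abs, Nat.abs_cast]; ring
          _ ≤ X * (|d| * (k * (|C| * |ρ x|))) := by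
              gcongr
              · exact hX x
              · exact h2.trans (by gcongr; exact le_abs_self _)
          _ = X * (|d| * (k * |ρ x|) * |C|) := by ring
          _ ≤ X * (B * 2 * |C|) := by gcongr
          _ = _ := by ring
    · have : (fun y => η k y • Y y) =ᶠ[𝓝 x] fun _ => 0 := by
        filter_upwards [hY0 x hxs] with y hy
        simp [hy]
      rw [this.codiv_eq]
      simp only [codiv, fderiv_fun_const, Pi.zero_apply, zero_apply,
        Finset.sum_const_zero, norm_zero]
      positivity
  have hlim : Tendsto (fun k : ℕ => ∫ x in Ω, codiv (fun y => η k y • Y y) x) atTop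
      (𝓝 (∫ x in Ω, codiv Y x)) := by
    refine tendsto_integral_of_dominated_convergence (fun _ => |C₁| + X * (B * (2 * |C|)))
      (fun k => (continuousOn_codiv hΩ (hs k)).aestronglyMeasurable hΩ.measurableSet) ?_
      (fun k => (ae_restrict_iff' hΩ.measurableSet).2 (ae_of_all _ (hbound k)))
      ((ae_restrict_iff' hΩ.measurableSet).2 (ae_of_all _ fun x hx => ?_))
    · have : IsFiniteMeasure (volume.restrict Ω) := ⟨by simpa using hb.measure_lt_top⟩
      exact integrable_const _
    · refine tendsto_const_nhds.congr' ?_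
      by_cases hxs : x ∈ tsupport χ
      · have hρ0 : ρ x < 0 := (h.mem_iff x (hχU hxs)).1 hx
        have hev : ∀ᶠ k : ℕ in atTop, 2 / (-ρ x) < (k : ℝ) :=
          tendsto_natCast_atTop_atTop.eventually_gt_atTop _
        filter_upwards [hev] with k hk
        symm
        refine Filter.EventuallyEq.codiv_eq ?_
        have hlt : 2 < -((k : ℝ) * ρ x) := by
          rw [div_lt_iff₀ (by linarith)] at hk
          linarith
        have hcont : ContinuousAt (fun y => -((k : ℝ) * ρ y)) x :=
          ((continuousAt_const.mul (hρs x (hχU hxs)).continuousAt)).neg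
        filter_upwards [hcont.eventually (lt_mem_nhds hlt)] with y hy
        simp only [hη]
        rw [Real.smoothTransition.one_of_one_le (by linarith), one_smul]
      · refine Eventually.of_forall fun k => ?_
        refine Filter.EventuallyEq.codiv_eq ?_
        filter_upwards [hY0 x hxs] with y hy
        simp [hy]
  refine tendsto_nhds_unique hlim (tendsto_const_nhds.congr' ?_)
  filter_upwards [eventually_gt_atTop 0] with k hk using (hzero k hk).symm

/-- The divergence theorem for tangential covector fields on a smooth bounded domain. -/
theorem IsSmoothBoundedDomain.integral_codiv_eq_zero {Ω : Set (EuclideanSpace ℝ (Fin n))}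
    (hΩ : IsSmoothBoundedDomain Ω)
    {A : EuclideanSpace ℝ (Fin n) → EuclideanSpace ℝ (Fin n) →L[ℝ] ℝ}
    (hAc : ContinuousOn A (closure Ω)) (hA : ContDiffOn ℝ 1 A Ω) {M : ℝ}
    (hM : ∀ x ∈ Ω, ‖fderiv ℝ A x‖ ≤ M) (hν : ∀ x ν, IsOutwardNormal Ω x ν → A x ν = 0) :
    ∫ x in Ω, codiv A x = 0 := by
  have hcomp : IsCompact (closure Ω) := hΩ.isBounded.isCompact_closure
  -- Each point has a ball in which cutoffs of `A` have divergence of zero integral: by compact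
  -- support at interior points, by the level set argument at boundary points. A finite subcover and
  -- a smooth partition of unity then recover `A`.
  have hloc : ∀ x ∈ closure Ω, ∃ r > 0, ∀ χ : EuclideanSpace ℝ (Fin n) → ℝ, ContDiff ℝ ∞ χ →
      tsupport χ ⊆ Metric.ball x r → ∫ x in Ω, codiv (fun y => χ y • A y) x = 0 := by
    intro x hx
    by_cases hxΩ : x ∈ Ω
    · obtain ⟨r, hr, hrΩ⟩ := Metric.isOpen_iff.1 hΩ.isOpen x hxΩ
      refine ⟨r, hr, fun χ hχ hs => ?_⟩
      refine integral_codiv_eq_zero_of_compact (K := tsupport χ) hΩ.isOpen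
        (Metric.isCompact_of_isClosed_isBounded (isClosed_tsupport χ)
          (Metric.isBounded_ball.subset hs)) (hs.trans hrΩ)
        ((hχ.of_le (by norm_cast)).contDiffOn.smul hA) fun y hy => ?_
      simp [image_eq_zero_of_notMem_tsupport hy]
    · have hfr : x ∈ frontier Ω := by rw [hΩ.isOpen.frontier_eq]; exact ⟨hx, hxΩ⟩
      obtain ⟨U, ρ, hxU, h⟩ := hΩ.smooth_boundary x hfr
      obtain ⟨r, hr, hrU, C, hC⟩ := exists_abs_apply_gradient_le hΩ.isOpen h hxU hAc hA hM hν
      refine ⟨r, hr, fun χ hχ hs => ?_⟩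
      exact integral_codiv_smul_eq_zero_of_boundary hΩ.isOpen hΩ.isBounded h hAc hA hM hχ
        (Metric.isCompact_of_isClosed_isBounded (isClosed_tsupport χ)
          (Metric.isBounded_ball.subset hs)) (hs.trans hrU)
        fun y hy => hC y ⟨hy.1, hs hy.2⟩
  choose! r hr hloc using hloc
  obtain ⟨t, ht, hcover⟩ := hcomp.elim_nhds_subcover (fun x => Metric.ball x (r x))
    fun x hx => Metric.ball_mem_nhds x (hr x hx)
  obtain ⟨f, hf⟩ := SmoothPartitionOfUnity.exists_isSubordinate
    (modelWithCornersSelf ℝ (EuclideanSpace ℝ (Fin n))) (s := closure Ω) isClosed_closure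
    (fun i : t => Metric.ball (i : EuclideanSpace ℝ (Fin n)) (r i)) (fun _ => Metric.isOpen_ball)
    (by simpa [iUnion_subtype] using hcover)
  have hfs : ∀ i, ContDiff ℝ ∞ (f i) := fun i => (f i).contMDiff.contDiff
  have hsum : ∀ x ∈ closure Ω, ∑ i, f i x = 1 := fun x hx => by
    rw [← f.sum_eq_one hx, finsum_eq_sum_of_fintype]
  have hd : ∀ x ∈ Ω, DifferentiableAt ℝ A x := fun x hx =>
    (hA.contDiffAt (hΩ.isOpen.mem_nhds hx)).differentiableAt one_ne_zero
  have hdec : ∀ x ∈ Ω, codiv A x = ∑ i, codiv (fun y => f i y • A y) x := by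
    intro x hx
    have h1 : A =ᶠ[𝓝 x] fun y => ∑ i, f i y • A y := by
      filter_upwards [hΩ.isOpen.mem_nhds hx] with y hy
      rw [← Finset.sum_smul, hsum y (subset_closure hy), one_smul]
    rw [h1.codiv_eq]
    unfold codiv
    rw [fderiv_fun_sum (A := fun i y => f i y • A y)
      fun i _ => ((hfs i).differentiable (by simp) x).smul (hd x hx), Finset.sum_comm]
    simp
  rw [setIntegral_congr_fun hΩ.isOpen.measurableSet hdec, integral_finsetSum]
  · exact Finset.sum_eq_zero fun i _ => hloc i (ht i i.2) (f i) (hfs i) (hf i)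
  · intro i _
    obtain ⟨C, hC⟩ := exists_bound_codiv_smul hΩ.isOpen hΩ.isBounded hAc hA hM (hfs i)
    exact integrableOn_of_bounded_continuousOn hΩ.isOpen hΩ.isBounded (continuousOn_codiv hΩ.isOpen
      (((hfs i).of_le (by norm_cast)).contDiffOn.smul hA)) hC

/-! ### Sobolev and Gagliardo–Nirenberg inequalities -/

/-- An open half space contains a basis. -/
theorem exists_basis_inner_neg {N : EuclideanSpace ℝ (Fin n)} (hN : N ≠ 0) :
    ∃ b : Module.Basis (Fin n) ℝ (EuclideanSpace ℝ (Fin n)), ∀ i, ⟪N, b i⟫ < 0 := by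
  set s : Set (EuclideanSpace ℝ (Fin n)) := {v | ⟪N, v⟫ < 0} with hs
  have hso : IsOpen s := isOpen_lt (by fun_prop) continuous_const
  have hne : -N ∈ s := by
    simp only [hs, mem_ofPred_eq, inner_neg_right, real_inner_self_eq_norm_sq]
    have := norm_pos_iff.2 hN
    nlinarith
  have hspan : Submodule.span ℝ s = ⊤ := by
    refine Submodule.eq_top_of_nonempty_interior' _ ⟨-N, ?_⟩
    exact interior_mono Submodule.subset_span (by rwa [hso.interior_eq])
  obtain ⟨b, hbs, hbspan, hli⟩ := exists_linearIndependent ℝ s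
  have hfin : Fintype b := hli.setFinite.fintype
  let B := Module.Basis.mk hli (by rw [Subtype.range_coe, hbspan, hspan])
  have hcard : Fintype.card b = Fintype.card (Fin n) := by
    rw [← Module.finrank_eq_card_basis B]; simp
  refine ⟨B.reindex (Fintype.equivOfCardEq hcard), fun i => ?_⟩
  rw [Module.Basis.reindex_apply, Module.Basis.mk_apply]
  exact hbs (Subtype.coe_prop _)

/-- Near each point of its closure, a smooth domain is invariant under small positive translations
in the directions of some basis. -/
theorem IsSmoothBoundedDomain.exists_inward_basis {Ω : Set (EuclideanSpace ℝ (Fin n))}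
    (hΩ : IsSmoothBoundedDomain Ω) {x₀ : EuclideanSpace ℝ (Fin n)} (hx₀ : x₀ ∈ closure Ω) :
    ∃ r > 0, ∃ b : Module.Basis (Fin n) ℝ (EuclideanSpace ℝ (Fin n)),
      ∀ x ∈ Ω, x ∈ Metric.ball x₀ r → ∀ i, ∀ t : ℝ, 0 ≤ t → x + t • b i ∈ Metric.ball x₀ r →
        x + t • b i ∈ Ω := by
  by_cases hxΩ : x₀ ∈ Ω
  · obtain ⟨r, hr, hrΩ⟩ := Metric.isOpen_iff.1 hΩ.isOpen x₀ hxΩ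
    exact ⟨r, hr, (EuclideanSpace.basisFun (Fin n) ℝ).toBasis, fun x _ _ i t _ h => hrΩ h⟩
  have hfr : x₀ ∈ frontier Ω := by rw [hΩ.isOpen.frontier_eq]; exact ⟨hx₀, hxΩ⟩
  obtain ⟨U, ρ, hxU, h⟩ := hΩ.smooth_boundary x₀ hfr
  obtain ⟨b, hb⟩ := exists_basis_inner_neg (h.gradient_ne_zero x₀ hxU)
  -- The strict inequalities persist near `x₀`, so `ρ` decreases along every `b i` and `{ρ < 0}` is
  -- not left inside the ball.
  have hev : ∀ᶠ x in 𝓝 x₀, x ∈ U ∧ ∀ i, ⟪gradient ρ x, b i⟫ < 0 := by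
    refine Filter.Eventually.and (h.isOpen.mem_nhds hxU) (eventually_all.2 fun i => ?_)
    have hct : ContinuousAt (fun x => ⟪gradient ρ x, b i⟫) x₀ :=
      (h.contDiffOn_gradient.continuousOn.continuousAt (h.isOpen.mem_nhds hxU)).inner
        continuousAt_const
    exact hct.eventually (gt_mem_nhds (hb i))
  obtain ⟨r, hr, hrU⟩ := Metric.nhds_basis_ball.mem_iff.1 hev
  refine ⟨r, hr, b, fun x hx hxr i t ht hxt => ?_⟩
  rcases ht.eq_or_lt with rfl | ht
  · simpa using hx
  have hseg : ∀ s ∈ Icc 0 t, x + s • b i ∈ Metric.ball x₀ r := fun s hs => by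
    have := (convex_ball x₀ r).add_smul_mem hxr hxt (t := s / t)
      ⟨by have := hs.1; positivity, by rw [div_le_one ht]; exact hs.2⟩
    rwa [smul_smul, div_mul_cancel₀ _ ht.ne'] at this
  have hd : ∀ s ∈ Icc 0 t, HasDerivAt (fun s : ℝ => ρ (x + s • b i))
      ⟪gradient ρ (x + s • b i), b i⟫ s := fun s hs => by
    have h1 : HasFDerivAt ρ (fderiv ℝ ρ (x + s • b i)) (x + s • b i) :=
      ((h.contDiffOn.contDiffAt (h.isOpen.mem_nhds (hrU (hseg s hs)).1)).differentiableAt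
        (by simp)).hasFDerivAt
    have h2 : HasDerivAt (fun s : ℝ => x + s • b i) (b i) s := by
      simpa using ((hasDerivAt_id s).smul_const (b i)).const_add x
    have h3 := h1.comp_hasDerivAt s h2
    rw [gradient, InnerProductSpace.toDual_symm_apply]
    exact h3
  have hanti : AntitoneOn (fun s : ℝ => ρ (x + s • b i)) (Icc 0 t) := by
    refine antitoneOn_of_deriv_nonpos (convex_Icc 0 t)
      (fun s hs => (hd s hs).continuousAt.continuousWithinAt) (fun s hs => ?_) (fun s hs => ?_)
    · exact (hd s (interior_subset hs)).differentiableAt.differentiableWithinAt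
    · rw [(hd s (interior_subset hs)).deriv]
      exact ((hrU (hseg s (interior_subset hs))).2 i).le
  have h1 := hanti ⟨le_rfl, ht.le⟩ ⟨ht.le, le_rfl⟩ ht.le
  simp only [zero_smul, add_zero] at h1
  rw [h.mem_iff _ (hrU hxt).1]
  exact h1.trans_lt ((h.mem_iff x (hrU hxr).1).1 hx)

/-- A function supported in a ball is controlled by the integral of its derivative along a ray
which stays in the domain as long as it stays in the ball. -/
theorem enorm_le_lintegral_fderiv_ray {Ω : Set (EuclideanSpace ℝ (Fin n))} (hΩ : IsOpen Ω)
    {x₀ : EuclideanSpace ℝ (Fin n)} {r : ℝ} {g : EuclideanSpace ℝ (Fin n) → ℝ}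
    (hg : ContDiffOn ℝ 1 g Ω) (hs : tsupport g ⊆ Metric.ball x₀ r)
    {e x : EuclideanSpace ℝ (Fin n)} (he : e ≠ 0)
    (hray : x ∈ Metric.ball x₀ r → ∀ t : ℝ, 0 ≤ t → x + t • e ∈ Metric.ball x₀ r → x + t • e ∈ Ω) :
    ‖g x‖ₑ ≤ ∫⁻ t : ℝ, Ω.indicator (fun y => ‖e‖ₑ * ‖fderiv ℝ g y‖ₑ) (x + t • e) := by
  by_cases hx0 : g x = 0
  · simp [hx0]
  have hxs : x ∈ tsupport g := subset_tsupport g hx0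
  have hxb := hs hxs
  have hlc : Continuous fun t : ℝ => x + t • e := by fun_prop
  have hScl : IsClosed ((fun t : ℝ => x + t • e) ⁻¹' tsupport g) :=
    (isClosed_tsupport g).preimage hlc
  have he0 : 0 < ‖e‖ := norm_pos_iff.2 he
  have hScomp : IsCompact ((fun t : ℝ => x + t • e) ⁻¹' tsupport g) := by
    refine Metric.isCompact_of_isClosed_isBounded hScl ?_
    refine (Metric.isBounded_closedBall (x := (0 : ℝ)) (r := (2 * r) / ‖e‖)).subset fun t ht => ?_
    rw [mem_closedBall_zero_iff, le_div_iff₀ he0, ← norm_smul]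
    have h1 := hs ht
    rw [Metric.mem_ball] at h1 hxb
    calc ‖t • e‖ = dist (x + t • e) x := by simp [dist_eq_norm]
      _ ≤ dist (x + t • e) x₀ + dist x x₀ := dist_triangle_right _ _ _
      _ ≤ 2 * r := by linarith
  -- `τ` is the last parameter at which the line meets the support. Slightly later, at `T`, `g`
  -- vanishes while the point is still in the ball. Convexity of the ball and `hray` keep the whole
  -- segment in `Ω`, where `g` is `C¹`.
  obtain ⟨τ, hτ, hτmax⟩ := hScomp.exists_isGreatest ⟨0, by simpa using hxs⟩
  have hτ0 : 0 ≤ τ := hτmax (by simpa using hxs)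
  have hev : ∀ᶠ t in 𝓝[>] τ, x + t • e ∈ Metric.ball x₀ r :=
    (hlc.continuousAt.continuousWithinAt).eventually (Metric.isOpen_ball.mem_nhds (hs hτ))
  obtain ⟨T, hTb, hTτ⟩ := (hev.and self_mem_nhdsWithin).exists
  have hT0 : 0 < T := hτ0.trans_lt hTτ
  have hgT : g (x + T • e) = 0 := by
    refine image_eq_zero_of_notMem_tsupport fun hmem => ?_
    exact absurd (hτmax hmem) (not_le.2 hTτ)
  have hseg : ∀ t ∈ Icc 0 T, x + t • e ∈ Ω := fun t ht => by
    refine hray hxb t ht.1 ?_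
    have := (convex_ball x₀ r).add_smul_mem hxb hTb (t := t / T)
      ⟨by have := ht.1; positivity, by rw [div_le_one hT0]; exact ht.2⟩
    rwa [smul_smul, div_mul_cancel₀ _ hT0.ne'] at this
  have hd : ∀ t ∈ uIcc 0 T, HasDerivAt (fun t : ℝ => g (x + t • e))
      (fderiv ℝ g (x + t • e) e) t := fun t ht => by
    rw [uIcc_of_le hT0.le] at ht
    have h2 : HasDerivAt (fun s : ℝ => x + s • e) e t := by
      simpa using ((hasDerivAt_id t).smul_const e).const_add x
    exact (((hg.contDiffAt (hΩ.mem_nhds (hseg t ht))).differentiableAt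
      one_ne_zero).hasFDerivAt).comp_hasDerivAt t h2
  have hcont : ContinuousOn (fun t : ℝ => fderiv ℝ g (x + t • e) e) (Icc 0 T) :=
    ((hg.continuousOn_fderiv_of_isOpen hΩ le_rfl).comp hlc.continuousOn hseg).clm_apply
      continuousOn_const
  have hftc := intervalIntegral.integral_eq_sub_of_hasDerivAt hd
    (by rw [← uIcc_of_le hT0.le] at hcont; exact hcont.intervalIntegrable)
  rw [hgT] at hftc
  simp only [zero_smul, add_zero, zero_sub] at hftc
  calc ‖g x‖ₑ = ‖∫ t in (0 : ℝ)..T, fderiv ℝ g (x + t • e) e‖ₑ := by rw [hftc, enorm_neg]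
    _ ≤ ∫⁻ t in Ioc 0 T, ‖fderiv ℝ g (x + t • e) e‖ₑ := by
        rw [intervalIntegral.integral_of_le hT0.le]
        exact enorm_integral_le_lintegral_enorm _
    _ ≤ ∫⁻ t in Ioc 0 T, Ω.indicator (fun y => ‖e‖ₑ * ‖fderiv ℝ g y‖ₑ) (x + t • e) := by
        refine setLIntegral_mono' measurableSet_Ioc fun t ht => ?_
        rw [indicator_of_mem (hseg t ⟨ht.1.le, ht.2⟩), mul_comm]
        exact (fderiv ℝ g (x + t • e)).le_opENorm e
    _ ≤ _ := setLIntegral_le_lintegral _ _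

/-- Nothing is known about `g` outside `Ω`; under the indicator it may be replaced by its extension
by zero, which is measurable. -/
theorem measurable_indicator_enorm_add_fderiv {Ω : Set (EuclideanSpace ℝ (Fin n))} (hΩ : IsOpen Ω)
    {g : EuclideanSpace ℝ (Fin n) → ℝ} (hg : ContinuousOn g Ω) (B : ℝ≥0∞) :
    Measurable (Ω.indicator fun y => ‖g y‖ₑ + B * ‖fderiv ℝ g y‖ₑ) := by
  classical
  have h1 : Measurable (Ω.piecewise g fun _ => 0) :=
    hg.measurable_piecewise continuousOn_const hΩ.measurableSet
  have h2 : (Ω.indicator fun y => ‖g y‖ₑ + B * ‖fderiv ℝ g y‖ₑ) =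
      Ω.indicator fun y => ‖Ω.piecewise g (fun _ => 0) y‖ₑ + B * ‖fderiv ℝ g y‖ₑ := by
    ext y
    by_cases hy : y ∈ Ω <;> simp [hy]
  rw [h2]
  exact (h1.enorm.add ((measurable_fderiv ℝ g).enorm.const_mul B)).indicator hΩ.measurableSet

/-- The Gagliardo–Nirenberg–Sobolev inequality for functions which vanish off a ball, in which the
domain is invariant under positive translations along a basis. -/
theorem exists_lintegral_rpow_le_of_tsupport_subset_ball {Ω : Set (EuclideanSpace ℝ (Fin n))}
    (hΩ : IsOpen Ω) {x₀ : EuclideanSpace ℝ (Fin n)} {r : ℝ}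
    (b : Module.Basis (Fin n) ℝ (EuclideanSpace ℝ (Fin n)))
    (hb : ∀ x ∈ Ω, x ∈ Metric.ball x₀ r → ∀ i, ∀ t : ℝ, 0 ≤ t →
      x + t • b i ∈ Metric.ball x₀ r → x + t • b i ∈ Ω)
    {p : ℝ} (hp : 0 ≤ p) (hnp : ((n : ℝ) - 1) * p ≤ 1) :
    ∃ C : ℝ≥0∞, C ≠ ⊤ ∧ ∀ g : EuclideanSpace ℝ (Fin n) → ℝ, ContDiffOn ℝ 1 g Ω →
      tsupport g ⊆ Metric.ball x₀ r →
      ∫⁻ x in Ω, ‖g x‖ₑ ^ (1 + p) ≤ C * (∫⁻ x in Ω, (‖g x‖ₑ + ‖fderiv ℝ g x‖ₑ)) ^ (1 + p) := by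
  -- In the coordinates of `b` the admissible rays are parallel to the axes; the change of variables
  -- costs only the Haar factor `c`.
  set L : (Fin n → ℝ) ≃L[ℝ] EuclideanSpace ℝ (Fin n) := b.equivFunL.symm with hL
  obtain ⟨c, hc0, hct, hc⟩ : ∃ c : ℝ≥0∞, c ≠ 0 ∧ c ≠ ⊤ ∧
      Measure.map L (volume : Measure (Fin n → ℝ)) = c • volume := by
    have : (Measure.map L (volume : Measure (Fin n → ℝ))).IsAddHaarMeasure :=
      L.isAddHaarMeasure_map _
    exact ⟨Measure.addHaarScalarFactor (Measure.map L volume) volume,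
      by simpa using (Measure.addHaarScalarFactor_pos_of_isAddHaarMeasure _ _).ne',
      ENNReal.coe_ne_top, Measure.isAddLeftInvariant_eq_smul _ _⟩
  -- `B` dominates every `‖b i‖`, so the single function `F` below majorises `|g|` and all the ray
  -- integrands; `1 ≤ B` allows `B` to be pulled out of `∫ F`.
  set B : ℝ≥0∞ := 1 + ∑ i, ‖b i‖ₑ with hB
  have hBt : B ≠ ⊤ := by
    rw [hB]
    exact ENNReal.add_ne_top.2 ⟨ENNReal.one_ne_top, ENNReal.sum_ne_top.2 fun i _ => enorm_ne_top⟩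
  have hlin : ∀ F : EuclideanSpace ℝ (Fin n) → ℝ≥0∞, Measurable F →
      ∫⁻ y, F (L y) = c * ∫⁻ x, F x := fun F hF => by
    rw [← lintegral_map hF L.continuous.measurable, hc, lintegral_smul_measure, smul_eq_mul]
  refine ⟨c⁻¹ * (c * B) ^ (1 + p), ENNReal.mul_ne_top (ENNReal.inv_ne_top.2 hc0)
    (ENNReal.rpow_ne_top_of_nonneg (by linarith) (ENNReal.mul_ne_top hct hBt)),
    fun g hg hs => ?_⟩
  set F := Ω.indicator fun y => ‖g y‖ₑ + B * ‖fderiv ℝ g y‖ₑ with hF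
  have hFm : Measurable F := measurable_indicator_enorm_add_fderiv hΩ hg.continuousOn B
  have hgm : Measurable (Ω.indicator fun y => ‖g y‖ₑ) := by
    simpa using measurable_indicator_enorm_add_fderiv hΩ hg.continuousOn 0
  have hgl : ∀ y i, Ω.indicator (fun x => ‖g x‖ₑ) (L y) ≤
      ∫⁻ t, F (L (Function.update y i t)) := by
    intro y i
    by_cases hy : L y ∈ Ω
    · rw [indicator_of_mem hy]
      refine (enorm_le_lintegral_fderiv_ray hΩ hg hs (b.ne_zero i)
        fun h t ht => hb _ hy h i t ht).trans ?_
      have hup : ∀ t, L (Function.update y i t) = L y + (t - y i) • b i := fun t => by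
        have h1 : Function.update y i t = y + Pi.single i (t - y i) := by
          ext j
          by_cases hj : j = i
          · subst hj; simp
          · simp [hj]
        rw [h1, map_add, hL]
        congr 1
        refine (Module.Basis.equivFun_symm_apply b _).trans ?_
        simp [Pi.single_apply]
      simp_rw [hup]
      rw [lintegral_sub_right_eq_self (fun t => F (L y + t • b i))]
      refine lintegral_mono fun t => ?_
      rw [hF]
      refine indicator_le_indicator ?_
      refine le_add_left ?_
      gcongr
      rw [hB]
      exact le_add_left (Finset.single_le_sum (f := fun i => ‖b i‖ₑ) (fun _ _ => zero_le)
        (Finset.mem_univ i))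
    · rw [indicator_of_notMem hy]
      exact zero_le
  -- The grid-lines inequality asks only for measurability, so extending `F` by zero across `∂Ω` is
  -- harmless.
  have hmain := lintegral_mul_prod_lintegral_pow_le (fun _ : Fin n => (volume : Measure ℝ)) hp
    (by simpa using hnp) (f := fun y => F (L y)) (hFm.comp L.continuous.measurable)
  rw [← volume_pi, hlin F hFm] at hmain
  -- The exponents `1 - (n - 1) p` and `n` copies of `p` add up to `1 + p`, and the first is
  -- nonnegative by `hnp`.
  have hpt : ∀ y, (Ω.indicator (fun x => ‖g x‖ₑ) (L y)) ^ (1 + p) ≤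
      F (L y) ^ (1 - ((Fintype.card (Fin n) : ℝ) - 1) * p) *
        ∏ i, (∫⁻ t, F (L (Function.update y i t))) ^ p := by
    intro y
    set a := Ω.indicator (fun x => ‖g x‖ₑ) (L y) with ha
    have h1 : a ^ (1 + p) = a ^ (1 - ((Fintype.card (Fin n) : ℝ) - 1) * p) *
        ∏ _i : Fin n, a ^ p := by
      rw [Finset.prod_const, ← ENNReal.rpow_natCast, ← ENNReal.rpow_mul,
        ← ENNReal.rpow_add_of_nonneg]
      · congr 1
        simp only [Finset.card_univ, Fintype.card_fin]
        ring
      · simp only [Fintype.card_fin]; linarith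
      · positivity
    rw [h1]
    refine mul_le_mul' (ENNReal.rpow_le_rpow ?_ (by simp only [Fintype.card_fin]; linarith))
      (Finset.prod_le_prod' fun i _ => ENNReal.rpow_le_rpow (hgl y i) hp)
    rw [ha, hF]
    exact indicator_le_indicator le_self_add
  have hfin := (lintegral_mono hpt).trans hmain
  rw [hlin (fun x => (Ω.indicator (fun x => ‖g x‖ₑ) x) ^ (1 + p)) (hgm.pow_const _)] at hfin
  have h2 : ∫⁻ x, (Ω.indicator (fun x => ‖g x‖ₑ) x) ^ (1 + p) = ∫⁻ x in Ω, ‖g x‖ₑ ^ (1 + p) := by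
    rw [← lintegral_indicator hΩ.measurableSet]
    refine lintegral_congr fun x => ?_
    by_cases hx : x ∈ Ω
    · simp [hx]
    · simp [hx, ENNReal.zero_rpow_of_pos (show 0 < 1 + p by linarith)]
  have h3 : ∫⁻ x, F x ≤ B * ∫⁻ x in Ω, (‖g x‖ₑ + ‖fderiv ℝ g x‖ₑ) := by
    rw [hF, lintegral_indicator hΩ.measurableSet, ← lintegral_const_mul' _ _ hBt]
    refine lintegral_mono fun x => ?_
    simp only
    rw [mul_add]
    gcongr
    exact le_mul_of_one_le_left zero_le (by rw [hB]; exact le_self_add)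
  rw [h2] at hfin
  calc ∫⁻ x in Ω, ‖g x‖ₑ ^ (1 + p) = c⁻¹ * (c * ∫⁻ x in Ω, ‖g x‖ₑ ^ (1 + p)) := by
        rw [← mul_assoc, ENNReal.inv_mul_cancel hc0 hct, one_mul]
    _ ≤ c⁻¹ * (c * (B * ∫⁻ x in Ω, (‖g x‖ₑ + ‖fderiv ℝ g x‖ₑ))) ^ (1 + p) := by
        gcongr
        refine hfin.trans ?_
        gcongr
    _ = _ := by
        rw [← mul_assoc c, ENNReal.mul_rpow_of_nonneg _ _ (by linarith : 0 ≤ 1 + p), mul_assoc]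

/-- The Gagliardo–Nirenberg–Sobolev inequality `W^{1,1}(Ω) ⊆ L^{1+p}(Ω)` on a smooth bounded
domain. -/
theorem IsSmoothBoundedDomain.exists_lintegral_rpow_le {Ω : Set (EuclideanSpace ℝ (Fin n))}
    (hΩ : IsSmoothBoundedDomain Ω) {p : ℝ} (hp : 0 ≤ p) (hnp : ((n : ℝ) - 1) * p ≤ 1) :
    ∃ C : ℝ≥0∞, C ≠ ⊤ ∧ ∀ w : EuclideanSpace ℝ (Fin n) → ℝ, ContDiffOn ℝ 1 w Ω →
      ∫⁻ x in Ω, ‖w x‖ₑ ^ (1 + p) ≤ C * (∫⁻ x in Ω, (‖w x‖ₑ + ‖fderiv ℝ w x‖ₑ)) ^ (1 + p) := by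
  have hcomp : IsCompact (closure Ω) := hΩ.isBounded.isCompact_closure
  have key : ∃ C : ℝ≥0∞, C ≠ ⊤ ∧ ∀ w : EuclideanSpace ℝ (Fin n) → ℝ, ContDiffOn ℝ 1 w Ω →
      ∫⁻ x in Ω ∩ closure Ω, ‖w x‖ₑ ^ (1 + p) ≤
        C * (∫⁻ x in Ω, (‖w x‖ₑ + ‖fderiv ℝ w x‖ₑ)) ^ (1 + p) := by
    -- The property of `S` is monotone and stable under unions, so compactness reduces it to a small
    -- ball about each point of the closure, where a bump function localises `w`.
    refine hcomp.induction_on (p := fun S => ∃ C : ℝ≥0∞, C ≠ ⊤ ∧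
      ∀ w : EuclideanSpace ℝ (Fin n) → ℝ, ContDiffOn ℝ 1 w Ω →
      ∫⁻ x in Ω ∩ S, ‖w x‖ₑ ^ (1 + p) ≤
        C * (∫⁻ x in Ω, (‖w x‖ₑ + ‖fderiv ℝ w x‖ₑ)) ^ (1 + p)) ?_ ?_ ?_ ?_
    · exact ⟨0, by simp, by simp⟩
    · rintro s t hst ⟨C, hC, h⟩
      exact ⟨C, hC, fun w hw => (lintegral_mono_set (inter_subset_inter_right _ hst)).trans (h w hw)⟩
    · rintro s t ⟨C, hC, h⟩ ⟨C', hC', h'⟩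
      refine ⟨C + C', ENNReal.add_ne_top.2 ⟨hC, hC'⟩, fun w hw => ?_⟩
      rw [inter_union_distrib_left, add_mul]
      exact (lintegral_union_le _ _ _).trans (add_le_add (h w hw) (h' w hw))
    · intro x₀ hx₀
      obtain ⟨r, hr, b, hb⟩ := hΩ.exists_inward_basis hx₀
      obtain ⟨C, hC, h⟩ := exists_lintegral_rpow_le_of_tsupport_subset_ball hΩ.isOpen b hb hp hnp
      let χ : ContDiffBump x₀ := ⟨r / 3, r / 2, by positivity, by linarith⟩
      have hχs : ContDiff ℝ 1 χ := χ.contDiff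
      obtain ⟨D, hD⟩ := hcomp.exists_bound_of_continuousOn
        (hχs.continuous_fderiv one_ne_zero).continuousOn
      set K : ℝ≥0∞ := 1 + ENNReal.ofReal D with hK
      have hKt : K ≠ ⊤ := by simp [hK]
      refine ⟨Metric.ball x₀ (r / 3), mem_nhdsWithin_of_mem_nhds (Metric.ball_mem_nhds _
        (by positivity)), C * K ^ (1 + p), ENNReal.mul_ne_top hC
          (ENNReal.rpow_ne_top_of_nonneg (by linarith) hKt), fun w hw => ?_⟩
      have hts : tsupport (fun x => χ x * w x) ⊆ Metric.ball x₀ r := by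
        refine (tsupport_mul_subset_left (f := χ) (g := w)).trans ?_
        rw [χ.tsupport_eq]
        exact Metric.closedBall_subset_ball (show r / 2 < r by linarith)
      have h1 := h (fun x => χ x * w x) (hχs.contDiffOn.mul hw) hts
      have h2 : ∫⁻ x in Ω ∩ Metric.ball x₀ (r / 3), ‖w x‖ₑ ^ (1 + p) ≤
          ∫⁻ x in Ω, ‖χ x * w x‖ₑ ^ (1 + p) := by
        refine le_trans ?_ (lintegral_mono_set (inter_subset_left (t := Metric.ball x₀ (r / 3))))
        refine setLIntegral_mono' (hΩ.isOpen.measurableSet.inter Metric.isOpen_ball.measurableSet)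
          fun x hx => ?_
        rw [χ.one_of_mem_closedBall (Metric.ball_subset_closedBall hx.2), one_mul]
      have h3 : ∫⁻ x in Ω, (‖χ x * w x‖ₑ + ‖fderiv ℝ (fun x => χ x * w x) x‖ₑ) ≤
          K * ∫⁻ x in Ω, (‖w x‖ₑ + ‖fderiv ℝ w x‖ₑ) := by
        rw [← lintegral_const_mul' _ _ hKt]
        refine setLIntegral_mono' hΩ.isOpen.measurableSet fun x hx => ?_
        have hχ1 : ‖χ x‖ₑ ≤ 1 := by
          rw [← ofReal_norm, Real.norm_eq_abs, abs_of_nonneg χ.nonneg]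
          exact ENNReal.ofReal_le_one.2 χ.le_one
        have hχD : ‖fderiv ℝ χ x‖ₑ ≤ ENNReal.ofReal D := by
          rw [← ofReal_norm]
          exact ENNReal.ofReal_le_ofReal (hD x (subset_closure hx))
        rw [fderiv_fun_mul (hχs.differentiable one_ne_zero x)
          ((hw.contDiffAt (hΩ.isOpen.mem_nhds hx)).differentiableAt one_ne_zero)]
        calc ‖χ x * w x‖ₑ + ‖χ x • fderiv ℝ w x + w x • fderiv ℝ χ x‖ₑ
            ≤ ‖χ x‖ₑ * ‖w x‖ₑ + (‖χ x‖ₑ * ‖fderiv ℝ w x‖ₑ + ‖w x‖ₑ * ‖fderiv ℝ χ x‖ₑ) := by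
              rw [enorm_mul]
              gcongr
              refine (enorm_add_le (χ x • fderiv ℝ w x) (w x • fderiv ℝ χ x)).trans ?_
              rw [enorm_smul, enorm_smul]
          _ ≤ 1 * ‖w x‖ₑ + (1 * ‖fderiv ℝ w x‖ₑ + ‖w x‖ₑ * ENNReal.ofReal D) := by gcongr
          _ ≤ 1 * ‖w x‖ₑ + (1 * ‖fderiv ℝ w x‖ₑ + ‖w x‖ₑ * ENNReal.ofReal D) +
              ENNReal.ofReal D * ‖fderiv ℝ w x‖ₑ := le_self_add
          _ = K * (‖w x‖ₑ + ‖fderiv ℝ w x‖ₑ) := by rw [hK]; ring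
      calc _ ≤ _ := h2
        _ ≤ _ := h1
        _ ≤ C * (K * ∫⁻ x in Ω, (‖w x‖ₑ + ‖fderiv ℝ w x‖ₑ)) ^ (1 + p) := by gcongr
        _ = _ := by rw [ENNReal.mul_rpow_of_nonneg _ _ (by linarith : 0 ≤ 1 + p), mul_assoc]
  rwa [inter_eq_left.2 subset_closure] at key

/-- Chain rule; `1 < s` makes `|·|^s` differentiable at the zeros of `φ` as well. -/
theorem enorm_fderiv_abs_rpow_le {φ : EuclideanSpace ℝ (Fin n) → ℝ} {x : EuclideanSpace ℝ (Fin n)}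
    (hφ : DifferentiableAt ℝ φ x) {s : ℝ} (hs : 1 < s) :
    ‖fderiv ℝ (fun y => ‖φ y‖ ^ s) x‖ₑ ≤ ENNReal.ofReal s * ‖φ x‖ₑ ^ (s - 1) * ‖fderiv ℝ φ x‖ₑ := by
  have h1 : HasFDerivAt (fun y => ‖φ y‖ ^ s) ((s * ‖φ x‖ ^ (s - 2) * φ x) • fderiv ℝ φ x) x :=
    (hasDerivAt_norm_rpow (φ x) hs).comp_hasFDerivAt x hφ.hasFDerivAt
  have h2 : ‖s * ‖φ x‖ ^ (s - 2) * φ x‖ = s * ‖φ x‖ ^ (s - 1) := by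
    rcases eq_or_ne (φ x) 0 with h0 | h0
    · simp [h0, Real.zero_rpow (sub_pos.2 hs).ne']
    · have hp : 0 < ‖φ x‖ := norm_pos_iff.2 h0
      rw [norm_mul, norm_mul, Real.norm_of_nonneg (by linarith : (0 : ℝ) ≤ s),
        Real.norm_of_nonneg (Real.rpow_nonneg hp.le _), mul_assoc, ← Real.rpow_add_one hp.ne']
      congr 2
      ring
  rw [h1.fderiv, enorm_smul, ← ofReal_norm (s * ‖φ x‖ ^ (s - 2) * φ x), h2,
    ENNReal.ofReal_mul (by linarith), ← ENNReal.ofReal_rpow_of_nonneg (norm_nonneg _) (by linarith),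
    ofReal_norm]

/-- The Gagliardo–Nirenberg inequality at the exponent `2 + 4 / m`, where `m` is at least the
dimension. -/
theorem IsSmoothBoundedDomain.exists_gagliardo_nirenberg_lintegral
    {Ω : Set (EuclideanSpace ℝ (Fin n))} (hΩ : IsSmoothBoundedDomain Ω) {m : ℝ} (hm : 2 < m)
    (hnm : n ≤ m) :
    ∃ C : ℝ≥0∞, C ≠ ⊤ ∧ ∀ φ : EuclideanSpace ℝ (Fin n) → ℝ, ContDiffOn ℝ 1 φ Ω →
      (∃ B, ∀ x ∈ Ω, ‖φ x‖ ≤ B) →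
      ∫⁻ x in Ω, ‖φ x‖ₑ ^ (2 + 4 / m) ≤ C * (∫⁻ x in Ω, ‖φ x‖ₑ ^ (2 : ℝ)) ^ (2 / m) *
        ∫⁻ x in Ω, (‖φ x‖ₑ ^ (2 : ℝ) + ‖fderiv ℝ φ x‖ₑ ^ (2 : ℝ)) := by
  have hm0 : 0 < m := by linarith
  have hm1 : 0 < m - 1 := by linarith
  have hm2 : 0 < m - 2 := by linarith
  -- The inequality for `W^{1,1}` with this `p`, admissible because `n ≤ m`, is applied to `|φ|^s`.
  -- The choice of `s` makes `s (1 + p)` the Sobolev exponent `r = 2m / (m - 2)` of dimension `m`,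
  -- and `s - 1 = r / 2`, so that Cauchy–Schwarz on `|φ|^(s-1) |∇φ|` reproduces `J = ∫ |φ|^r`.
  set p := 1 / (m - 1) with hp
  have hp0 : 0 < p := by positivity
  obtain ⟨C, hC, hS⟩ := hΩ.exists_lintegral_rpow_le (p := p) hp0.le (by
    rw [hp, mul_one_div, div_le_one hm1]; linarith)
  set s := 2 * (m - 1) / (m - 2) with hs
  have hs1 : 1 < s := by rw [hs, lt_div_iff₀ hm2]; linarith
  set r := 2 * m / (m - 2) with hr
  have hr0 : 0 < r := by positivity
  have hsr : s * (1 + p) = r := by rw [hs, hp, hr]; field_simp; ring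
  have hsr2 : s - 1 = r * (1 / 2) := by rw [hs, hr]; field_simp; ring
  set θ := (m - 2) / m with hθ
  have hθ0 : 0 < θ := by positivity
  set S := ENNReal.ofReal s with hSdef
  have hS1 : 1 ≤ S := by rw [hSdef]; exact ENNReal.one_le_ofReal.2 hs1.le
  have hSt : S ≠ ⊤ := ENNReal.ofReal_ne_top
  set D := C * S ^ (1 + p) with hD
  have hDt : D ≠ ⊤ := ENNReal.mul_ne_top hC (ENNReal.rpow_ne_top_of_nonneg (by linarith) hSt)
  refine ⟨D ^ (2 / (1 + p)) * 2, ENNReal.mul_ne_top (ENNReal.rpow_ne_top_of_nonneg (by positivity)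
    hDt) (by simp), fun φ hφ ⟨B, hB⟩ => ?_⟩
  have hφd : ∀ x ∈ Ω, DifferentiableAt ℝ φ x := fun x hx =>
    (hφ.contDiffAt (hΩ.isOpen.mem_nhds hx)).differentiableAt one_ne_zero
  have hma : AEMeasurable (fun x => ‖φ x‖ₑ) (volume.restrict Ω) :=
    (hφ.continuousOn.aestronglyMeasurable hΩ.isOpen.measurableSet).enorm
  have hmd : AEMeasurable (fun x => ‖fderiv ℝ φ x‖ₑ) (volume.restrict Ω) :=
    (measurable_fderiv ℝ φ).enorm.aemeasurable
  set J := ∫⁻ x in Ω, ‖φ x‖ₑ ^ r with hJ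
  set H := ∫⁻ x in Ω, (‖φ x‖ₑ + ‖fderiv ℝ φ x‖ₑ) ^ (2 : ℝ) with hH
  -- Finiteness, from the boundedness of `φ`, is what permits cancelling a power of `J` below.
  have hJt : J ≠ ⊤ := by
    have h1 : J ≤ ∫⁻ _ in Ω, ENNReal.ofReal B ^ r := by
      refine setLIntegral_mono' hΩ.isOpen.measurableSet fun x hx => ?_
      gcongr
      rw [← ofReal_norm]
      exact ENNReal.ofReal_le_ofReal (hB x hx)
    refine ne_top_of_le_ne_top ?_ h1
    rw [setLIntegral_const]
    exact ENNReal.mul_ne_top (ENNReal.rpow_ne_top_of_nonneg hr0.le ENNReal.ofReal_ne_top)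
      hΩ.isBounded.measure_lt_top.ne
  have hw := hS (fun x => ‖φ x‖ ^ s) ((contDiff_norm_rpow hs1).comp_contDiffOn hφ)
  have hwl : ∫⁻ x in Ω, ‖‖φ x‖ ^ s‖ₑ ^ (1 + p) = J := by
    refine lintegral_congr fun x => ?_
    rw [Real.enorm_rpow_of_nonneg (norm_nonneg _) (by linarith), enorm_norm, ← ENNReal.rpow_mul,
      hsr]
  have hwr : ∫⁻ x in Ω, (‖‖φ x‖ ^ s‖ₑ + ‖fderiv ℝ (fun y => ‖φ y‖ ^ s) x‖ₑ) ≤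
      S * (J ^ (1 / 2 : ℝ) * H ^ (1 / 2 : ℝ)) := by
    calc _ ≤ ∫⁻ x in Ω, S * ((‖φ x‖ₑ ^ r) ^ (1 / 2 : ℝ) *
          ((‖φ x‖ₑ + ‖fderiv ℝ φ x‖ₑ) ^ (2 : ℝ)) ^ (1 / 2 : ℝ)) := by
          refine setLIntegral_mono' hΩ.isOpen.measurableSet fun x hx => ?_
          rw [← ENNReal.rpow_mul, ← ENNReal.rpow_mul, ← hsr2]
          norm_num only [ENNReal.rpow_one]
          rw [mul_add, mul_add]
          refine add_le_add ?_ ?_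
          · rw [Real.enorm_rpow_of_nonneg (norm_nonneg _) (by linarith), enorm_norm]
            calc ‖φ x‖ₑ ^ s = ‖φ x‖ₑ ^ (s - 1) * ‖φ x‖ₑ ^ (1 : ℝ) := by
                  rw [← ENNReal.rpow_add_of_nonneg _ _ (by linarith) zero_le_one]; congr 1; ring
              _ ≤ _ := by
                rw [ENNReal.rpow_one]
                exact le_mul_of_one_le_left zero_le hS1
          · rw [← mul_assoc]
            exact enorm_fderiv_abs_rpow_le (hφd x hx) hs1
      _ = S * ∫⁻ x in Ω, ((‖φ x‖ₑ ^ r) ^ (1 / 2 : ℝ) *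
          ((‖φ x‖ₑ + ‖fderiv ℝ φ x‖ₑ) ^ (2 : ℝ)) ^ (1 / 2 : ℝ)) := lintegral_const_mul' _ _ hSt
      _ ≤ _ := by
          gcongr
          exact ENNReal.lintegral_mul_norm_pow_le (hma.pow_const _) ((hma.add hmd).pow_const _)
            (by norm_num) (by norm_num) (by norm_num)
  have hJ1 : J ≤ D * (J ^ ((1 + p) / 2) * H ^ ((1 + p) / 2)) := by
    have h1p : 0 ≤ 1 + p := by linarith
    calc J ≤ C * (S * (J ^ (1 / 2 : ℝ) * H ^ (1 / 2 : ℝ))) ^ (1 + p) := by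
          rw [← hwl]
          refine hw.trans ?_
          rw [hwl]
          gcongr
      _ = _ := by
          rw [ENNReal.mul_rpow_of_nonneg _ _ h1p, ENNReal.mul_rpow_of_nonneg _ _ h1p,
            ← ENNReal.rpow_mul, ← ENNReal.rpow_mul, hD, ← mul_assoc]
          congr 3 <;> ring
  -- Since `m > 2`, the exponent `(1 + p) / 2` of `J` on the right of `hJ1` is less than one and can
  -- be absorbed. As `θ = 2 / r`, this is the squared embedding of `H¹` into `L^r`.
  have hJ2 : J ^ θ ≤ D ^ (2 / (1 + p)) * H := by
    rcases eq_or_ne J 0 with h0 | h0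
    · rw [h0, ENNReal.zero_rpow_of_pos hθ0]; exact zero_le
    have hq : 0 < 1 - (1 + p) / 2 := by
      rw [hp]
      have : 1 / (m - 1) < 1 := by rw [div_lt_one hm1]; linarith
      linarith
    have h1 : J ^ (1 - (1 + p) / 2) ≤ D * H ^ ((1 + p) / 2) := by
      have h2 : J = J ^ (1 - (1 + p) / 2) * J ^ ((1 + p) / 2) := by
        rw [← ENNReal.rpow_add _ _ h0 hJt]; simp
      have h3 : J ^ ((1 + p) / 2) ≠ 0 := by simp [h0, hJt]
      have h4 : J ^ ((1 + p) / 2) ≠ ⊤ := ENNReal.rpow_ne_top_of_nonneg (by positivity) hJt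
      rw [← ENNReal.mul_le_mul_iff_left h3 h4, ← h2]
      calc J ≤ _ := hJ1
        _ = _ := by ring
    have h2 := ENNReal.rpow_le_rpow h1 (show 0 ≤ 2 / (1 + p) by positivity)
    rw [ENNReal.mul_rpow_of_nonneg _ _ (by positivity), ← ENNReal.rpow_mul, ← ENNReal.rpow_mul] at h2
    have h3 : (1 - (1 + p) / 2) * (2 / (1 + p)) = θ := by
      rw [hθ, hp]
      have : m - 1 + 1 ≠ 0 := by linarith
      field_simp
      ring
    have h4 : (1 + p) / 2 * (2 / (1 + p)) = 1 := by field_simp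
    rwa [h3, h4, ENNReal.rpow_one] at h2
  have hH2 : H ≤ 2 * ∫⁻ x in Ω, (‖φ x‖ₑ ^ (2 : ℝ) + ‖fderiv ℝ φ x‖ₑ ^ (2 : ℝ)) := by
    rw [← lintegral_const_mul' _ _ (by simp)]
    refine lintegral_mono fun x => ?_
    have := ENNReal.rpow_add_le_mul_rpow_add_rpow ‖φ x‖ₑ ‖fderiv ℝ φ x‖ₑ (p := 2) (by norm_num)
    refine this.trans_eq ?_
    norm_num
  -- Hölder interpolation between `L²` and `L^r` with weights `2 / m` and `θ`, which add up to one.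
  calc ∫⁻ x in Ω, ‖φ x‖ₑ ^ (2 + 4 / m)
      = ∫⁻ x in Ω, (‖φ x‖ₑ ^ (2 : ℝ)) ^ (2 / m) * (‖φ x‖ₑ ^ r) ^ θ := by
        refine lintegral_congr fun x => ?_
        rw [← ENNReal.rpow_mul, ← ENNReal.rpow_mul, ← ENNReal.rpow_add_of_nonneg _ _
          (by positivity) (by positivity)]
        congr 1
        rw [hr, hθ]
        field_simp
        ring
    _ ≤ (∫⁻ x in Ω, ‖φ x‖ₑ ^ (2 : ℝ)) ^ (2 / m) * J ^ θ :=
        ENNReal.lintegral_mul_norm_pow_le (hma.pow_const _) (hma.pow_const _) (by positivity)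
          hθ0.le (by rw [hθ]; field_simp; ring)
    _ ≤ (∫⁻ x in Ω, ‖φ x‖ₑ ^ (2 : ℝ)) ^ (2 / m) * (D ^ (2 / (1 + p)) * (2 *
          ∫⁻ x in Ω, (‖φ x‖ₑ ^ (2 : ℝ) + ‖fderiv ℝ φ x‖ₑ ^ (2 : ℝ)))) := by gcongr; exact hJ2.trans (by gcongr)
    _ = _ := by ring

/-- The bounds on `φ` and its derivative make all the integrals finite, so the inequality passes to
real integrals. The Dirichlet integral enters linearly, which is what later lets it be absorbed. -/
theorem IsSmoothBoundedDomain.exists_gagliardo_nirenberg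
    {Ω : Set (EuclideanSpace ℝ (Fin n))} (hΩ : IsSmoothBoundedDomain Ω) {m : ℝ} (hm : 2 < m)
    (hnm : n ≤ m) :
    ∃ C : ℝ, 0 ≤ C ∧ ∀ φ : EuclideanSpace ℝ (Fin n) → ℝ, ContDiffOn ℝ 1 φ Ω →
      (∃ B, ∀ x ∈ Ω, ‖φ x‖ ≤ B) → (∃ B, ∀ x ∈ Ω, ‖fderiv ℝ φ x‖ ≤ B) →
      ∫ x in Ω, |φ x| ^ (2 + 4 / m) ≤ C * (∫ x in Ω, φ x ^ 2) ^ (2 / m) *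
        ((∫ x in Ω, φ x ^ 2) + ∫ x in Ω, ‖fderiv ℝ φ x‖ ^ 2) := by
  have hm0 : 0 < m := by linarith
  obtain ⟨C, hC, h⟩ := hΩ.exists_gagliardo_nirenberg_lintegral hm hnm
  refine ⟨C.toReal, ENNReal.toReal_nonneg, fun φ hφ ⟨B, hB⟩ ⟨B', hB'⟩ => ?_⟩
  have hint : ∀ (F : EuclideanSpace ℝ (Fin n) → ℝ) (s K : ℝ), 0 ≤ s → ContinuousOn F Ω →
      (∀ x, 0 ≤ F x) → (∀ x ∈ Ω, F x ≤ K) →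
      IntegrableOn (fun x => F x ^ s) Ω ∧
      ENNReal.ofReal (∫ x in Ω, F x ^ s) = ∫⁻ x in Ω, ENNReal.ofReal (F x) ^ s := by
    intro F s K hs hF hF0 hK
    have h1 : IntegrableOn (fun x => F x ^ s) Ω :=
      integrableOn_of_bounded_continuousOn hΩ.isOpen hΩ.isBounded
        (hF.rpow_const fun _ _ => Or.inr hs) (C := K ^ s) fun x hx => by
          rw [Real.norm_of_nonneg (Real.rpow_nonneg (hF0 x) _)]
          exact Real.rpow_le_rpow (hF0 x) (hK x hx) hs
    refine ⟨h1, ?_⟩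
    rw [ofReal_integral_eq_lintegral_ofReal h1 (ae_of_all _ fun x => Real.rpow_nonneg (hF0 x) _)]
    exact lintegral_congr fun x => (ENNReal.ofReal_rpow_of_nonneg (hF0 x) hs).symm
  have h0 := hint (fun x => ‖φ x‖) (2 + 4 / m) B (by positivity) hφ.continuousOn.norm
    (fun x => norm_nonneg _) hB
  have h1 := hint (fun x => ‖φ x‖) 2 B (by positivity) hφ.continuousOn.norm
    (fun x => norm_nonneg _) hB
  have h2 := hint (fun x => ‖fderiv ℝ φ x‖) 2 B' (by positivity)
    (hφ.continuousOn_fderiv_of_isOpen hΩ.isOpen le_rfl).norm (fun x => norm_nonneg _) hB'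
  have hmain := h φ hφ ⟨B, hB⟩
  rw [lintegral_add_left' (((hφ.continuousOn.aestronglyMeasurable
    hΩ.isOpen.measurableSet).enorm).pow_const _)] at hmain
  simp only [ofReal_norm] at h0 h1 h2
  rw [← h0.2, ← h1.2, ← h2.2] at hmain
  have hsq : ∀ x, ‖φ x‖ ^ (2 : ℝ) = φ x ^ 2 := fun x => by
    rw [Real.rpow_two, Real.norm_eq_abs, sq_abs]
  have hy0 : 0 ≤ ∫ x in Ω, φ x ^ 2 := integral_nonneg fun x => sq_nonneg _
  have hd0 : 0 ≤ ∫ x in Ω, ‖fderiv ℝ φ x‖ ^ 2 := integral_nonneg fun x => sq_nonneg _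
  simp only [hsq, Real.rpow_two ‖fderiv ℝ φ _‖] at hmain
  rw [ENNReal.ofReal_rpow_of_nonneg hy0 (by positivity), ← ENNReal.ofReal_add hy0 hd0,
    ← ENNReal.ofReal_toReal hC, ← ENNReal.ofReal_mul ENNReal.toReal_nonneg,
    ← ENNReal.ofReal_mul (by positivity), ENNReal.ofReal_le_ofReal_iff (by positivity)] at hmain
  exact hmain

/-! ### The one-sided Taylor estimate -/

/-- One-sided Taylor estimate for a bistable nonlinearity: the remainder is at most of order
`|φ|^{2+p}`, uniformly in `φ ∈ ℝ`. -/
theorem IsBistable.exists_mul_sub_le {f : ℝ → ℝ} (hf : IsBistable f) {p : ℝ} (hp : 0 < p)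
    (hp1 : p ≤ 1) :
    ∃ C : ℝ, 0 ≤ C ∧ ∀ v φ : ℝ, |v| ≤ 2 →
      φ * (f (v + φ) - f v) ≤ deriv f v * φ ^ 2 + C * |φ| ^ (2 + p) := by
  have hfd : Differentiable ℝ f := hf.contDiff.differentiable (by simp)
  have hf1 : ContDiff ℝ 1 (deriv f) :=
    ((contDiff_infty_iff_deriv (𝕜 := ℝ)).1 hf.contDiff).2.of_le (by norm_cast)
  have hf'd : Differentiable ℝ (deriv f) := hf1.differentiable one_ne_zero
  have hI : IsCompact (Icc (-2 : ℝ) 2) := isCompact_Icc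
  obtain ⟨F, hF⟩ := hI.exists_bound_of_continuousOn hfd.continuous.continuousOn
  obtain ⟨L, hL⟩ := hI.exists_bound_of_continuousOn hf1.continuous.continuousOn
  obtain ⟨R₁, hR₁⟩ := (hf.tendsto_atTop.eventually_le_atBot (-F)).exists_forall_of_atTop
  obtain ⟨R₂, hR₂⟩ := (hf.tendsto_atBot.eventually_ge_atTop F).exists_forall_of_atBot
  -- For `|v| ≤ 2` and `|φ| ≥ R` the point `v + φ` lies beyond `R₁` or `R₂`, where `f` is below `-F`
  -- or above `F`.
  set R := max 1 (max (R₁ + 2) (2 - R₂)) with hR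
  have hR1 : 1 ≤ R := le_max_left _ _
  have hRa : R₁ + 2 ≤ R := (le_max_left _ _).trans (le_max_right _ _)
  have hRb : 2 - R₂ ≤ R := (le_max_right _ _).trans (le_max_right _ _)
  obtain ⟨K, hK⟩ := (isCompact_Icc (a := -(R + 2)) (b := R + 2)).exists_bound_of_continuousOn
    (hf1.continuous_deriv le_rfl).continuousOn
  have hL0 : 0 ≤ L := (norm_nonneg _).trans (hL 0 (by simp))
  have hK0 : 0 ≤ K := (norm_nonneg _).trans (hK 0 (by constructor <;> linarith))
  refine ⟨L + K * R, by positivity, fun v φ hv => ?_⟩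
  have hv' : v ∈ Icc (-2 : ℝ) 2 := abs_le.1 hv
  have hrp : 0 ≤ |φ| ^ (2 + p) := by positivity
  have hLv := abs_le.1 (hL v hv')
  have hFv := abs_le.1 (hF v hv')
  rcases le_total |φ| R with h | h
  · have hseg : ∀ x ∈ uIcc v (v + φ), x ∈ Icc (-(R + 2)) (R + 2) ∧ |x - v| ≤ |φ| := fun x hx => by
      have h1 : |x - v| ≤ |φ| := by
        have := abs_sub_left_of_mem_uIcc hx
        simpa using this
      refine ⟨?_, h1⟩
      have h2 := abs_le.1 (h1.trans h)
      constructor <;> linarith [hv'.1, hv'.2]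
    have hd1 : ∀ x ∈ uIcc v (v + φ), ‖deriv f x - deriv f v‖ ≤ K * |φ| := fun x hx => by
      have h3 : ∀ y ∈ uIcc v (v + φ), ‖deriv (deriv f) y‖ ≤ K := fun y hy => hK y (hseg y hy).1
      have := (convex_uIcc v (v + φ)).norm_image_sub_le_of_norm_deriv_le
        (fun y _ => hf'd y) h3 left_mem_uIcc hx
      exact this.trans (by gcongr; exact (hseg x hx).2)
    have hd2 := (convex_uIcc v (v + φ)).norm_image_sub_le_of_norm_hasDerivWithin_le
      (f := fun x => f x - deriv f v * x) (f' := fun x => deriv f x - deriv f v)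
      (fun x _ => by
        have h4 := (hfd x).hasDerivAt.sub ((hasDerivAt_id x).const_mul (deriv f v))
        rw [mul_one] at h4
        exact h4.hasDerivWithinAt) hd1 left_mem_uIcc right_mem_uIcc
    have hd3 : |f (v + φ) - f v - deriv f v * φ| ≤ K * |φ| * |φ| := by
      have h5 : f (v + φ) - deriv f v * (v + φ) - (f v - deriv f v * v) =
          f (v + φ) - f v - deriv f v * φ := by ring
      simp only [h5, Real.norm_eq_abs, add_sub_cancel_left] at hd2
      exact hd2
    have h6 : φ * (f (v + φ) - f v) - deriv f v * φ ^ 2 ≤ K * |φ| ^ (3 : ℝ) := by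
      calc _ = φ * (f (v + φ) - f v - deriv f v * φ) := by ring
        _ ≤ |φ| * |f (v + φ) - f v - deriv f v * φ| := by rw [← abs_mul]; exact le_abs_self _
        _ ≤ |φ| * (K * |φ| * |φ|) := by gcongr
        _ = K * |φ| ^ (3 : ℝ) := by
          rw [show (3 : ℝ) = ((3 : ℕ) : ℝ) by norm_num, Real.rpow_natCast]; ring
    -- For `|φ| ≤ R` the second-order remainder is cubic after multiplication by `φ`; `p ≤ 1` and `1
    -- ≤ R` trade the surplus power for the constant `R`.
    have h7 : |φ| ^ (3 : ℝ) ≤ R * |φ| ^ (2 + p) := by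
      calc |φ| ^ (3 : ℝ) = |φ| ^ (1 - p) * |φ| ^ (2 + p) := by
            rw [← Real.rpow_add_of_nonneg (abs_nonneg _) (by linarith) (by linarith)]
            congr 1; ring
        _ ≤ R ^ (1 - p) * |φ| ^ (2 + p) := by gcongr
        _ ≤ R ^ (1 : ℝ) * |φ| ^ (2 + p) := by
          gcongr
          linarith
        _ = _ := by rw [Real.rpow_one]
    have h8 : K * |φ| ^ (3 : ℝ) ≤ K * (R * |φ| ^ (2 + p)) := by gcongr
    have h9 : 0 ≤ L * |φ| ^ (2 + p) := by positivity
    linarith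
  -- For large `|φ|` the left side has a sign, and `L |φ|^(2+p)` only has to offset a possibly
  -- negative `f'(v) φ²`.
  · have h1 : φ * (f (v + φ) - f v) ≤ 0 := by
      rcases le_total 0 φ with hφ | hφ
      · rw [abs_of_nonneg hφ] at h
        have := hR₁ (v + φ) (by linarith [hv'.1])
        exact mul_nonpos_of_nonneg_of_nonpos hφ (by linarith)
      · rw [abs_of_nonpos hφ] at h
        have := hR₂ (v + φ) (by linarith [hv'.2])
        exact mul_nonpos_of_nonpos_of_nonneg hφ (by linarith)
    have h2 : φ ^ 2 ≤ |φ| ^ (2 + p) := by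
      rw [← sq_abs, ← Real.rpow_two]
      exact Real.rpow_le_rpow_of_exponent_le (hR1.trans h) (by linarith)
    have h3 : -L * φ ^ 2 ≤ deriv f v * φ ^ 2 := by gcongr; exact hLv.1
    have h4 : L * φ ^ 2 ≤ L * |φ| ^ (2 + p) := by gcongr
    have h5 : 0 ≤ K * R * |φ| ^ (2 + p) := by positivity
    linarith

/-! ### Integrals depending on time -/

theorem continuousOn_setIntegral {Ω : Set (EuclideanSpace ℝ (Fin n))} (hΩ : IsOpen Ω)
    (hb : Bornology.IsBounded Ω) {a b : ℝ} {F : ℝ → EuclideanSpace ℝ (Fin n) → ℝ}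
    (hF : ContinuousOn (fun q : ℝ × EuclideanSpace ℝ (Fin n) => F q.1 q.2)
      (Icc a b ×ˢ closure Ω)) :
    ContinuousOn (fun t => ∫ x in Ω, F t x) (Icc a b) := by
  have hfin : IsFiniteMeasure (volume.restrict Ω) := ⟨by simpa using hb.measure_lt_top⟩
  obtain ⟨C, hC⟩ := (isCompact_Icc.prod hb.isCompact_closure).exists_bound_of_continuousOn hF
  have hx : ∀ t ∈ Icc a b, ContinuousOn (F t) Ω := fun t ht =>
    hF.comp (f := fun x => (t, x)) (by fun_prop) fun x hx => ⟨ht, subset_closure hx⟩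
  intro t ht
  refine continuousWithinAt_of_dominated (bound := fun _ => C) ?_ ?_ (integrable_const C) ?_
  · filter_upwards [self_mem_nhdsWithin] with s hs
    exact (hx s hs).aestronglyMeasurable hΩ.measurableSet
  · filter_upwards [self_mem_nhdsWithin] with s hs
    exact (ae_restrict_iff' hΩ.measurableSet).2 (ae_of_all _ fun x hx =>
      hC (s, x) ⟨hs, subset_closure hx⟩)
  · refine (ae_restrict_iff' hΩ.measurableSet).2 (ae_of_all _ fun x hx => ?_)
    exact (hF.comp (f := fun s : ℝ => (s, x)) (by fun_prop)
      fun s hs => ⟨hs, subset_closure hx⟩ : ContinuousOn _ (Icc a b)) t ht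

theorem hasDerivAt_setIntegral {Ω : Set (EuclideanSpace ℝ (Fin n))} (hΩ : IsOpen Ω)
    (hb : Bornology.IsBounded Ω) {a b : ℝ} {F F' : ℝ → EuclideanSpace ℝ (Fin n) → ℝ}
    (hF : ContinuousOn (fun q : ℝ × EuclideanSpace ℝ (Fin n) => F q.1 q.2)
      (Icc a b ×ˢ closure Ω))
    (hF' : ContinuousOn (fun q : ℝ × EuclideanSpace ℝ (Fin n) => F' q.1 q.2)
      (Icc a b ×ˢ closure Ω))
    (hd : ∀ t ∈ Ioo a b, ∀ x ∈ Ω, HasDerivAt (fun s => F s x) (F' t x) t) {t : ℝ}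
    (ht : t ∈ Ioo a b) :
    HasDerivAt (fun t => ∫ x in Ω, F t x) (∫ x in Ω, F' t x) t := by
  have hfin : IsFiniteMeasure (volume.restrict Ω) := ⟨by simpa using hb.measure_lt_top⟩
  obtain ⟨C, hC⟩ := (isCompact_Icc.prod hb.isCompact_closure).exists_bound_of_continuousOn hF
  obtain ⟨C', hC'⟩ := (isCompact_Icc.prod hb.isCompact_closure).exists_bound_of_continuousOn hF'
  have hslice : ∀ {G : ℝ → EuclideanSpace ℝ (Fin n) → ℝ}, ContinuousOn
      (fun q : ℝ × EuclideanSpace ℝ (Fin n) => G q.1 q.2) (Icc a b ×ˢ closure Ω) →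
      ∀ s ∈ Icc a b, ContinuousOn (G s) Ω := fun hG s hs =>
    hG.comp (f := fun x => (s, x)) (by fun_prop) fun x hx => ⟨hs, subset_closure hx⟩
  refine (hasDerivAt_integral_of_dominated_loc_of_deriv_le (bound := fun _ => C')
    (Ioo_mem_nhds ht.1 ht.2) ?_ ?_ ?_ ?_ (integrable_const C') ?_).2
  · filter_upwards [Ioo_mem_nhds ht.1 ht.2] with s hs
    exact (hslice hF s (Ioo_subset_Icc_self hs)).aestronglyMeasurable hΩ.measurableSet
  · exact integrableOn_of_bounded_continuousOn hΩ hb (hslice hF t (Ioo_subset_Icc_self ht))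
      fun x hx => hC (t, x) ⟨Ioo_subset_Icc_self ht, subset_closure hx⟩
  · exact (hslice hF' t (Ioo_subset_Icc_self ht)).aestronglyMeasurable hΩ.measurableSet
  · exact (ae_restrict_iff' hΩ.measurableSet).2 (ae_of_all _ fun x hx s hs =>
      hC' (s, x) ⟨Ioo_subset_Icc_self hs, subset_closure hx⟩)
  · exact (ae_restrict_iff' hΩ.measurableSet).2 (ae_of_all _ fun x hx s hs => hd s hs x hx)

/-! ### Neumann functions, Green's identity and the spectral bound -/

/-- `w` is `C²` in `Ω` with bounded second derivatives, and its gradient extends to a continuous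
covector field `A` on the closure, which is tangential at the boundary. -/
structure IsNeumannC2 (Ω : Set (EuclideanSpace ℝ (Fin n))) (w : EuclideanSpace ℝ (Fin n) → ℝ)
    (A : EuclideanSpace ℝ (Fin n) → EuclideanSpace ℝ (Fin n) →L[ℝ] ℝ) : Prop where
  contDiffOn : ContDiffOn ℝ 2 w Ω
  continuousOn : ContinuousOn w (closure Ω)
  continuousOn_field : ContinuousOn A (closure Ω)
  field_eq : ∀ x ∈ Ω, A x = fderiv ℝ w x
  bound : ∃ M, ∀ x ∈ Ω, ‖fderiv ℝ (fderiv ℝ w) x‖ ≤ M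
  tangential : ∀ x ν, IsOutwardNormal Ω x ν → A x ν = 0

theorem fderivWithin_closure_eq {F : Type*} [NormedAddCommGroup F] [NormedSpace ℝ F]
    {Ω : Set (EuclideanSpace ℝ (Fin n))} (hΩ : IsOpen Ω)
    {w : EuclideanSpace ℝ (Fin n) → F} {x : EuclideanSpace ℝ (Fin n)} (hx : x ∈ Ω) :
    fderivWithin ℝ w (closure Ω) x = fderiv ℝ w x :=
  fderivWithin_of_mem_nhds (mem_of_superset (hΩ.mem_nhds hx) subset_closure)

theorem fderivWithin_fderivWithin_closure_eq {Ω : Set (EuclideanSpace ℝ (Fin n))} (hΩ : IsOpen Ω)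
    {w : EuclideanSpace ℝ (Fin n) → ℝ} {x : EuclideanSpace ℝ (Fin n)} (hx : x ∈ Ω) :
    fderivWithin ℝ (fderivWithin ℝ w (closure Ω)) (closure Ω) x = fderiv ℝ (fderiv ℝ w) x := by
  rw [fderivWithin_closure_eq hΩ hx]
  refine Filter.EventuallyEq.fderiv_eq ?_
  filter_upwards [hΩ.mem_nhds hx] with y hy using fderivWithin_closure_eq hΩ hy

theorem laplacian_eq_codiv (w : EuclideanSpace ℝ (Fin n) → ℝ) (x : EuclideanSpace ℝ (Fin n)) :
    Laplacian.laplacian w x = codiv (fderiv ℝ w) x := by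
  rw [InnerProductSpace.laplacian_eq_iteratedFDeriv_orthonormalBasis w
    (EuclideanSpace.basisFun (Fin n) ℝ)]
  simp [codiv, iteratedFDeriv_two_apply]

theorem apply_gradient_self (w : EuclideanSpace ℝ (Fin n) → ℝ) (x : EuclideanSpace ℝ (Fin n)) :
    fderiv ℝ w x (gradient w x) = ‖fderiv ℝ w x‖ ^ 2 := by
  have h1 : fderiv ℝ w x (gradient w x) = ⟪gradient w x, gradient w x⟫ := by
    conv_rhs => rw [gradient]
    rw [InnerProductSpace.toDual_symm_apply]
    rfl
  rw [h1, real_inner_self_eq_norm_sq, gradient, LinearIsometryEquiv.norm_map]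

theorem norm_gradient (w : EuclideanSpace ℝ (Fin n) → ℝ) (x : EuclideanSpace ℝ (Fin n)) :
    ‖gradient w x‖ = ‖fderiv ℝ w x‖ := by
  rw [gradient, LinearIsometryEquiv.norm_map]

/-- Inside `Ω` the derivatives within the closure are ordinary derivatives; their continuity on the
compact closure gives the extended field and the bound on second derivatives, and the no flux
condition is tangency. -/
theorem IsC21.isNeumannC2 {Ω : Set (EuclideanSpace ℝ (Fin n))} (hΩ : IsOpen Ω)
    (hb : Bornology.IsBounded Ω) {I : Set ℝ} {u : ℝ → EuclideanSpace ℝ (Fin n) → ℝ}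
    (hu : IsC21 Ω I u) (hn : NoFlux Ω I u) {t : ℝ} (ht : t ∈ I) :
    IsNeumannC2 Ω (u t) (fderivWithin ℝ (u t) (closure Ω)) where
  contDiffOn := (hu.contDiffOn_space t ht).mono subset_closure
  continuousOn := (hu.contDiffOn_space t ht).continuousOn
  continuousOn_field := hu.continuousOn_space_deriv.comp (f := fun x => (t, x)) (by fun_prop)
    fun _ hx => ⟨ht, hx⟩
  field_eq := fun x hx => fderivWithin_closure_eq hΩ hx
  bound := by
    have h1 : ContinuousOn (fun x => fderivWithin ℝ (fderivWithin ℝ (u t) (closure Ω))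
        (closure Ω) x) (closure Ω) :=
      hu.continuousOn_space_deriv₂.comp (f := fun x => (t, x)) (by fun_prop)
        fun _ hx => ⟨ht, hx⟩
    obtain ⟨M, hM⟩ := hb.isCompact_closure.exists_bound_of_continuousOn
      (E := EuclideanSpace ℝ (Fin n) →L[ℝ] EuclideanSpace ℝ (Fin n) →L[ℝ] ℝ) h1
    refine ⟨M, fun x hx => ?_⟩
    rw [← fderivWithin_fderivWithin_closure_eq hΩ hx]
    exact hM x (subset_closure hx)
  tangential := hn t ht

namespace IsNeumannC2

variable {Ω : Set (EuclideanSpace ℝ (Fin n))} {w w' : EuclideanSpace ℝ (Fin n) → ℝ}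
  {A A' : EuclideanSpace ℝ (Fin n) → EuclideanSpace ℝ (Fin n) →L[ℝ] ℝ}

theorem differentiableAt (h : IsNeumannC2 Ω w A) (hΩ : IsOpen Ω) {x : EuclideanSpace ℝ (Fin n)}
    (hx : x ∈ Ω) : DifferentiableAt ℝ w x :=
  (h.contDiffOn.contDiffAt (hΩ.mem_nhds hx)).differentiableAt two_ne_zero

theorem contDiffOn_fderiv (h : IsNeumannC2 Ω w A) (hΩ : IsOpen Ω) :
    ContDiffOn ℝ 1 (fderiv ℝ w) Ω :=
  h.contDiffOn.fderiv_of_isOpen hΩ (by norm_num)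

theorem differentiableAt_fderiv (h : IsNeumannC2 Ω w A) (hΩ : IsOpen Ω)
    {x : EuclideanSpace ℝ (Fin n)} (hx : x ∈ Ω) : DifferentiableAt ℝ (fderiv ℝ w) x :=
  ((h.contDiffOn_fderiv hΩ).contDiffAt (hΩ.mem_nhds hx)).differentiableAt one_ne_zero

theorem contDiffOn_field (h : IsNeumannC2 Ω w A) (hΩ : IsOpen Ω) : ContDiffOn ℝ 1 A Ω :=
  (h.contDiffOn_fderiv hΩ).congr h.field_eq

theorem field_eventuallyEq (h : IsNeumannC2 Ω w A) (hΩ : IsOpen Ω)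
    {x : EuclideanSpace ℝ (Fin n)} (hx : x ∈ Ω) : A =ᶠ[𝓝 x] fderiv ℝ w := by
  filter_upwards [hΩ.mem_nhds hx] with y hy using h.field_eq y hy

theorem exists_bound_fderiv (h : IsNeumannC2 Ω w A) (hb : Bornology.IsBounded Ω) :
    ∃ B, ∀ x ∈ Ω, ‖fderiv ℝ w x‖ ≤ B := by
  obtain ⟨B, hB⟩ := hb.isCompact_closure.exists_bound_of_continuousOn h.continuousOn_field
  exact ⟨B, fun x hx => by rw [← h.field_eq x hx]; exact hB x (subset_closure hx)⟩

theorem exists_bound (h : IsNeumannC2 Ω w A) (hb : Bornology.IsBounded Ω) :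
    ∃ B, ∀ x ∈ closure Ω, ‖w x‖ ≤ B :=
  hb.isCompact_closure.exists_bound_of_continuousOn h.continuousOn

theorem laplacian_sub (h : IsNeumannC2 Ω w A) (h' : IsNeumannC2 Ω w' A') (hΩ : IsOpen Ω)
    {x : EuclideanSpace ℝ (Fin n)} (hx : x ∈ Ω) :
    Laplacian.laplacian (fun y => w y - w' y) x =
      Laplacian.laplacian w x - Laplacian.laplacian w' x :=
  ContDiffAt.laplacian_sub (h.contDiffOn.contDiffAt (hΩ.mem_nhds hx))
    (h'.contDiffOn.contDiffAt (hΩ.mem_nhds hx))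

theorem sub (h : IsNeumannC2 Ω w A) (h' : IsNeumannC2 Ω w' A') (hΩ : IsOpen Ω) :
    IsNeumannC2 Ω (fun x => w x - w' x) (fun x => A x - A' x) where
  contDiffOn := h.contDiffOn.sub h'.contDiffOn
  continuousOn := h.continuousOn.sub h'.continuousOn
  continuousOn_field := h.continuousOn_field.sub h'.continuousOn_field
  field_eq := fun x hx => by
    rw [fderiv_fun_sub (h.differentiableAt hΩ hx) (h'.differentiableAt hΩ hx), h.field_eq x hx,
      h'.field_eq x hx]
  bound := by
    obtain ⟨M, hM⟩ := h.bound
    obtain ⟨M', hM'⟩ := h'.bound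
    refine ⟨M + M', fun x hx => ?_⟩
    have h1 : fderiv ℝ (fun y => w y - w' y) =ᶠ[𝓝 x] fun y => fderiv ℝ w y - fderiv ℝ w' y := by
      filter_upwards [hΩ.mem_nhds hx] with y hy
      rw [fderiv_fun_sub (h.differentiableAt hΩ hy) (h'.differentiableAt hΩ hy)]
    rw [h1.fderiv_eq, fderiv_fun_sub (h.differentiableAt_fderiv hΩ hx)
      (h'.differentiableAt_fderiv hΩ hx)]
    exact (norm_sub_le (fderiv ℝ (fderiv ℝ w) x) _).trans (add_le_add (hM x hx) (hM' x hx))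
  tangential := fun x ν hν => by simp [h.tangential x ν hν, h'.tangential x ν hν]

theorem continuousOn_laplacian (h : IsNeumannC2 Ω w A) (hΩ : IsOpen Ω) :
    ContinuousOn (Laplacian.laplacian w) Ω :=
  (continuousOn_codiv hΩ (h.contDiffOn_fderiv hΩ)).congr fun x _ => laplacian_eq_codiv w x

theorem exists_bound_laplacian (h : IsNeumannC2 Ω w A) :
    ∃ B, ∀ x ∈ Ω, ‖Laplacian.laplacian w x‖ ≤ B := by
  obtain ⟨M, hM⟩ := h.bound
  refine ⟨n * M, fun x hx => ?_⟩
  rw [laplacian_eq_codiv]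
  exact (norm_codiv_le _ _).trans (by gcongr; exact hM x hx)

theorem integrableOn_mul_laplacian (h : IsNeumannC2 Ω w A) (hΩ : IsOpen Ω)
    (hb : Bornology.IsBounded Ω) : IntegrableOn (fun x => w x * Laplacian.laplacian w x) Ω := by
  obtain ⟨B, hB⟩ := h.exists_bound hb
  obtain ⟨B', hB'⟩ := h.exists_bound_laplacian
  refine integrableOn_of_bounded_continuousOn hΩ hb (C := B * B')
    ((h.continuousOn.mono subset_closure).mul (h.continuousOn_laplacian hΩ)) fun x hx => ?_
  rw [norm_mul]
  exact mul_le_mul (hB x (subset_closure hx)) (hB' x hx) (norm_nonneg _)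
    ((norm_nonneg _).trans (hB x (subset_closure hx)))

theorem integrableOn_sq_fderiv (h : IsNeumannC2 Ω w A) (hΩ : IsOpen Ω)
    (hb : Bornology.IsBounded Ω) : IntegrableOn (fun x => ‖fderiv ℝ w x‖ ^ 2) Ω := by
  obtain ⟨B, hB⟩ := h.exists_bound_fderiv hb
  refine integrableOn_of_bounded_continuousOn hΩ hb (C := B ^ 2)
    ((h.contDiffOn_fderiv hΩ).continuousOn.norm.pow 2) fun x hx => ?_
  rw [norm_pow, norm_norm]
  have := hB x hx
  gcongr

theorem integral_laplacian (h : IsNeumannC2 Ω w A) (hΩ : IsSmoothBoundedDomain Ω) :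
    ∫ x in Ω, Laplacian.laplacian w x = 0 := by
  obtain ⟨M, hM⟩ := h.bound
  rw [← hΩ.integral_codiv_eq_zero h.continuousOn_field (h.contDiffOn_field hΩ.isOpen)
    (fun x hx => by rw [(h.field_eventuallyEq hΩ.isOpen hx).fderiv_eq]; exact hM x hx)
    h.tangential]
  refine setIntegral_congr_fun hΩ.isOpen.measurableSet fun x hx => ?_
  rw [laplacian_eq_codiv, (h.field_eventuallyEq hΩ.isOpen hx).codiv_eq]

/-- Green's first identity. -/
theorem integral_mul_laplacian (h : IsNeumannC2 Ω w A) (hΩ : IsSmoothBoundedDomain Ω) :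
    ∫ x in Ω, w x * Laplacian.laplacian w x = - ∫ x in Ω, ‖fderiv ℝ w x‖ ^ 2 := by
  obtain ⟨M, hM⟩ := h.bound
  obtain ⟨B, hB⟩ := h.exists_bound hΩ.isBounded
  obtain ⟨B', hB'⟩ := h.exists_bound_fderiv hΩ.isBounded
  have hw1 : ContDiffOn ℝ 1 w Ω := h.contDiffOn.of_le (by norm_num)
  -- The divergence theorem for the field `w ∇w`, tangential because `∇w` is; the constant is the
  -- product rule bound for its derivative.
  have hdiv := hΩ.integral_codiv_eq_zero (A := fun x => w x • A x) (M := B * M + B' * B')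
    (h.continuousOn.smul h.continuousOn_field) (hw1.smul (h.contDiffOn_field hΩ.isOpen))
    (fun x hx => by
      have h1 := (h.field_eventuallyEq hΩ.isOpen hx)
      rw [fderiv_fun_smul (h.differentiableAt hΩ.isOpen hx)
        (h1.differentiableAt_iff.2 (h.differentiableAt_fderiv hΩ.isOpen hx)), h1.fderiv_eq,
        h.field_eq x hx]
      have hBx := hB x (subset_closure hx)
      have hB'x := hB' x hx
      refine (norm_add_le (w x • fderiv ℝ (fderiv ℝ w) x) _).trans (add_le_add ?_ ?_)
      · refine (ContinuousLinearMap.opNorm_smul_le (w x) (fderiv ℝ (fderiv ℝ w) x)).trans ?_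
        exact mul_le_mul hBx (hM x hx) (norm_nonneg (fderiv ℝ (fderiv ℝ w) x))
          ((norm_nonneg _).trans hBx)
      · refine (ContinuousLinearMap.norm_smulRight_apply (fderiv ℝ w x) (fderiv ℝ w x)).le.trans ?_
        exact mul_le_mul hB'x hB'x (norm_nonneg _) ((norm_nonneg _).trans hB'x))
    (fun x ν hν => by simp [h.tangential x ν hν])
  have hexp : ∀ x ∈ Ω, codiv (fun y => w y • A y) x =
      w x * Laplacian.laplacian w x + ‖fderiv ℝ w x‖ ^ 2 := fun x hx => by
    have h1 := h.field_eventuallyEq hΩ.isOpen hx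
    rw [codiv_smul (h.differentiableAt hΩ.isOpen hx)
      (h1.differentiableAt_iff.2 (h.differentiableAt_fderiv hΩ.isOpen hx)), h1.codiv_eq,
      h.field_eq x hx, laplacian_eq_codiv, apply_gradient_self]
  rw [setIntegral_congr_fun hΩ.isOpen.measurableSet hexp,
    integral_add (h.integrableOn_mul_laplacian hΩ.isOpen hΩ.isBounded)
      (h.integrableOn_sq_fderiv hΩ.isOpen hΩ.isBounded)] at hdiv
  linarith

theorem memLp_two (h : IsNeumannC2 Ω w A) (hΩ : IsOpen Ω) (hb : Bornology.IsBounded Ω) :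
    MemLp w 2 (volume.restrict Ω) := by
  have hfin : IsFiniteMeasure (volume.restrict Ω) := ⟨by simpa using hb.measure_lt_top⟩
  obtain ⟨B, hB⟩ := h.exists_bound hb
  exact MemLp.of_bound ((h.continuousOn.mono subset_closure).aestronglyMeasurable hΩ.measurableSet)
    B ((ae_restrict_iff' hΩ.measurableSet).2 (ae_of_all _ fun x hx => hB x (subset_closure hx)))

/-- The classical gradient is the weak gradient. -/
theorem isH1With (h : IsNeumannC2 Ω w A) (hΩ : IsOpen Ω) (hb : Bornology.IsBounded Ω) (c : ℝ) :
    IsH1With Ω (fun x => c * w x) (fun x => c • gradient w x) where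
  memLp := (h.memLp_two hΩ hb).const_mul c
  memLp_grad := by
    have hfin : IsFiniteMeasure (volume.restrict Ω) := ⟨by simpa using hb.measure_lt_top⟩
    obtain ⟨B, hB⟩ := h.exists_bound_fderiv hb
    refine MemLp.const_smul (MemLp.of_bound (C := B) ?_ ?_) c
    · refine ContinuousOn.aestronglyMeasurable ?_ hΩ.measurableSet
      exact (InnerProductSpace.toDual ℝ
        (EuclideanSpace ℝ (Fin n))).symm.continuous.comp_continuousOn
        (h.contDiffOn_fderiv hΩ).continuousOn
    · refine (ae_restrict_iff' hΩ.measurableSet).2 (ae_of_all _ fun x hx => ?_)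
      rw [norm_gradient]
      exact hB x hx
  weak_gradient := fun ψ hψ hψc hψΩ e => by
    have hw1 : ContDiffOn ℝ 1 w Ω := h.contDiffOn.of_le (by norm_num)
    obtain ⟨B, hB⟩ := h.exists_bound hb
    obtain ⟨B', hB'⟩ := h.exists_bound_fderiv hb
    have hψ1 : ContDiff ℝ 1 ψ := hψ.of_le (by norm_cast)
    have hcψ' : Continuous fun x => fderiv ℝ ψ x e :=
      (hψ1.continuous_fderiv one_ne_zero).clm_apply continuous_const
    obtain ⟨P, hP⟩ := hb.isCompact_closure.exists_bound_of_continuousOn hψ1.continuous.continuousOn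
    obtain ⟨P', hP'⟩ := hb.isCompact_closure.exists_bound_of_continuousOn hcψ'.continuousOn
    have hcw' : ContinuousOn (fun x => fderiv ℝ w x e) Ω :=
      (h.contDiffOn_fderiv hΩ).continuousOn.clm_apply continuousOn_const
    -- The product `w ψ` vanishes off the support of `ψ`, so no boundary condition is needed here.
    have hzero := integral_fderiv_apply_eq_zero volume (Z := fun x => w x * ψ x) hΩ hψc.isCompact
      hψΩ (hw1.mul hψ1.contDiffOn)
      (fun x hx => by simp [image_eq_zero_of_notMem_tsupport hx]) e
    have hexp : ∀ x ∈ Ω, fderiv ℝ (fun y => w y * ψ y) x e =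
        w x * fderiv ℝ ψ x e + fderiv ℝ w x e * ψ x := fun x hx => by
      rw [fderiv_fun_mul (h.differentiableAt hΩ hx) (hψ1.differentiable one_ne_zero x)]
      simp [mul_comm]
    have hi1 : IntegrableOn (fun x => w x * fderiv ℝ ψ x e) Ω :=
      integrableOn_of_bounded_continuousOn hΩ hb (C := B * P')
        ((h.continuousOn.mono subset_closure).mul hcψ'.continuousOn) fun x hx => by
          have hx' := subset_closure hx
          rw [norm_mul]
          exact mul_le_mul (hB x hx') (hP' x hx') (norm_nonneg _)
            ((norm_nonneg _).trans (hB x hx'))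
    have hi2 : IntegrableOn (fun x => fderiv ℝ w x e * ψ x) Ω :=
      integrableOn_of_bounded_continuousOn hΩ hb (C := (B' * ‖e‖) * P)
        (hcw'.mul hψ1.continuous.continuousOn) fun x hx => by
          have hx' := subset_closure hx
          have h1 : ‖fderiv ℝ w x e‖ ≤ B' * ‖e‖ :=
            ((fderiv ℝ w x).le_opNorm e).trans (by gcongr; exact hB' x hx)
          rw [norm_mul]
          exact mul_le_mul h1 (hP x hx') (norm_nonneg _) ((norm_nonneg _).trans h1)
    rw [setIntegral_congr_fun hΩ.measurableSet hexp, integral_add hi1 hi2] at hzero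
    have h2 : ∀ x, ⟪c • gradient w x, e⟫ * ψ x = c * (fderiv ℝ w x e * ψ x) := fun x => by
      rw [inner_smul_left, gradient, InnerProductSpace.toDual_symm_apply]
      simp [mul_assoc]
    simp_rw [h2, mul_assoc c, integral_const_mul]
    linear_combination c * hzero

/-- A lower bound of a quadratic form on the unit sphere of mean zero functions, in homogeneous
form. -/
theorem neg_mul_integral_sq_le (h : IsNeumannC2 Ω w A) (hΩ : IsOpen Ω)
    (hb : Bornology.IsBounded Ω) {q : EuclideanSpace ℝ (Fin n) → ℝ} {κ : ℝ}
    (hq : ∀ φ G, IsH1With Ω φ G → ∫ x in Ω, φ x = 0 → ∫ x in Ω, φ x ^ 2 = 1 →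
      -κ ≤ ∫ x in Ω, (‖G x‖ ^ 2 - q x * φ x ^ 2)) (h0 : ∫ x in Ω, w x = 0) :
    -κ * ∫ x in Ω, w x ^ 2 ≤ ∫ x in Ω, (‖fderiv ℝ w x‖ ^ 2 - q x * w x ^ 2) := by
  have hy0 : 0 ≤ ∫ x in Ω, w x ^ 2 := integral_nonneg fun x => sq_nonneg _
  -- If `∫ w² = 0`, normalisation is impossible, but then `w = 0` almost everywhere and only the
  -- nonnegative gradient term remains. Otherwise the hypothesis applies to `w / √y`.
  rcases hy0.eq_or_lt with hy | hy
  · have hint : IntegrableOn (fun x => w x ^ 2) Ω := (h.memLp_two hΩ hb).integrable_sq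
    have hae := (integral_eq_zero_iff_of_nonneg (fun x => sq_nonneg (w x)) hint).1 hy.symm
    rw [← hy, mul_zero]
    refine integral_nonneg_of_ae ?_
    filter_upwards [hae] with x hx
    simp only [Pi.zero_apply] at hx ⊢
    rw [hx]
    simp
  · set y := ∫ x in Ω, w x ^ 2 with hydef
    set c := (Real.sqrt y)⁻¹ with hc
    have hc2 : c ^ 2 = y⁻¹ := by rw [hc, inv_pow, Real.sq_sqrt hy.le]
    have h1 := hq _ _ (h.isH1With hΩ hb c) (by rw [integral_const_mul, h0, mul_zero]) (by
      simp_rw [mul_pow]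
      rw [integral_const_mul, ← hydef, hc2, inv_mul_cancel₀ hy.ne'])
    have h2 : ∀ x, ‖c • gradient w x‖ ^ 2 - q x * (c * w x) ^ 2 =
        y⁻¹ * (‖fderiv ℝ w x‖ ^ 2 - q x * w x ^ 2) := fun x => by
      rw [norm_smul, mul_pow, Real.norm_eq_abs, sq_abs, norm_gradient, hc2.symm]
      ring
    simp_rw [h2] at h1
    rw [integral_const_mul, ← div_eq_inv_mul, le_div_iff₀ hy] at h1
    exact h1

end IsNeumannC2

/-! ### Bounded continuous functions and their variance -/

/-- Bounded continuous functions on a set. -/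
structure IsBddContOn (Ω : Set (EuclideanSpace ℝ (Fin n))) (F : EuclideanSpace ℝ (Fin n) → ℝ) :
    Prop where
  continuousOn : ContinuousOn F Ω
  bound : ∃ C, ∀ x ∈ Ω, ‖F x‖ ≤ C

namespace IsBddContOn

variable {Ω : Set (EuclideanSpace ℝ (Fin n))} {F G : EuclideanSpace ℝ (Fin n) → ℝ}

theorem of_closure (hb : Bornology.IsBounded Ω) (h : ContinuousOn F (closure Ω)) :
    IsBddContOn Ω F := by
  obtain ⟨C, hC⟩ := hb.isCompact_closure.exists_bound_of_continuousOn h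
  exact ⟨h.mono subset_closure, C, fun x hx => hC x (subset_closure hx)⟩

theorem add (hF : IsBddContOn Ω F) (hG : IsBddContOn Ω G) : IsBddContOn Ω fun x => F x + G x := by
  obtain ⟨C, hC⟩ := hF.bound
  obtain ⟨D, hD⟩ := hG.bound
  exact ⟨hF.continuousOn.add hG.continuousOn, C + D, fun x hx =>
    (norm_add_le _ _).trans (add_le_add (hC x hx) (hD x hx))⟩

theorem mul (hF : IsBddContOn Ω F) (hG : IsBddContOn Ω G) : IsBddContOn Ω fun x => F x * G x := by
  obtain ⟨C, hC⟩ := hF.bound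
  obtain ⟨D, hD⟩ := hG.bound
  refine ⟨hF.continuousOn.mul hG.continuousOn, C * D, fun x hx => ?_⟩
  rw [norm_mul]
  exact mul_le_mul (hC x hx) (hD x hx) (norm_nonneg _) ((norm_nonneg _).trans (hC x hx))

theorem const (c : ℝ) : IsBddContOn Ω fun _ => c :=
  ⟨continuousOn_const, ‖c‖, fun _ _ => le_rfl⟩

theorem congr (hF : IsBddContOn Ω F) (h : ∀ x ∈ Ω, G x = F x) : IsBddContOn Ω G := by
  obtain ⟨C, hC⟩ := hF.bound
  exact ⟨hF.continuousOn.congr h, C, fun x hx => by rw [h x hx]; exact hC x hx⟩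

theorem sub (hF : IsBddContOn Ω F) (hG : IsBddContOn Ω G) : IsBddContOn Ω fun x => F x - G x :=
  (hF.add ((const (-1)).mul hG)).congr fun x _ => by ring

theorem sq (hF : IsBddContOn Ω F) : IsBddContOn Ω fun x => F x ^ 2 :=
  (hF.mul hF).congr fun _ _ => pow_two _

theorem abs_rpow (hF : IsBddContOn Ω F) {s : ℝ} (hs : 0 ≤ s) :
    IsBddContOn Ω fun x => |F x| ^ s := by
  obtain ⟨C, hC⟩ := hF.bound
  refine ⟨hF.continuousOn.abs.rpow_const fun _ _ => Or.inr hs, C ^ s, fun x hx => ?_⟩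
  rw [Real.norm_of_nonneg (by positivity)]
  exact Real.rpow_le_rpow (abs_nonneg _) (hC x hx) hs

theorem integrableOn (hF : IsBddContOn Ω F) (hΩ : IsOpen Ω) (hb : Bornology.IsBounded Ω) :
    IntegrableOn F Ω := by
  obtain ⟨C, hC⟩ := hF.bound
  exact integrableOn_of_bounded_continuousOn hΩ hb hF.continuousOn hC

theorem memLp_two (hF : IsBddContOn Ω F) (hΩ : IsOpen Ω) (hb : Bornology.IsBounded Ω) :
    MemLp F 2 (volume.restrict Ω) := by
  have hfin : IsFiniteMeasure (volume.restrict Ω) := ⟨by simpa using hb.measure_lt_top⟩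
  obtain ⟨C, hC⟩ := hF.bound
  exact MemLp.of_bound (hF.continuousOn.aestronglyMeasurable hΩ.measurableSet) C
    ((ae_restrict_iff' hΩ.measurableSet).2 (ae_of_all _ hC))

/-- Expansion of the second moment about a constant. -/
theorem integral_add_const_sq (hF : IsBddContOn Ω F) (hΩ : IsOpen Ω)
    (hb : Bornology.IsBounded Ω) (c : ℝ) :
    ∫ x in Ω, (F x + c) ^ 2 =
      (∫ x in Ω, F x ^ 2) + 2 * c * (∫ x in Ω, F x) + c ^ 2 * volume.real Ω := by
  have h1 : ∀ x, (F x + c) ^ 2 = F x ^ 2 + 2 * c * F x + c ^ 2 := fun x => by ring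
  simp_rw [h1]
  rw [integral_add ((hF.sq.add ((const (2 * c)).mul hF)).integrableOn hΩ hb)
    ((const (c ^ 2)).integrableOn hΩ hb),
    integral_add (hF.sq.integrableOn hΩ hb) (((const (2 * c)).mul hF).integrableOn hΩ hb),
    integral_const_mul, setIntegral_const, smul_eq_mul]
  ring

/-- The variance is at most the second moment about any constant. -/
theorem variance_le (hF : IsBddContOn Ω F) (hΩ : IsOpen Ω) (hb : Bornology.IsBounded Ω)
    (hV : 0 < volume.real Ω) (c : ℝ) :
    (∫ x in Ω, F x ^ 2) - (volume.real Ω)⁻¹ * (∫ x in Ω, F x) ^ 2 ≤ ∫ x in Ω, (F x + c) ^ 2 := by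
  rw [hF.integral_add_const_sq hΩ hb]
  set V := volume.real Ω
  set I := ∫ x in Ω, F x
  have h1 : 2 * c * I + c ^ 2 * V + V⁻¹ * I ^ 2 = V⁻¹ * (I + c * V) ^ 2 := by
    field_simp
    ring
  have h2 : 0 ≤ V⁻¹ * (I + c * V) ^ 2 := by positivity
  linarith

/-- The quantity is the second moment of `F` about its own average. -/
theorem variance_nonneg (hF : IsBddContOn Ω F) (hΩ : IsOpen Ω) (hb : Bornology.IsBounded Ω)
    (hV : 0 < volume.real Ω) :
    0 ≤ (∫ x in Ω, F x ^ 2) - (volume.real Ω)⁻¹ * (∫ x in Ω, F x) ^ 2 := by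
  have h1 : 0 ≤ ∫ x in Ω, (F x + -((volume.real Ω)⁻¹ * ∫ x in Ω, F x)) ^ 2 :=
    integral_nonneg fun x => sq_nonneg _
  rw [hF.integral_add_const_sq hΩ hb] at h1
  have h2 : ∀ V I : ℝ, 0 < V → 2 * -(V⁻¹ * I) * I + (-(V⁻¹ * I)) ^ 2 * V = -(V⁻¹ * I ^ 2) :=
    fun V I hV => by field_simp; ring
  have h3 := h2 _ (∫ x in Ω, F x) hV
  linarith

/-- Young's inequality against a mean zero function only sees the variance. -/
theorem neg_two_mul_integral_mul_le (hF : IsBddContOn Ω F) (hG : IsBddContOn Ω G)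
    (hΩ : IsOpen Ω) (hb : Bornology.IsBounded Ω) (hV : 0 < volume.real Ω)
    (h0 : ∫ x in Ω, F x = 0) :
    -(2 * ∫ x in Ω, F x * G x) ≤ (∫ x in Ω, F x ^ 2) +
      ((∫ x in Ω, G x ^ 2) - (volume.real Ω)⁻¹ * (∫ x in Ω, G x) ^ 2) := by
  -- Since `F` has mean zero, `F + G` has the mean of `G`, so expanding the variance of the sum
  -- produces exactly the variance of `G`.
  have h1 := (hF.add hG).variance_nonneg hΩ hb hV
  have h2 : ∫ x in Ω, (F x + G x) ^ 2 =
      (∫ x in Ω, F x ^ 2) + 2 * (∫ x in Ω, F x * G x) + ∫ x in Ω, G x ^ 2 := by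
    have h3 : ∀ x, (F x + G x) ^ 2 = F x ^ 2 + 2 * (F x * G x) + G x ^ 2 := fun x => by ring
    simp_rw [h3]
    rw [integral_add ((hF.sq.add ((const 2).mul (hF.mul hG))).integrableOn hΩ hb)
      (hG.sq.integrableOn hΩ hb), integral_add (hF.sq.integrableOn hΩ hb)
      (((const 2).mul (hF.mul hG)).integrableOn hΩ hb), integral_const_mul]
  rw [h2, integral_add (hF.integrableOn hΩ hb) (hG.integrableOn hΩ hb), h0, zero_add] at h1
  linarith

end IsBddContOn

/-! ### The energy inequality and Gronwall's argument -/

/-- The energy inequality for the difference of a solution and an approximate solution, as long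
as the superquadratic remainder is absorbed. -/
theorem IsNeumannC2.two_mul_integral_mul_le {Ω : Set (EuclideanSpace ℝ (Fin n))}
    (hΩ : IsSmoothBoundedDomain Ω) {w wt q N R : EuclideanSpace ℝ (Fin n) → ℝ}
    {A : EuclideanSpace ℝ (Fin n) → EuclideanSpace ℝ (Fin n) →L[ℝ] ℝ} (hw : IsNeumannC2 Ω w A)
    (hV : 0 < volume.real Ω) (h0 : ∫ x in Ω, w x = 0) (hq : IsBddContOn Ω q)
    (hN : IsBddContOn Ω N) (hR : IsBddContOn Ω R) {ε κ L C s c : ℝ} (hε : 0 < ε) (hε1 : ε ≤ 1)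
    (hκ : 0 ≤ κ) (hs : 0 ≤ s) (hqL : ∀ x ∈ Ω, q x ≤ L)
    (hwt : ∀ x ∈ Ω, wt x = Laplacian.laplacian w x + (ε ^ 2)⁻¹ * N x + c - R x)
    (hspec : -κ * ∫ x in Ω, w x ^ 2 ≤
      ∫ x in Ω, (‖fderiv ℝ w x‖ ^ 2 - (ε ^ 2)⁻¹ * q x * w x ^ 2))
    (hnl : ∀ x ∈ Ω, w x * N x ≤ q x * w x ^ 2 + C * |w x| ^ s)
    (hsmall : C * ∫ x in Ω, |w x| ^ s ≤
      ε ^ 4 * ((∫ x in Ω, w x ^ 2) + ∫ x in Ω, ‖fderiv ℝ w x‖ ^ 2)) :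
    2 * ∫ x in Ω, w x * wt x ≤ (2 * κ + 2 * |L| + 3) * (∫ x in Ω, w x ^ 2) +
      ((∫ x in Ω, R x ^ 2) - (volume.real Ω)⁻¹ * (∫ x in Ω, R x) ^ 2) := by
  have hΩo := hΩ.isOpen
  have hb := hΩ.isBounded
  have hwb : IsBddContOn Ω w := .of_closure hb hw.continuousOn
  have hlap : IsBddContOn Ω (Laplacian.laplacian w) :=
    ⟨hw.continuousOn_laplacian hΩo, hw.exists_bound_laplacian⟩
  have hgr := hw.integrableOn_sq_fderiv hΩo hb
  -- The nonlocal constant `c` disappears because `w` has mean zero.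
  have hexp : ∫ x in Ω, w x * wt x = -(∫ x in Ω, ‖fderiv ℝ w x‖ ^ 2) +
      (ε ^ 2)⁻¹ * (∫ x in Ω, w x * N x) - ∫ x in Ω, w x * R x := by
    have h1 : ∀ x ∈ Ω, w x * wt x = w x * Laplacian.laplacian w x + (ε ^ 2)⁻¹ * (w x * N x) +
        c * w x - w x * R x := fun x hx => by rw [hwt x hx]; ring
    have i1 := hwb.mul hlap
    have i2 := (IsBddContOn.const (Ω := Ω) (ε ^ 2)⁻¹).mul (hwb.mul hN)
    have i3 := (IsBddContOn.const (Ω := Ω) c).mul hwb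
    have i4 := hwb.mul hR
    rw [setIntegral_congr_fun hΩo.measurableSet h1,
      integral_sub (((i1.add i2).add i3).integrableOn hΩo hb) (i4.integrableOn hΩo hb),
      integral_add ((i1.add i2).integrableOn hΩo hb) (i3.integrableOn hΩo hb),
      integral_add (i1.integrableOn hΩo hb) (i2.integrableOn hΩo hb), integral_const_mul,
      integral_const_mul, h0, hw.integral_mul_laplacian hΩ]
    ring
  have hQ : ∫ x in Ω, q x * w x ^ 2 ≤ |L| * ∫ x in Ω, w x ^ 2 := by
    rw [← integral_const_mul]
    refine setIntegral_mono_on ((hq.mul hwb.sq).integrableOn hΩo hb)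
      (((IsBddContOn.const |L|).mul hwb.sq).integrableOn hΩo hb) hΩo.measurableSet fun x hx => ?_
    exact mul_le_mul_of_nonneg_right ((hqL x hx).trans (le_abs_self L)) (sq_nonneg _)
  have hWN : ∫ x in Ω, w x * N x ≤ (∫ x in Ω, q x * w x ^ 2) + C * ∫ x in Ω, |w x| ^ s := by
    rw [← integral_const_mul, ← integral_add ((hq.mul hwb.sq).integrableOn hΩo hb)
      (((IsBddContOn.const C).mul (hwb.abs_rpow hs)).integrableOn hΩo hb)]
    exact setIntegral_mono_on ((hwb.mul hN).integrableOn hΩo hb)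
      (((hq.mul hwb.sq).add ((IsBddContOn.const C).mul (hwb.abs_rpow hs))).integrableOn hΩo hb)
      hΩo.measurableSet hnl
  have hWR := hwb.neg_two_mul_integral_mul_le hR hΩo hb hV h0
  have hspec' : ∫ x in Ω, (‖fderiv ℝ w x‖ ^ 2 - (ε ^ 2)⁻¹ * q x * w x ^ 2) =
      (∫ x in Ω, ‖fderiv ℝ w x‖ ^ 2) - (ε ^ 2)⁻¹ * ∫ x in Ω, q x * w x ^ 2 := by
    simp_rw [mul_assoc]
    rw [integral_sub hgr (((IsBddContOn.const _).mul (hq.mul hwb.sq)).integrableOn hΩo hb),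
      integral_const_mul]
  rw [hspec'] at hspec
  rw [hexp]
  have hy0 : 0 ≤ ∫ x in Ω, w x ^ 2 := integral_nonneg fun x => sq_nonneg _
  have hG0 : 0 ≤ ∫ x in Ω, ‖fderiv ℝ w x‖ ^ 2 := integral_nonneg fun x => sq_nonneg _
  generalize (∫ x in Ω, w x ^ 2) = y at *
  generalize (∫ x in Ω, ‖fderiv ℝ w x‖ ^ 2) = G at *
  generalize (∫ x in Ω, q x * w x ^ 2) = Q at *
  generalize (∫ x in Ω, |w x| ^ s) = X at *
  generalize (∫ x in Ω, w x * N x) = WN at *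
  generalize (∫ x in Ω, w x * R x) = WR at *
  generalize ((∫ x in Ω, R x ^ 2) - (volume.real Ω)⁻¹ * (∫ x in Ω, R x) ^ 2) = D at *
  have he2 : 0 < ε ^ 2 := by positivity
  have he21 : ε ^ 2 ≤ 1 := pow_le_one₀ hε.le hε1
  -- The fourth power of `ε` in `hsmall` leaves `ε²` after the singular factor `ε⁻²`.
  have h1 : (ε ^ 2)⁻¹ * WN ≤ (ε ^ 2)⁻¹ * Q + ε ^ 2 * (y + G) := by
    calc (ε ^ 2)⁻¹ * WN ≤ (ε ^ 2)⁻¹ * (Q + ε ^ 4 * (y + G)) := by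
          gcongr
          exact hWN.trans (by linarith)
      _ = _ := by field_simp
  -- With `ε² G` from `h1` to be absorbed, `-G + ε⁻² Q + ε² G = -(1 - ε²)(G - ε⁻² Q) + Q`. The
  -- spectral bound controls the first term, and `Q ≤ |L| y` the second.
  have h2 : (1 - ε ^ 2) * (-κ * y) ≤ (1 - ε ^ 2) * (G - (ε ^ 2)⁻¹ * Q) :=
    mul_le_mul_of_nonneg_left hspec (by linarith)
  have h3 : ε ^ 2 * ((ε ^ 2)⁻¹ * Q) = Q := by field_simp
  have h4 : 0 ≤ ε ^ 2 * (κ * y) := by positivity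
  have h5 : ε ^ 2 * y ≤ y := mul_le_of_le_one_left hy0 he21
  linarith

/-- A Gronwall estimate whose differential inequality only holds below a threshold. -/
theorem le_of_deriv_le_below_threshold {T K Y η : ℝ} (hT : 0 < T) (hK : 0 ≤ K) {y y' D : ℝ → ℝ}
    (hy : ContinuousOn y (Icc 0 T)) (hD : ContinuousOn D (Icc 0 T))
    (hD0 : ∀ t ∈ Icc 0 T, 0 ≤ D t) (hd : ∀ t ∈ Ioo 0 T, HasDerivAt y (y' t) t)
    (hle : ∀ t ∈ Ioo 0 T, y t ≤ Y → y' t ≤ K * y t + D t)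
    (h0 : y 0 ≤ η) (hDη : ∫ t in (0 : ℝ)..T, D t ≤ η) (hη : 0 ≤ η)
    (hY : Real.exp (K * T) * (2 * η) < Y) :
    ∀ t ∈ Icc 0 T, y t ≤ Real.exp (K * T) * (2 * η) := by
  have hDi : ∀ t ∈ Icc 0 T, IntervalIntegrable D volume 0 t := fun t ht => by
    refine ContinuousOn.intervalIntegrable ?_
    rw [uIcc_of_le ht.1]
    exact hD.mono (Icc_subset_Icc_right ht.2)
  have key : ∀ τ ∈ Icc 0 T, (∀ s ∈ Ioo 0 τ, y s ≤ Y) → y τ ≤ Real.exp (K * T) * (2 * η) := by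
    intro τ hτ hs
    -- Below the threshold `z` is nonincreasing: `exp (-K t) ≤ 1` and `D ≥ 0` let the weight on `D`
    -- be dropped.
    set z := fun t => Real.exp (-(K * t)) * y t - ∫ s in (0 : ℝ)..t, D s with hz
    have hprim : ContinuousOn (fun t => ∫ s in (0 : ℝ)..t, D s) (Icc 0 T) := by
      rw [← uIcc_of_le hT.le] at hD ⊢
      exact intervalIntegral.continuousOn_primitive_interval (hD.integrableOn_compact isCompact_uIcc)
    have hzc : ContinuousOn z (Icc 0 τ) :=
      ((Continuous.continuousOn (by fun_prop)).mul (hy.mono (Icc_subset_Icc_right hτ.2))).sub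
        (hprim.mono (Icc_subset_Icc_right hτ.2))
    have hzd : ∀ t ∈ Ioo 0 τ, HasDerivAt z
        (Real.exp (-(K * t)) * (-K) * y t + Real.exp (-(K * t)) * y' t - D t) t := by
      intro t ht
      have htT : t ∈ Ioo 0 T := ⟨ht.1, ht.2.trans_le hτ.2⟩
      have hnh := Icc_mem_nhds htT.1 htT.2
      have h1 : HasDerivAt (fun t => Real.exp (-(K * t))) (Real.exp (-(K * t)) * (-K)) t := by
        have := (((hasDerivAt_id t).const_mul K).neg).exp
        simpa using this
      have h2 : HasDerivAt (fun t => ∫ s in (0 : ℝ)..t, D s) (D t) t :=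
        intervalIntegral.integral_hasDerivAt_right (hDi t (Ioo_subset_Icc_self htT))
          (hD.stronglyMeasurableAtFilter_nhdsWithin measurableSet_Icc t |>.filter_mono
            (by rw [nhdsWithin_eq_nhds.2 hnh])) (hD.continuousAt hnh)
      exact (h1.mul (hd t htT)).sub h2
    have hanti : AntitoneOn z (Icc 0 τ) := by
      refine antitoneOn_of_deriv_nonpos (convex_Icc 0 τ) hzc (fun t ht => ?_) (fun t ht => ?_)
      · rw [interior_Icc] at ht
        exact (hzd t ht).differentiableAt.differentiableWithinAt
      · rw [interior_Icc] at ht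
        have htT : t ∈ Ioo 0 T := ⟨ht.1, ht.2.trans_le hτ.2⟩
        rw [(hzd t ht).deriv]
        have h1 := hle t htT (hs t ht)
        have h2 : Real.exp (-(K * t)) ≤ 1 := Real.exp_le_one_iff.2 (by
          have := mul_nonneg hK ht.1.le; linarith)
        have h3 : Real.exp (-(K * t)) * y' t ≤ Real.exp (-(K * t)) * (K * y t + D t) := by gcongr
        have h4 : Real.exp (-(K * t)) * D t ≤ D t :=
          mul_le_of_le_one_left (hD0 t (Ioo_subset_Icc_self htT)) h2
        linarith
    have h1 := hanti ⟨le_rfl, hτ.1⟩ ⟨hτ.1, le_rfl⟩ hτ.1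
    simp only [hz, mul_zero, neg_zero, Real.exp_zero, one_mul, intervalIntegral.integral_same,
      sub_zero] at h1
    have h2 : ∫ s in (0 : ℝ)..τ, D s ≤ ∫ s in (0 : ℝ)..T, D s := by
      refine intervalIntegral.integral_mono_interval le_rfl hτ.1 hτ.2 ?_ (hDi T ⟨hT.le, le_rfl⟩)
      exact (ae_restrict_iff' measurableSet_Ioc).2 (ae_of_all _ fun t ht =>
        hD0 t (Ioc_subset_Icc_self ht))
    have h3 : Real.exp (-(K * τ)) * y τ ≤ 2 * η := by linarith
    calc y τ = Real.exp (K * τ) * (Real.exp (-(K * τ)) * y τ) := by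
          rw [← mul_assoc, ← Real.exp_add]; simp
      _ ≤ Real.exp (K * τ) * (2 * η) := by gcongr
      _ ≤ Real.exp (K * T) * (2 * η) := by
          gcongr
          exact hτ.2
  -- At a first time with `Y ≤ y` the estimate `key` still applies, since its hypothesis concerns
  -- earlier times only; it gives a value strictly below `Y`, a contradiction.
  by_cases hex : ∃ t ∈ Icc 0 T, Y ≤ y t
  · exfalso
    have hcl : IsCompact (Icc 0 T ∩ y ⁻¹' Ici Y) := by
      refine isCompact_Icc.of_isClosed_subset ?_ inter_subset_left
      exact hy.preimage_isClosed_of_isClosed isClosed_Icc isClosed_Ici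
    obtain ⟨τ, hτ, hmin⟩ := hcl.exists_isLeast (by obtain ⟨t, ht, h⟩ := hex; exact ⟨t, ht, h⟩)
    have h1 := key τ hτ.1 fun s hs => by
      by_contra hcon
      have := hmin ⟨⟨hs.1.le, hs.2.le.trans hτ.1.2⟩, (not_le.1 hcon).le⟩
      exact absurd hs.2 (not_lt.2 this)
    have h2 : Y ≤ y τ := hτ.2
    linarith
  · push Not at hex
    exact fun t ht => key t ht fun s hs => (hex s ⟨hs.1.le, hs.2.le.trans ht.2⟩).le

/-! ### Convergence of moments in `L²` -/

theorem eLpNorm_two_eq_ofReal_sqrt {α : Type*} [MeasurableSpace α] {μ : Measure α} {F : α → ℝ}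
    (hF : MemLp F 2 μ) : eLpNorm F 2 μ = ENNReal.ofReal (Real.sqrt (∫ x, F x ^ 2 ∂μ)) := by
  rw [hF.eLpNorm_eq_integral_rpow_norm two_ne_zero ENNReal.ofNat_ne_top]
  simp [Real.sqrt_eq_rpow]

/-- Convergence in `L²` of a finite measure implies convergence of the integrals and of the second
moments. -/
theorem tendsto_integral_and_sq_of_eLpNorm_two {α ι : Type*} [MeasurableSpace α] {μ : Measure α}
    [IsFiniteMeasure μ] {l : Filter ι} {w : ι → α → ℝ} {F : α → ℝ} (hF : MemLp F 2 μ)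
    (hw : ∀ᶠ i in l, MemLp (w i) 2 μ)
    (h : Tendsto (fun i => eLpNorm (fun x => w i x - F x) 2 μ) l (𝓝 0)) :
    Tendsto (fun i => ∫ x, w i x ∂μ) l (𝓝 (∫ x, F x ∂μ)) ∧
      Tendsto (fun i => ∫ x, w i x ^ 2 ∂μ) l (𝓝 (∫ x, F x ^ 2 ∂μ)) := by
  constructor
  · refine tendsto_integral_of_L1' F hF.aestronglyMeasurable
      (hw.mono fun i hi => hi.integrable one_le_two) ?_
    have h1 : Tendsto (fun i => eLpNorm (fun x => w i x - F x) 2 μ *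
        μ univ ^ (1 / (1 : ℝ≥0∞).toReal - 1 / (2 : ℝ≥0∞).toReal)) l (𝓝 0) := by
      have := ENNReal.Tendsto.mul_const h (b := μ univ ^ (1 / (1 : ℝ≥0∞).toReal -
        1 / (2 : ℝ≥0∞).toReal)) (Or.inr (ENNReal.rpow_ne_top_of_nonneg (by norm_num)
          (measure_ne_top μ _)))
      rwa [zero_mul] at this
    refine tendsto_of_tendsto_of_tendsto_of_le_of_le' tendsto_const_nhds h1
      (Eventually.of_forall fun _ => zero_le) ?_
    filter_upwards [hw] with i hi
    exact eLpNorm_le_eLpNorm_mul_rpow_measure_univ one_le_two (hi.sub hF).aestronglyMeasurable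
  · have h1 : Tendsto (fun i => (eLpNorm (w i) 2 μ).toReal) l (𝓝 (eLpNorm F 2 μ).toReal) := by
      rw [tendsto_iff_dist_tendsto_zero]
      have h2 : Tendsto (fun i => (eLpNorm (fun x => w i x - F x) 2 μ).toReal) l (𝓝 0) := by
        simpa [Function.comp_def] using (ENNReal.tendsto_toReal ENNReal.zero_ne_top).comp h
      refine squeeze_zero' (Eventually.of_forall fun _ => dist_nonneg) ?_ h2
      filter_upwards [hw] with i hi
      have hd := hi.sub hF
      have t1 : eLpNorm (w i) 2 μ ≤ eLpNorm (w i - F) 2 μ + eLpNorm F 2 μ := by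
        simpa using eLpNorm_add_le hd.aestronglyMeasurable hF.aestronglyMeasurable one_le_two
      have t2 : eLpNorm F 2 μ ≤ eLpNorm (w i) 2 μ + eLpNorm (w i - F) 2 μ := by
        have := eLpNorm_sub_le hi.aestronglyMeasurable hd.aestronglyMeasurable
          (p := 2) one_le_two
        simpa using this
      have t1' := ENNReal.toReal_mono (ENNReal.add_ne_top.2 ⟨hd.eLpNorm_ne_top,
        hF.eLpNorm_ne_top⟩) t1
      have t2' := ENNReal.toReal_mono (ENNReal.add_ne_top.2 ⟨hi.eLpNorm_ne_top,
        hd.eLpNorm_ne_top⟩) t2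
      rw [ENNReal.toReal_add hd.eLpNorm_ne_top hF.eLpNorm_ne_top] at t1'
      rw [ENNReal.toReal_add hi.eLpNorm_ne_top hd.eLpNorm_ne_top] at t2'
      have e1 : (fun x => w i x - F x) = w i - F := rfl
      rw [Real.dist_eq, abs_le, e1]
      constructor <;> linarith
    have hsq : ∀ {G : α → ℝ}, MemLp G 2 μ → (eLpNorm G 2 μ).toReal ^ 2 = ∫ x, G x ^ 2 ∂μ :=
      fun hG => by
        rw [eLpNorm_two_eq_ofReal_sqrt hG, ENNReal.toReal_ofReal (Real.sqrt_nonneg _),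
          Real.sq_sqrt (integral_nonneg fun _ => sq_nonneg _)]
    rw [← hsq hF]
    exact (h1.pow 2).congr' (hw.mono fun i hi => hsq hi)

/-! ### Regularity of the solutions and the residual -/

variable {Ω : Set (EuclideanSpace ℝ (Fin n))}

theorem IsSmoothBoundedDomain.volume_real_pos (hΩ : IsSmoothBoundedDomain Ω) :
    0 < volume.real Ω :=
  ENNReal.toReal_pos (hΩ.isOpen.measure_pos volume hΩ.isConnected.nonempty).ne'
    hΩ.isBounded.measure_lt_top.ne

namespace IsC21

variable {I : Set ℝ} {u : ℝ → EuclideanSpace ℝ (Fin n) → ℝ}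

theorem hasDerivAt (hu : IsC21 Ω I u) {t : ℝ} (ht : I ∈ 𝓝 t) {x : EuclideanSpace ℝ (Fin n)}
    (hx : x ∈ closure Ω) :
    HasDerivAt (fun s => u s x) (derivWithin (fun s => u s x) I t) t :=
  ((hu.differentiableOn_time x hx) t (mem_of_mem_nhds ht)).hasDerivWithinAt.hasDerivAt ht

theorem isBddContOn_comp (hu : IsC21 Ω I u) (hb : Bornology.IsBounded Ω) {g : ℝ → ℝ}
    (hg : Continuous g) {t : ℝ} (ht : t ∈ I) : IsBddContOn Ω fun x => g (u t x) :=
  .of_closure hb (hg.comp_continuousOn (hu.contDiffOn_space t ht).continuousOn)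

theorem continuousOn_sum_deriv₂ (hu : IsC21 Ω I u) :
    ContinuousOn (fun p : ℝ × EuclideanSpace ℝ (Fin n) => ∑ i,
      fderivWithin ℝ (fderivWithin ℝ (u p.1) (closure Ω)) (closure Ω) p.2
        (EuclideanSpace.single i 1) (EuclideanSpace.single i 1)) (I ×ˢ closure Ω) :=
  continuousOn_finsetSum _ fun _ _ =>
    (ContinuousOn.clm_apply (F := EuclideanSpace ℝ (Fin n) →L[ℝ] ℝ)
      hu.continuousOn_space_deriv₂ continuousOn_const).clm_apply continuousOn_const

theorem sum_deriv₂_eq (hΩ : IsOpen Ω) (w : EuclideanSpace ℝ (Fin n) → ℝ)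
    {x : EuclideanSpace ℝ (Fin n)} (hx : x ∈ Ω) :
    ∑ i, fderivWithin ℝ (fderivWithin ℝ w (closure Ω)) (closure Ω) x
      (EuclideanSpace.single i 1) (EuclideanSpace.single i 1) = Laplacian.laplacian w x := by
  rw [laplacian_eq_codiv, codiv, fderivWithin_fderivWithin_closure_eq hΩ hx]

end IsC21

namespace IsApproxSolution

variable {f : ℝ → ℝ} {ε T : ℝ} {k : ℕ} {v : ℝ → EuclideanSpace ℝ (Fin n) → ℝ} {lam : ℝ → ℝ}

/-- The essential bound becomes pointwise by continuity on the open cylinder. It is phrased as `max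
|v| 2 = 2` because what propagates from almost everywhere to everywhere is an equality of continuous
functions. -/
theorem abs_le_two (hv : IsApproxSolution Ω f ε T k v lam) (hΩ : IsOpen Ω) {t : ℝ}
    (ht : t ∈ Ioo 0 T) {x : EuclideanSpace ℝ (Fin n)} (hx : x ∈ Ω) : |v t x| ≤ 2 := by
  have hc : ContinuousOn (fun p : ℝ × EuclideanSpace ℝ (Fin n) => |v p.1 p.2|) (Ioo 0 T ×ˢ Ω) :=
    (hv.regular.continuousOn.mono (prod_mono Ioo_subset_Icc_self subset_closure)).abs
  have hae : ∀ᵐ p ∂(volume.restrict (Icc 0 T ×ˢ Ω)), |v p.1 p.2| ≤ 2 := by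
    have h1 := ae_le_eLpNormEssSup (f := fun p : ℝ × EuclideanSpace ℝ (Fin n) => v p.1 p.2)
      (μ := volume.restrict (Icc 0 T ×ˢ Ω))
    have h2 := hv.sup_le
    rw [eLpNorm_exponent_top] at h2
    filter_upwards [h1] with p hp
    have h3 := hp.trans h2
    rw [← ofReal_norm, Real.norm_eq_abs] at h3
    simpa using (ENNReal.ofReal_le_ofReal_iff (q := 2) (by norm_num)).1 (by simpa using h3)
  have hae' : (fun p : ℝ × EuclideanSpace ℝ (Fin n) => max |v p.1 p.2| 2)
      =ᵐ[volume.restrict (Ioo 0 T ×ˢ Ω)] fun _ => 2 := by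
    filter_upwards [ae_restrict_of_ae_restrict_of_subset
      (prod_mono Ioo_subset_Icc_self (subset_refl Ω)) hae] with p hp using max_eq_right hp
  have := Measure.eqOn_open_of_ae_eq hae' (isOpen_Ioo.prod hΩ) (hc.sup continuousOn_const)
    continuousOn_const (show (t, x) ∈ Ioo 0 T ×ˢ Ω from ⟨ht, hx⟩)
  exact max_eq_right_iff.1 this

/-- The residual up to functions of time extends continuously to the closure, and its variance is
integrable in time. -/
theorem exists_residual (hv : IsApproxSolution Ω f ε T k v lam) (hΩ : IsSmoothBoundedDomain Ω)
    (hf : Continuous f) (hT : 0 < T) (hε : 0 ≤ ε) :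
    ∃ R : ℝ → EuclideanSpace ℝ (Fin n) → ℝ,
      ContinuousOn (fun p : ℝ × EuclideanSpace ℝ (Fin n) => R p.1 p.2) (Icc 0 T ×ˢ closure Ω) ∧
      (∀ t ∈ Icc 0 T, ∀ x ∈ Ω, R t x = derivWithin (fun s => v s x) (Icc 0 T) t -
        Laplacian.laplacian (v t) x - (ε ^ 2)⁻¹ * f (v t x)) ∧
      ContinuousOn (fun t => (∫ x in Ω, R t x ^ 2) -
        (volume.real Ω)⁻¹ * (∫ x in Ω, R t x) ^ 2) (Icc 0 T) ∧
      (∀ t ∈ Icc 0 T, IsBddContOn Ω (R t)) ∧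
      ∫ t in (0 : ℝ)..T, ((∫ x in Ω, R t x ^ 2) -
        (volume.real Ω)⁻¹ * (∫ x in Ω, R t x) ^ 2) ≤ (ε ^ k) ^ 2 := by
  have hΩo := hΩ.isOpen
  have hb := hΩ.isBounded
  have hV := hΩ.volume_real_pos
  -- The term in `lam` is left out, since `lam` is an arbitrary function of time. The Laplacian is
  -- written with derivatives within the closure, so that `R` is continuous on the closed cylinder.
  set R : ℝ → EuclideanSpace ℝ (Fin n) → ℝ := fun t x =>
    derivWithin (fun s => v s x) (Icc 0 T) t -
      (∑ i, fderivWithin ℝ (fderivWithin ℝ (v t) (closure Ω)) (closure Ω) x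
        (EuclideanSpace.single i 1) (EuclideanSpace.single i 1)) - (ε ^ 2)⁻¹ * f (v t x) with hR
  have hRc : ContinuousOn (fun p : ℝ × EuclideanSpace ℝ (Fin n) => R p.1 p.2)
      (Icc 0 T ×ˢ closure Ω) :=
    (hv.regular.continuousOn_time_deriv.sub hv.regular.continuousOn_sum_deriv₂).sub
      (continuousOn_const.mul (hf.comp_continuousOn hv.regular.continuousOn))
  have hReq : ∀ t ∈ Icc 0 T, ∀ x ∈ Ω, R t x = derivWithin (fun s => v s x) (Icc 0 T) t -
      Laplacian.laplacian (v t) x - (ε ^ 2)⁻¹ * f (v t x) := fun t _ x hx => by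
    simp only [hR]
    rw [IsC21.sum_deriv₂_eq hΩo (v t) hx]
  have hRb : ∀ t ∈ Icc 0 T, IsBddContOn Ω (R t) := fun t ht =>
    .of_closure hb (hRc.comp (f := fun x => (t, x)) (by fun_prop) fun _ hx => ⟨ht, hx⟩)
  set D := fun t => (∫ x in Ω, R t x ^ 2) - (volume.real Ω)⁻¹ * (∫ x in Ω, R t x) ^ 2 with hD
  have hDc : ContinuousOn D (Icc 0 T) :=
    (continuousOn_setIntegral hΩo hb (F := fun t x => R t x ^ 2) (hRc.pow 2)).sub
      (continuousOn_const.mul ((continuousOn_setIntegral hΩo hb hRc).pow 2))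
  refine ⟨R, hRc, hReq, hDc, hRb, ?_⟩
  have hD0 : ∀ t ∈ Icc 0 T, 0 ≤ D t := fun t ht => (hRb t ht).variance_nonneg hΩo hb hV
  have hres : ∫⁻ p in Icc 0 T ×ˢ Ω, ‖acResidual f ε T v lam p‖ₑ ^ (2 : ℝ) ≤
      ENNReal.ofReal ((ε ^ k) ^ 2) := by
    have h1 := hv.residual_le
    rw [eLpNorm_eq_lintegral_rpow_enorm_toReal two_ne_zero ENNReal.ofNat_ne_top] at h1
    have h2 := ENNReal.rpow_le_rpow h1 (show (0 : ℝ) ≤ 2 by norm_num)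
    rw [← ENNReal.rpow_mul, ENNReal.toReal_ofNat] at h2
    norm_num only [ENNReal.rpow_one] at h2
    refine h2.trans_eq ?_
    rw [ENNReal.ofReal_rpow_of_nonneg (by positivity) (by norm_num), Real.rpow_two]
  rw [Measure.volume_eq_prod, ← Measure.prod_restrict, lintegral_prod _ (by
    have := hv.residual_memLp.aestronglyMeasurable
    rw [Measure.volume_eq_prod, ← Measure.prod_restrict] at this
    exact this.enorm.pow_const _)] at hres
  have hslice : ∀ t ∈ Icc 0 T, ENNReal.ofReal (D t) ≤
      ∫⁻ x in Ω, ‖acResidual f ε T v lam (t, x)‖ₑ ^ (2 : ℝ) := fun t ht => by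
    -- At time `t` the true residual is `R + c`, and its second moment dominates the variance of
    -- `R`.
    set c := (ε ^ 2)⁻¹ * (ε * lam t) with hc
    calc ENNReal.ofReal (D t) ≤ ENNReal.ofReal (∫ x in Ω, (R t x + c) ^ 2) :=
          ENNReal.ofReal_le_ofReal ((hRb t ht).variance_le hΩo hb hV c)
      _ = ∫⁻ x in Ω, ENNReal.ofReal ((R t x + c) ^ 2) :=
          ofReal_integral_eq_lintegral_ofReal
            (((hRb t ht).add (IsBddContOn.const c)).sq.integrableOn hΩo hb)
            (ae_of_all _ fun _ => sq_nonneg _)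
      _ = _ := by
          refine setLIntegral_congr_fun hΩo.measurableSet fun x hx => ?_
          have h1 : acResidual f ε T v lam (t, x) = R t x + c := by
            rw [hReq t ht x hx, acResidual, hc]
            ring
          rw [h1, ← ofReal_norm, ENNReal.ofReal_rpow_of_nonneg (norm_nonneg _) (by norm_num),
            Real.rpow_two, Real.norm_eq_abs, sq_abs]
  have hDi : IntegrableOn D (Icc 0 T) := hDc.integrableOn_compact isCompact_Icc
  rw [intervalIntegral.integral_of_le hT.le, ← integral_Icc_eq_integral_Ioc,
    ← ENNReal.ofReal_le_ofReal_iff (by positivity), ofReal_integral_eq_lintegral_ofReal hDi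
      ((ae_restrict_iff' measurableSet_Icc).2 (ae_of_all _ hD0))]
  exact (setLIntegral_mono' measurableSet_Icc hslice).trans hres

end IsApproxSolution

/-- The solution is regular only for positive times; at time zero continuity of its moments comes
from the `L²` limit. -/
theorem continuousOn_Icc_of_Ioc {T : ℝ} {g : ℝ → ℝ} (h : ∀ a, 0 < a → ContinuousOn g (Icc a T))
    (h0 : Tendsto g (𝓝[>] 0) (𝓝 (g 0))) : ContinuousOn g (Icc 0 T) := by
  intro t ht
  rcases ht.1.eq_or_lt with rfl | ht0
  · have : ContinuousWithinAt g (Ici 0) 0 := continuousWithinAt_Ioi_iff_Ici.1 h0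
    exact this.mono Icc_subset_Ici_self
  · have h1 := h (t / 2) (by positivity) t ⟨by linarith, ht.2⟩
    refine h1.mono_of_mem_nhdsWithin ?_
    have h2 : Ioi (t / 2) ∈ 𝓝[Icc 0 T] t := mem_nhdsWithin_of_mem_nhds (Ioi_mem_nhds (by linarith))
    filter_upwards [h2, self_mem_nhdsWithin] with s hs hs' using ⟨le_of_lt hs, hs'.2⟩

/-! ### The difference of the two solutions -/

section Difference

variable {f : ℝ → ℝ} {ε T : ℝ} {k : ℕ} {u v : ℝ → EuclideanSpace ℝ (Fin n) → ℝ} {lam : ℝ → ℝ}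
  {φ : EuclideanSpace ℝ (Fin n) → ℝ}

/-- The difference of the solutions tends to the difference of the initial values, in `L²`. -/
theorem tendsto_eLpNorm_sub (hΩ : IsSmoothBoundedDomain Ω) (hT : 0 < T)
    (hv : IsC21 Ω (Icc 0 T) v) (hu : IsSolution Ω f ε T (fun x => v 0 x + φ x) u)
    (hφ : MemLp φ 2 (volume.restrict Ω)) :
    Tendsto (fun t => eLpNorm (fun x => (u t x - v t x) - φ x) 2 (volume.restrict Ω))
      (𝓝[>] 0) (𝓝 0) := by
  have hΩo := hΩ.isOpen
  have hb := hΩ.isBounded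
  have hb0 : ∀ t ∈ Icc 0 T, IsBddContOn Ω (v t) := fun t ht =>
    hv.isBddContOn_comp hb (g := fun s => s) continuous_id ht
  have hbu : ∀ t ∈ Ioc 0 T, IsBddContOn Ω (u t) := fun t ht =>
    hu.regular.isBddContOn_comp hb (g := fun s => s) continuous_id ht
  have h00 : (0 : ℝ) ∈ Icc 0 T := ⟨le_rfl, hT.le⟩
  have hIoc : Ioc 0 T ∈ 𝓝[>] (0 : ℝ) := Ioc_mem_nhdsGT hT
  have hcont : ContinuousOn (fun t => ∫ x in Ω, (v t x - v 0 x) ^ 2) (Icc 0 T) := by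
    refine continuousOn_setIntegral hΩo hb (F := fun t x => (v t x - v 0 x) ^ 2) ?_
    refine (hv.continuousOn.sub ?_).pow 2
    exact (hv.contDiffOn_space 0 h00).continuousOn.comp (f := Prod.snd) (by fun_prop)
      fun p hp => hp.2
  have hv0 : Tendsto (fun t => eLpNorm (fun x => v t x - v 0 x) 2 (volume.restrict Ω))
      (𝓝[>] 0) (𝓝 0) := by
    have h1 : Tendsto (fun t => ∫ x in Ω, (v t x - v 0 x) ^ 2) (𝓝[>] 0) (𝓝 0) := by
      have h2 := hcont 0 h00
      have h3 : Tendsto (fun t => ∫ x in Ω, (v t x - v 0 x) ^ 2) (𝓝[Icc 0 T] 0) (𝓝 0) := by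
        simpa [ContinuousWithinAt] using h2
      exact h3.mono_left (nhdsWithin_le_of_mem (mem_of_superset hIoc Ioc_subset_Icc_self))
    have h2 : Tendsto (fun t => ENNReal.ofReal (Real.sqrt (∫ x in Ω, (v t x - v 0 x) ^ 2)))
        (𝓝[>] 0) (𝓝 0) := by
      have := ENNReal.tendsto_ofReal (h1.sqrt)
      simpa using this
    refine h2.congr' ?_
    filter_upwards [hIoc] with t ht
    exact (eLpNorm_two_eq_ofReal_sqrt
      (((hb0 t (Ioc_subset_Icc_self ht)).sub (hb0 0 h00)).memLp_two hΩo hb)).symm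
  have hsum := hu.initial_limit.add hv0
  rw [add_zero] at hsum
  refine tendsto_of_tendsto_of_tendsto_of_le_of_le' tendsto_const_nhds hsum
    (Eventually.of_forall fun _ => zero_le) ?_
  filter_upwards [hIoc] with t ht
  -- The difference splits into the distance of `u` from its datum and the increment of `v`, both
  -- tending to zero in `L²`.
  have e1 : (fun x => (u t x - v t x) - φ x) =
      (fun x => u t x - (v 0 x + φ x)) - fun x => v t x - v 0 x := by
    ext x
    simp only [Pi.sub_apply]
    ring
  rw [e1]
  refine eLpNorm_sub_le ?_ ?_ one_le_two
  · exact (((hbu t ht).memLp_two hΩo hb).sub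
      (((hb0 0 h00).memLp_two hΩo hb).add hφ)).aestronglyMeasurable
  · exact (((hb0 t (Ioc_subset_Icc_self ht)).sub (hb0 0 h00)).memLp_two hΩo hb).aestronglyMeasurable

theorem ae_sub_eq_initial (hu : IsSolution Ω f ε T (fun x => v 0 x + φ x) u) :
    (fun x => u 0 x - v 0 x) =ᵐ[volume.restrict Ω] φ := by
  filter_upwards [hu.initial] with x hx
  rw [hx]
  ring

/-- Away from zero this is continuity on compact cylinders; at zero it is `L²` convergence to `φ`.
The value of `u` at time zero matters only almost everywhere. -/
theorem continuousOn_integral_sub (hΩ : IsSmoothBoundedDomain Ω) (hT : 0 < T)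
    (hv : IsC21 Ω (Icc 0 T) v) (hu : IsSolution Ω f ε T (fun x => v 0 x + φ x) u)
    (hφ : MemLp φ 2 (volume.restrict Ω)) :
    ContinuousOn (fun t => ∫ x in Ω, (u t x - v t x)) (Icc 0 T) ∧
      ContinuousOn (fun t => ∫ x in Ω, (u t x - v t x) ^ 2) (Icc 0 T) := by
  have hΩo := hΩ.isOpen
  have hb := hΩ.isBounded
  have hfin : IsFiniteMeasure (volume.restrict Ω) := ⟨by simpa using hb.measure_lt_top⟩
  have hc : ∀ a, 0 < a → ContinuousOn (fun p : ℝ × EuclideanSpace ℝ (Fin n) =>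
      u p.1 p.2 - v p.1 p.2) (Icc a T ×ˢ closure Ω) := fun a ha =>
    (hu.regular.continuousOn.mono (prod_mono (fun t ht => ⟨ha.trans_le ht.1, ht.2⟩)
      (subset_refl _))).sub (hv.continuousOn.mono
        (prod_mono (Icc_subset_Icc_left ha.le) (subset_refl _)))
  have hlim := tendsto_integral_and_sq_of_eLpNorm_two hφ (l := 𝓝[>] (0 : ℝ))
    (w := fun t x => u t x - v t x) (by
      filter_upwards [Ioc_mem_nhdsGT hT] with t ht
      exact ((hu.regular.isBddContOn_comp hb (g := fun s => s) continuous_id ht).sub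
        (hv.isBddContOn_comp hb (g := fun s => s) continuous_id
          (Ioc_subset_Icc_self ht))).memLp_two hΩo hb) (tendsto_eLpNorm_sub hΩ hT hv hu hφ)
  have hae := ae_sub_eq_initial hu
  refine ⟨continuousOn_Icc_of_Ioc (fun a ha => continuousOn_setIntegral hΩo hb
    (F := fun t x => u t x - v t x) (hc a ha)) ?_,
    continuousOn_Icc_of_Ioc (fun a ha => continuousOn_setIntegral hΩo hb
    (F := fun t x => (u t x - v t x) ^ 2) ((hc a ha).pow 2)) ?_⟩
  · rw [integral_congr_ae hae]
    exact hlim.1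
  · have : ∫ x in Ω, (u 0 x - v 0 x) ^ 2 = ∫ x in Ω, φ x ^ 2 :=
      integral_congr_ae (hae.mono fun _ hx => congrArg (· ^ 2) hx)
    rw [this]
    exact hlim.2

/-- Differentiation of the moments of the difference. -/
theorem hasDerivAt_integral_sub (hΩ : IsSmoothBoundedDomain Ω)
    (hv : IsC21 Ω (Icc 0 T) v) (hu : IsC21 Ω (Ioc 0 T) u) {t : ℝ} (ht : t ∈ Ioo 0 T) :
    HasDerivAt (fun t => ∫ x in Ω, (u t x - v t x))
      (∫ x in Ω, (derivWithin (fun s => u s x) (Ioc 0 T) t -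
        derivWithin (fun s => v s x) (Icc 0 T) t)) t ∧
    HasDerivAt (fun t => ∫ x in Ω, (u t x - v t x) ^ 2)
      (2 * ∫ x in Ω, (u t x - v t x) * (derivWithin (fun s => u s x) (Ioc 0 T) t -
        derivWithin (fun s => v s x) (Icc 0 T) t)) t := by
  have hΩo := hΩ.isOpen
  have hb := hΩ.isBounded
  -- Starting the window at `t / 2` avoids time zero, where `u` need not be regular.
  have hsub1 : Icc (t / 2) T ×ˢ closure Ω ⊆ Ioc 0 T ×ˢ closure Ω :=
    prod_mono (fun s hs => ⟨by linarith [ht.1, hs.1], hs.2⟩) (subset_refl _)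
  have hsub2 : Icc (t / 2) T ×ˢ closure Ω ⊆ Icc 0 T ×ˢ closure Ω :=
    prod_mono (Icc_subset_Icc_left (by linarith [ht.1])) (subset_refl _)
  have hc := (hu.continuousOn.mono hsub1).sub (hv.continuousOn.mono hsub2)
  have hc' := (hu.continuousOn_time_deriv.mono hsub1).sub (hv.continuousOn_time_deriv.mono hsub2)
  have hd : ∀ s ∈ Ioo (t / 2) T, ∀ x ∈ Ω, HasDerivAt (fun s => u s x - v s x)
      (derivWithin (fun s => u s x) (Ioc 0 T) s - derivWithin (fun s => v s x) (Icc 0 T) s) s :=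
    fun s hs x hx => by
      have hs0 : 0 < s := by linarith [ht.1, hs.1]
      exact (hu.hasDerivAt (Ioc_mem_nhds hs0 hs.2) (subset_closure hx)).sub
        (hv.hasDerivAt (Icc_mem_nhds hs0 hs.2) (subset_closure hx))
  have htm : t ∈ Ioo (t / 2) T := ⟨by linarith [ht.1], ht.2⟩
  refine ⟨hasDerivAt_setIntegral hΩo hb (F := fun t x => u t x - v t x)
    (F' := fun t x => derivWithin (fun s => u s x) (Ioc 0 T) t -
        derivWithin (fun s => v s x) (Icc 0 T) t) hc hc' hd htm, ?_⟩
  have h2 := hasDerivAt_setIntegral hΩo hb (F := fun t x => (u t x - v t x) ^ 2)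
    (F' := fun t x => 2 * ((u t x - v t x) * (derivWithin (fun s => u s x) (Ioc 0 T) t -
        derivWithin (fun s => v s x) (Icc 0 T) t))) (hc.pow 2)
    (continuousOn_const.mul (hc.mul hc')) (fun s hs x hx => by
      have := (hd s hs x hx).fun_pow 2
      refine this.congr_deriv ?_
      push_cast
      ring) htm
  rwa [integral_const_mul] at h2

/-- The difference of the solutions has zero mean. -/
theorem integral_sub_eq_zero (hΩ : IsSmoothBoundedDomain Ω) (hT : 0 < T) (hf : Continuous f)
    (hv : IsApproxSolution Ω f ε T k v lam)
    (hu : IsSolution Ω f ε T (fun x => v 0 x + φ x) u)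
    (hφ : MemLp φ 2 (volume.restrict Ω)) (hφ0 : ∫ x in Ω, φ x = 0) :
    ∀ t ∈ Icc 0 T, ∫ x in Ω, (u t x - v t x) = 0 := by
  have hΩo := hΩ.isOpen
  have hb := hΩ.isBounded
  have hcont := (continuousOn_integral_sub hΩ hT hv.regular hu hφ).1
  have hder : ∀ t ∈ Ioo 0 T, HasDerivAt (fun t => ∫ x in Ω, (u t x - v t x)) 0 t := by
    intro t ht
    have htu : t ∈ Ioc 0 T := Ioo_subset_Ioc_self ht
    have htv : t ∈ Icc 0 T := Ioo_subset_Icc_self ht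
    have h1 := (hasDerivAt_integral_sub hΩ hv.regular hu.regular ht).1
    have hbu : IsBddContOn Ω fun x => derivWithin (fun s => u s x) (Ioc 0 T) t :=
      .of_closure hb (hu.regular.continuousOn_time_deriv.comp (f := fun x => (t, x))
        (by fun_prop) fun _ hx => ⟨htu, hx⟩)
    have hbv : IsBddContOn Ω fun x => derivWithin (fun s => v s x) (Icc 0 T) t :=
      .of_closure hb (hv.regular.continuousOn_time_deriv.comp (f := fun x => (t, x))
        (by fun_prop) fun _ hx => ⟨htv, hx⟩)
    have hN := hu.regular.isNeumannC2 hΩo hb hu.noFlux htu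
    have hlap : IsBddContOn Ω (Laplacian.laplacian (u t)) :=
      ⟨hN.continuousOn_laplacian hΩo, hN.exists_bound_laplacian⟩
    have hfu : IsBddContOn Ω fun x => f (u t x) := hu.regular.isBddContOn_comp hb hf htu
    have hV := hΩ.volume_real_pos
    -- The mass of `v` is constant by hypothesis. For `u`, the Laplacian integrates to zero by the
    -- no flux condition, and the reaction term by subtraction of its average.
    rw [integral_sub (hbu.integrableOn hΩo hb) (hbv.integrableOn hΩo hb), hv.mass t htv,
      setIntegral_congr_fun hΩo.measurableSet (hu.equation t htu),
      integral_add (hlap.integrableOn hΩo hb)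
        (((IsBddContOn.const _).mul (hfu.sub (IsBddContOn.const _))).integrableOn hΩo hb),
      hN.integral_laplacian hΩ, integral_const_mul, integral_sub (hfu.integrableOn hΩo hb)
        ((IsBddContOn.const _).integrableOn hΩo hb), setIntegral_const, setAverage_eq,
      smul_eq_mul, smul_eq_mul, mul_inv_cancel_left₀ hV.ne'] at h1
    simpa using h1
  have hdiff : DifferentiableOn ℝ (fun t => ∫ x in Ω, (u t x - v t x)) (interior (Icc 0 T)) := by
    rw [interior_Icc]
    exact fun t ht => (hder t ht).differentiableAt.differentiableWithinAt
  have hmono := monotoneOn_of_deriv_nonneg (convex_Icc 0 T) hcont hdiff (fun t ht => by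
    rw [interior_Icc] at ht
    rw [(hder t ht).deriv])
  have hanti := antitoneOn_of_deriv_nonpos (convex_Icc 0 T) hcont hdiff (fun t ht => by
    rw [interior_Icc] at ht
    rw [(hder t ht).deriv])
  have h0 : ∫ x in Ω, (u 0 x - v 0 x) = 0 := by
    rw [integral_congr_ae (ae_sub_eq_initial hu), hφ0]
  intro t ht
  have h00 : (0 : ℝ) ∈ Icc 0 T := ⟨le_rfl, hT.le⟩
  have h1 := hmono h00 ht ht.1
  have h2 := hanti h00 ht ht.1
  simp only [h0] at h1 h2
  exact le_antisymm h2 h1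

/-- The error estimate at a fixed value of the parameter, under a smallness condition on the size
of the data. -/
theorem eLpNorm_sub_le_of_small (hΩ : IsSmoothBoundedDomain Ω) (hT : 0 < T)
    (hf : ContDiff ℝ 1 f) (hv : IsApproxSolution Ω f ε T k v lam)
    (hu : IsSolution Ω f ε T (fun x => v 0 x + φ x) u)
    (hφ : MemLp φ 2 (volume.restrict Ω)) (hφ0 : ∫ x in Ω, φ x = 0)
    (hφk : eLpNorm φ 2 (volume.restrict Ω) ≤ ENNReal.ofReal (ε ^ k))
    {κ L C₁ C₂ s r : ℝ} (hε : 0 < ε) (hε1 : ε ≤ 1) (hκ : 0 ≤ κ) (hs : 0 ≤ s) (hr : 0 ≤ r)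
    (hC₁ : 0 ≤ C₁) (hC₂ : 0 ≤ C₂)
    (hspec : ∀ t ∈ Ioc 0 T, ∀ φ G, IsH1With Ω φ G → ∫ x in Ω, φ x = 0 → ∫ x in Ω, φ x ^ 2 = 1 →
      -κ ≤ ∫ x in Ω, (‖G x‖ ^ 2 - (ε ^ 2)⁻¹ * deriv f (v t x) * φ x ^ 2))
    (hL : ∀ a, |a| ≤ 2 → deriv f a ≤ L)
    (hnl : ∀ a b : ℝ, |a| ≤ 2 → b * (f (a + b) - f a) ≤ deriv f a * b ^ 2 + C₁ * |b| ^ s)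
    (hGN : ∀ w A, IsNeumannC2 Ω w A → ∫ x in Ω, |w x| ^ s ≤ C₂ * (∫ x in Ω, w x ^ 2) ^ r *
      ((∫ x in Ω, w x ^ 2) + ∫ x in Ω, ‖fderiv ℝ w x‖ ^ 2))
    (hsmall : C₁ * (C₂ * (Real.exp ((2 * κ + 2 * |L| + 3) * T) * (4 * (ε ^ k) ^ 2)) ^ r) ≤ ε ^ 4) :
    ∀ t ∈ Icc 0 T, eLpNorm (fun x => u t x - v t x) 2 (volume.restrict Ω) ≤
      ENNReal.ofReal (Real.sqrt (Real.exp ((2 * κ + 2 * |L| + 3) * T) * 2) * ε ^ k) := by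
  have hΩo := hΩ.isOpen
  have hb := hΩ.isBounded
  have hV := hΩ.volume_real_pos
  have hmean := integral_sub_eq_zero hΩ hT hf.continuous hv hu hφ hφ0
  obtain ⟨R, hRc, hReq, hDc, hRb, hDint⟩ := hv.exists_residual hΩ hf.continuous hT hε.le
  set K := 2 * κ + 2 * |L| + 3 with hK
  have hK0 : 0 ≤ K := by positivity
  have hη : 0 < (ε ^ k) ^ 2 := by positivity
  have hae := ae_sub_eq_initial hu
  have hy0 : ∫ x in Ω, (u 0 x - v 0 x) ^ 2 ≤ (ε ^ k) ^ 2 := by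
    have h1 : ∫ x in Ω, (u 0 x - v 0 x) ^ 2 = ∫ x in Ω, φ x ^ 2 :=
      integral_congr_ae (hae.mono fun _ hx => congrArg (· ^ 2) hx)
    rw [eLpNorm_two_eq_ofReal_sqrt hφ, ENNReal.ofReal_le_ofReal_iff (by positivity)] at hφk
    rw [h1]
    exact (Real.sqrt_le_left (by positivity)).1 hφk
  -- The threshold `exp (K T) * 4 ε^(2k)` is twice what Gronwall yields from `y 0 ≤ ε^(2k)` and `∫ D
  -- ≤ ε^(2k)`, so there is strict room below it.
  have hrate : ∀ t ∈ Ioo 0 T, (∫ x in Ω, (u t x - v t x) ^ 2) ≤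
      Real.exp (K * T) * (4 * (ε ^ k) ^ 2) →
      2 * ∫ x in Ω, (u t x - v t x) * (derivWithin (fun s => u s x) (Ioc 0 T) t -
        derivWithin (fun s => v s x) (Icc 0 T) t) ≤ K * (∫ x in Ω, (u t x - v t x) ^ 2) +
        ((∫ x in Ω, R t x ^ 2) - (volume.real Ω)⁻¹ * (∫ x in Ω, R t x) ^ 2) := by
    intro t ht hyt
    have htu : t ∈ Ioc 0 T := Ioo_subset_Ioc_self ht
    have htv : t ∈ Icc 0 T := Ioo_subset_Icc_self ht
    have hNu := hu.regular.isNeumannC2 hΩo hb hu.noFlux htu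
    have hNv := hv.regular.isNeumannC2 hΩo hb hv.noFlux htv
    have hw := hNu.sub hNv hΩo
    refine hw.two_mul_integral_mul_le hΩ hV (hmean t htv)
      (q := fun x => deriv f (v t x)) (N := fun x => f (u t x) - f (v t x)) (C := C₁) (s := s)
      (c := -((ε ^ 2)⁻¹ * ⨍ y in Ω, f (u t y)))
      (hv.regular.isBddContOn_comp hb (hf.continuous_deriv le_rfl) htv)
      ((hu.regular.isBddContOn_comp hb hf.continuous htu).sub
        (hv.regular.isBddContOn_comp hb hf.continuous htv)) (hRb t htv) hε hε1 hκ hs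
      (fun x hx => hL _ (hv.abs_le_two hΩo ht hx)) (fun x hx => ?_)
      (hw.neg_mul_integral_sq_le hΩo hb (hspec t htu) (hmean t htv)) (fun x hx => ?_) ?_
    · rw [hu.equation t htu x hx, hNu.laplacian_sub hNv hΩo hx, hReq t htv x hx]
      ring
    · have := hnl (v t x) (u t x - v t x) (hv.abs_le_two hΩo ht hx)
      rwa [add_sub_cancel] at this
    · have hy : 0 ≤ ∫ x in Ω, (u t x - v t x) ^ 2 := integral_nonneg fun x => sq_nonneg _
      have hG : 0 ≤ ∫ x in Ω, ‖fderiv ℝ (fun x => u t x - v t x) x‖ ^ 2 :=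
        integral_nonneg fun x => sq_nonneg _
      calc C₁ * ∫ x in Ω, |u t x - v t x| ^ s
          ≤ C₁ * (C₂ * (∫ x in Ω, (u t x - v t x) ^ 2) ^ r *
            ((∫ x in Ω, (u t x - v t x) ^ 2) +
              ∫ x in Ω, ‖fderiv ℝ (fun x => u t x - v t x) x‖ ^ 2)) := by
            gcongr
            exact hGN _ _ hw
        _ ≤ C₁ * (C₂ * (Real.exp (K * T) * (4 * (ε ^ k) ^ 2)) ^ r *
            ((∫ x in Ω, (u t x - v t x) ^ 2) +
              ∫ x in Ω, ‖fderiv ℝ (fun x => u t x - v t x) x‖ ^ 2)) := by gcongr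
        _ = C₁ * (C₂ * (Real.exp (K * T) * (4 * (ε ^ k) ^ 2)) ^ r) *
            ((∫ x in Ω, (u t x - v t x) ^ 2) +
              ∫ x in Ω, ‖fderiv ℝ (fun x => u t x - v t x) x‖ ^ 2) := by ring
        _ ≤ _ := by gcongr
  have hgron := le_of_deriv_le_below_threshold hT hK0
    (continuousOn_integral_sub hΩ hT hv.regular hu hφ).2 hDc
    (fun t ht => (hRb t ht).variance_nonneg hΩo hb hV)
    (fun t ht => (hasDerivAt_integral_sub hΩ hv.regular hu.regular ht).2) hrate hy0 hDint hη.le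
    (by
      have := Real.exp_pos (K * T)
      nlinarith [mul_pos this hη])
  intro t ht
  have hmem : MemLp (fun x => u t x - v t x) 2 (volume.restrict Ω) := by
    rcases ht.1.eq_or_lt with rfl | ht0
    · exact hφ.ae_eq hae.symm
    · exact ((hu.regular.isBddContOn_comp hb (g := fun s => s) continuous_id ⟨ht0, ht.2⟩).sub
        (hv.regular.isBddContOn_comp hb (g := fun s => s) continuous_id ht)).memLp_two hΩo hb
  rw [eLpNorm_two_eq_ofReal_sqrt hmem]
  refine ENNReal.ofReal_le_ofReal ?_
  refine (Real.sqrt_le_sqrt (hgron t ht)).trans_eq ?_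
  rw [← mul_assoc, Real.sqrt_mul (by positivity), Real.sqrt_sq (by positivity)]

end Difference

/-! ### Choice of `ε₀` and conclusion -/

/-- The surplus power `ε^(a - 4)` tends to zero and beats any constant `A`. -/
theorem exists_small_rpow (A : ℝ) {a : ℝ} (ha : 4 < a) :
    ∃ ε₀ ∈ Ioc (0 : ℝ) 1, ∀ ε ∈ Ioo (0 : ℝ) ε₀, A * ε ^ a ≤ ε ^ 4 := by
  have h1 : Tendsto (fun ε : ℝ => A * ε ^ (a - 4)) (𝓝 0) (𝓝 0) := by
    have := ((Real.continuousAt_rpow_const 0 (a - 4) (Or.inr (by linarith))).tendsto).const_mul A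
    rwa [Real.zero_rpow (by linarith), mul_zero] at this
  obtain ⟨δ, hδ, h2⟩ := Metric.eventually_nhds_iff.1 (h1.eventually (gt_mem_nhds zero_lt_one))
  refine ⟨min δ 1, ⟨lt_min hδ one_pos, min_le_right _ _⟩, fun ε hε => ?_⟩
  have h3 := h2 (y := ε) (by
    rw [Real.dist_eq, sub_zero, abs_of_pos hε.1]
    exact hε.2.trans_le (min_le_left _ _))
  have h4 : ε ^ a = ε ^ (a - 4) * ε ^ 4 := by
    rw [← Real.rpow_natCast, ← Real.rpow_add hε.1]
    norm_num
  rw [h4, ← mul_assoc]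
  exact mul_le_of_le_one_left (by have := hε.1; positivity) h3.le

end

theorem lemma2 (n : ℕ) (hn : 1 ≤ n) (Ω : Set (EuclideanSpace ℝ (Fin n)))
    (hΩ : IsSmoothBoundedDomain Ω) (f : ℝ → ℝ) (hf : IsBistable f)
    (k : ℕ) (hk : max 4 n < k) (T : ℝ) (hT : 0 < T) (Cstar : ℝ) (hCstar : 0 < Cstar) :
    ∃ C : ℝ, 0 < C ∧ ∃ ε₀ ∈ Ioc (0 : ℝ) 1,
      ∀ (v : ℝ → ℝ → EuclideanSpace ℝ (Fin n) → ℝ) (lam : ℝ → ℝ → ℝ)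
        (φ : ℝ → EuclideanSpace ℝ (Fin n) → ℝ) (u : ℝ → ℝ → EuclideanSpace ℝ (Fin n) → ℝ),
        (∀ ε ∈ Ioc (0 : ℝ) 1, IsApproxSolution Ω f ε T k (v ε) (lam ε)) →
        SpectralLowerBound Ω f T Cstar v →
        (∀ ε ∈ Ioc (0 : ℝ) 1, MemLp (φ ε) 2 (volume.restrict Ω) ∧
          ∫ x in Ω, φ ε x = 0 ∧
          eLpNorm (φ ε) 2 (volume.restrict Ω) ≤ ENNReal.ofReal (ε ^ k)) →
        (∀ ε ∈ Ioc (0 : ℝ) 1, IsSolution Ω f ε T (fun x => v ε 0 x + φ ε x) (u ε)) →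
        ∀ ε ∈ Ioo (0 : ℝ) ε₀,
          (⨆ t ∈ Icc 0 T, eLpNorm (fun x => u ε t x - v ε t x) 2 (volume.restrict Ω))
            ≤ ENNReal.ofReal (C * ε ^ k) := by
  -- `m ≥ 4` makes `p = 4 / m ≤ 1` in the Taylor estimate and ensures `m > 2`; `m ≥ n` is needed for
  -- Gagliardo–Nirenberg; `m < k` makes the exponent `4 k / m` exceed `4`.
  set m : ℝ := max 4 n with hm
  have hm4 : 4 ≤ m := le_max_left _ _
  have hm0 : 0 < m := by linarith
  have hmk : m < k := by
    rw [hm]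
    exact_mod_cast hk
  have hf1 : ContDiff ℝ 1 f := hf.contDiff.of_le (by norm_cast)
  obtain ⟨C₁, hC₁, hnl⟩ := hf.exists_mul_sub_le (p := 4 / m) (by positivity)
    (by rw [div_le_one hm0]; exact hm4)
  obtain ⟨C₂, hC₂, hGN⟩ := hΩ.exists_gagliardo_nirenberg (m := m) (by linarith) (le_max_right _ _)
  obtain ⟨L, hL⟩ := (isCompact_Icc (a := (-2 : ℝ)) (b := 2)).exists_bound_of_continuousOn
    (hf1.continuous_deriv le_rfl).continuousOn
  set E := Real.exp ((2 * Cstar + 2 * |L| + 3) * T) with hE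
  have hE0 : 0 < E := Real.exp_pos _
  obtain ⟨ε₀, hε₀, hsm⟩ := exists_small_rpow (C₁ * (C₂ * (E * 4) ^ (2 / m)))
    (a := k * (4 / m)) (by rw [mul_div_assoc', lt_div_iff₀ hm0]; linarith)
  -- Gronwall bounds `y` by `E * 2 ε^(2k)`; the constant is the square root of the prefactor.
  refine ⟨Real.sqrt (E * 2), by positivity, ε₀, hε₀, fun v lam φ u hv hspec hφ hu ε hε => ?_⟩
  have hεI : ε ∈ Ioc (0 : ℝ) 1 := ⟨hε.1, hε.2.le.trans hε₀.2⟩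
  obtain ⟨hφ1, hφ2, hφ3⟩ := hφ ε hεI
  refine iSup₂_le fun t ht => ?_
  refine eLpNorm_sub_le_of_small hΩ hT hf1 (hv ε hεI) (hu ε hεI) hφ1 hφ2 hφ3 hε.1 hεI.2
    hCstar.le (s := 2 + 4 / m) (r := 2 / m) (by positivity) (by positivity) hC₁ hC₂
    (fun t ht => hspec t ht ε hεI) (fun a ha => (le_abs_self _).trans (hL a (abs_le.1 ha)))
    (fun a b ha => hnl a b ha) (fun w A hw => ?_) ?_ t ht
  · obtain ⟨B, hB⟩ := hw.exists_bound hΩ.isBounded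
    exact hGN w (hw.contDiffOn.of_le (by norm_num)) ⟨B, fun x hx => hB x (subset_closure hx)⟩
      (hw.exists_bound_fderiv hΩ.isBounded)
  -- The threshold is of order `ε^(2k)`, so its power `2 / m` has the exponent `4 k / m` for which
  -- `ε₀` was chosen.
  · have h1 : (E * (4 * (ε ^ k) ^ 2)) ^ (2 / m) = (E * 4) ^ (2 / m) * ε ^ (k * (4 / m)) := by
      have hε0 := hε.1
      rw [← mul_assoc, Real.mul_rpow (by positivity) (by positivity), ← pow_mul,
        ← Real.rpow_natCast, ← Real.rpow_mul hε0.le]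
      congr 2
      push_cast
      ring
    rw [h1]
    calc _ = C₁ * (C₂ * (E * 4) ^ (2 / m)) * ε ^ (k * (4 / m)) := by ring
      _ ≤ ε ^ 4 := hsm ε hε
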